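/- Let $K$ be a commutative ring with unit and let $A=A_{\bar 0}\oplus A_{\bar 1}$ be an associative unital $K$-superalgebra that is free as a $K$-module with a $K$-basis containing $1$. A Lie superalgebra over $K$ is a supermodule $L=L_{\bar 0}\oplus L_{\bar 1}$ with an even bilinear bracket satisfying $[x,y]=-(-1)^{|x||y|}[y,x]$, $[x,[y,z]]=[[x,y],z]+(-1)^{|x||y|}[y,[x,z]]$ for homogeneous $x,y,z$, and $[x,x]=0$ for $x\in L_{\bar 0}$; homomorphisms are even. A central extension of $L$ is a surjective homomorphism onto $L$ with central kernel; it is universal if it maps to every central extension of $L$ by exactly one homomorphism over $L$. Give the indices $1,2,3$ parity $\bar 0$ and the index $4$ parity $\bar 1$. Let $\mathfrak{gl}(3,1,A)$ be the Lie superalgebra of $4\times 4$ matrices over $A$, with $|E_{ij}(a)|=|i|+|j|+|a|$ and the supercommutator, and $\mathfrak{sl}(3,1,A)=[\mathfrak{gl}(3,1,A),\mathfrak{gl}(3,1,A)]$. Let $\mathfrak{st}(3,1,A)$ be the Lie superalgebra generated by elements $F_{ij}(a)$ of parity $|i|+|j|+|a|$ ($1\le i\ne j\le 4$, $a\in A$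 homogeneous) with the relations: $a\mapsto F_{ij}(a)$ is $K$-linear; $[F_{ij}(a),F_{jk}(b)]=F_{ik}(ab)$ for distinct $i,j,k$; $[F_{ij}(a),F_{kl}(b)]=0$ for $j\neq k$, $i\ne l$. Let $\mathcal H\subseteq\mathfrak{st}(3,1,A)$ be the subalgebra generated by all $[F_{ij}(a),F_{ji}(b)]$. Let $A_2$ be the quotient of $A$ by the two-sided ideal generated by the elements $2a$ and $ab-(-1)^{|a||b|}ba$ ($a,b$ homogeneous), with $\bar a$ the class of $a$, and let $\Pi(A_2)$ be $A_2$ with the parity changed. Consider the quadruples $(i,j,k,l)$ of distinct elements of $\{1,2,3,4\}$ as elements of $S_4$, let $P_1,\dots,P_6$ be the left cosets of the Klein subgroup $\{(1,2,3,4),(3,2,1,4),(1,4,3,2),(3,4,1,2)\}$, and put $\theta(i,j,k,l)=m$ if $(i,j,k,l)\in P_m$. Let $\mathcal W=\Pi(A_2)^6$ and let $\epsilon_m\colon \Pi(A_2)\to \mathcal W$ be the inclusion of the $m$-th summand. Then there is exactly one $K$-bilinear map $\psi\colon\mathfrak{st}(3,1,A)\times\mathfrak{st}(3,1,A)\to\mathcal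 W$ such that $\psi(F_{ij}(a),F_{kl}(b))=\epsilon_{\theta(i,j,k,l)}(\overline{ab})$ for distinct $i,j,k,l$, $\psi(F_{ij}(a),F_{kl}(b))=0$ if $i\ne j$ and $k\ne l$ but $i,j,k,l$ are not all distinct, and $\psi(x,y)=0$ if $x$ or $y$ belongs to $\mathcal H$. This $\psi$ is an even super 2-cocycle, and for the Lie superalgebra $\mathfrak{st}(3,1,A)^\sharp=\mathfrak{st}(3,1,A)\oplus\mathcal W$ with bracket $[(x,w_1),(y,w_2)]=([x,y],\psi(x,y))$ the following hold. (1) The projection $\mathfrak{st}(3,1,A)^\sharp\to\mathfrak{st}(3,1,A)$, whose kernel is $\mathcal W$, is a universal central extension of $\mathfrak{st}(3,1,A)$. (2) There is a homomorphism $\varphi\colon\mathfrak{st}(3,1,A)\to\mathfrak{sl}(3,1,A)$ with $\varphi(F_{ij}(a))=E_{ij}(a)$, and the composite $\mathfrak{st}(3,1,A)^\sharp\to\mathfrak{st}(3,1,A)\to\mathfrak{sl}(3,1,A)$ is a universal central extension of $\mathfrak{sl}(3,1,A)$. (3) $H_2(\mathfrak{st}(3,1,A))\cong\mathcal W=\Pi(A_2)^6$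 as $K$-supermodules, where $H_2(L)$ is the kernel of the bracket map $L\otimes L\to L$ modulo the submodule spanned by $x\otimes y+(-1)^{|x||y|}y\otimes x$, $z\otimes z$ with $z\in L_{\bar 0}$, and $(-1)^{|x||t|}[x,y]\otimes t+(-1)^{|x||y|}[y,t]\otimes x+(-1)^{|y||t|}[t,x]\otimes y$ (all of $x,y,t$ homogeneous). -/

import Mathlib

open scoped TensorProduct

universe u v w

noncomputable section

namespace SuperLie

/-! ### Signs, supermodules, Lie superalgebras -/

/-- The sign `(-1)^{ij}` attached to two parities. -/
def koszul (i j : ZMod 2) : ℤ := (-1) ^ (i * j).val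

@[simp] theorem koszul_zero_left (j : ZMod 2) : koszul 0 j = 1 := by simp [koszul]

@[simp] theorem koszul_zero_right (j : ZMod 2) : koszul j 0 = 1 := by simp [koszul]

@[simp] theorem koszul_one_one : koszul 1 1 = -1 := by decide

theorem parity_cases (i : ZMod 2) : i = 0 ∨ i = 1 := by
  revert i; decide

theorem parity_add_self (i : ZMod 2) : i + i = 0 := by
  revert i; decide

/-- A `K`-supermodule: a `K`-module `M = M₀ ⊕ M₁`. -/
class Supermodule (K : Type*) (M : Type*) [CommRing K] [AddCommGroup M] [Module K M] where
  /-- the homogeneous part of a given parity -/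
  gr : ZMod 2 → Submodule K M
  isCompl : IsCompl (gr 0) (gr 1)

/-- The homogeneous part of parity `p` of a supermodule. -/
abbrev gr (K : Type*) {M : Type*} [CommRing K] [AddCommGroup M] [Module K M] [Supermodule K M]
    (p : ZMod 2) : Submodule K M := Supermodule.gr p

/-- A Lie superalgebra over an arbitrary commutative ring `K`. -/
class LieSuperalgebra (K : Type*) (L : Type*) [CommRing K] [AddCommGroup L] [Module K L]
    extends Supermodule K L where
  /-- the (bilinear) bracket -/
  bracket : L →ₗ[K] L →ₗ[K] L
  bracket_mem : ∀ {p q : ZMod 2} {x y : L}, x ∈ gr p → y ∈ gr q → bracket x y ∈ gr (p + q)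
  skew : ∀ {p q : ZMod 2} {x y : L}, x ∈ gr p → y ∈ gr q →
    bracket x y = -(koszul p q • bracket y x)
  jacobi : ∀ {p q r : ZMod 2} {x y z : L}, x ∈ gr p → y ∈ gr q → z ∈ gr r →
    bracket x (bracket y z) = bracket (bracket x y) z + koszul p q • bracket y (bracket x z)
  even_self : ∀ {x : L}, x ∈ gr 0 → bracket x x = 0

/-- The bracket `[x, y]` of a Lie superalgebra. -/
abbrev br (K : Type*) {L : Type*} [CommRing K] [AddCommGroup L] [Module K L]
    [LieSuperalgebra K L] (x y : L) : L := LieSuperalgebra.bracket (K := K) x y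

/-- Homomorphisms of Lie superalgebras: even linear maps that respect the bracket. -/
structure LieSuperHom (K : Type*) (L M : Type*) [CommRing K]
    [AddCommGroup L] [Module K L] [LieSuperalgebra K L]
    [AddCommGroup M] [Module K M] [LieSuperalgebra K M] extends L →ₗ[K] M where
  map_gr : ∀ (p : ZMod 2) (x : L), x ∈ gr K p → toFun x ∈ gr K p
  map_br : ∀ x y : L, toFun (br K x y) = br K (toFun x) (toFun y)

instance {K L M : Type*} [CommRing K]
    [AddCommGroup L] [Module K L] [LieSuperalgebra K L]
    [AddCommGroup M] [Module K M] [LieSuperalgebra K M] :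
    CoeFun (LieSuperHom K L M) (fun _ => L → M) := ⟨fun f => f.toLinearMap⟩

/-- Composition of homomorphisms. -/
def LieSuperHom.comp {K L M N : Type*} [CommRing K]
    [AddCommGroup L] [Module K L] [LieSuperalgebra K L]
    [AddCommGroup M] [Module K M] [LieSuperalgebra K M]
    [AddCommGroup N] [Module K N] [LieSuperalgebra K N]
    (g : LieSuperHom K M N) (f : LieSuperHom K L M) : LieSuperHom K L N where
  toLinearMap := g.toLinearMap.comp f.toLinearMap
  map_gr p x hx := g.map_gr p _ (f.map_gr p x hx)
  map_br x y := (congrArg g.toFun (f.map_br x y)).trans (g.map_br _ _)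

/-! ### Central extensions -/

/-- `f : E → L` is a central extension of `L`: it is onto and its kernel is central in `E`. -/
def IsCentralExtension {K E L : Type*} [CommRing K]
    [AddCommGroup E] [Module K E] [LieSuperalgebra K E]
    [AddCommGroup L] [Module K L] [LieSuperalgebra K L] (f : LieSuperHom K E L) : Prop :=
  Function.Surjective f ∧ ∀ x : E, f x = 0 → ∀ y : E, br K x y = 0

/-- `f : U → L` is a universal central extension: it is a central extension, and it maps in
exactly one way to every central extension `g : E → L` (with `E` in the universe `w`). -/
def IsUniversalCentralExtension.{w', u', v', v''} {K : Type u'} {U : Type v'} {L : Type v''}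
    [CommRing K]
    [AddCommGroup U] [Module K U] [LieSuperalgebra K U]
    [AddCommGroup L] [Module K L] [LieSuperalgebra K L] (f : LieSuperHom K U L) : Prop :=
  IsCentralExtension f ∧
    ∀ (E : Type w') [AddCommGroup E] [Module K E] [LieSuperalgebra K E]
      (g : LieSuperHom K E L), IsCentralExtension g → ∃! h : LieSuperHom K U E, g.comp h = f

/-- An even super 2-cocycle on `L` with values in the supermodule `W`. -/
structure IsEvenSuperCocycle {K L W : Type*} [CommRing K]
    [AddCommGroup L] [Module K L] [LieSuperalgebra K L]
    [AddCommGroup W] [Module K W] [Supermodule K W] (ψ : L →ₗ[K] L →ₗ[K] W) : Prop where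
  even : ∀ {p q : ZMod 2} {x y : L}, x ∈ gr K p → y ∈ gr K q → ψ x y ∈ gr K (p + q)
  skew : ∀ {p q : ZMod 2} {x y : L}, x ∈ gr K p → y ∈ gr K q →
    ψ x y = -(koszul p q • ψ y x)
  jacobi : ∀ {p q r : ZMod 2} {x y z : L}, x ∈ gr K p → y ∈ gr K q → z ∈ gr K r →
    koszul p r • ψ (br K x y) z + koszul p q • ψ (br K y z) x + koszul q r • ψ (br K z x) y = 0
  even_self : ∀ {x : L}, x ∈ gr K 0 → ψ x x = 0

section CocycleExtension

variable {K L W : Type*} [CommRing K]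
    [AddCommGroup L] [Module K L] [LieSuperalgebra K L]
    [AddCommGroup W] [Module K W] [Supermodule K W]

theorem isCompl_prod {M N : Type*} [AddCommGroup M] [Module K M] [AddCommGroup N] [Module K N]
    {a b : Submodule K M} {c d : Submodule K N} (h : IsCompl a b) (h' : IsCompl c d) :
    IsCompl (a.prod c) (b.prod d) := by
  constructor
  · rw [disjoint_iff, Submodule.prod_inf_prod, h.inf_eq_bot, h'.inf_eq_bot, Submodule.prod_bot]
  · rw [codisjoint_iff, Submodule.prod_sup_prod, h.sup_eq_top, h'.sup_eq_top, Submodule.prod_top]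

/-- The underlying module `L ⊕ W` of the central extension built from an even super
2-cocycle `ψ`. -/
def CocycleExt {ψ : L →ₗ[K] L →ₗ[K] W} (_ : IsEvenSuperCocycle ψ) : Type _ := L × W

variable {ψ : L →ₗ[K] L →ₗ[K] W} (hψ : IsEvenSuperCocycle ψ)

instance : AddCommGroup (CocycleExt hψ) := inferInstanceAs (AddCommGroup (L × W))
instance : Module K (CocycleExt hψ) := inferInstanceAs (Module K (L × W))

/-- The bracket `[(x, w₁), (y, w₂)] = ([x, y], ψ(x, y))` on `L ⊕ W`. -/
def cocycleBracket (ψ : L →ₗ[K] L →ₗ[K] W) : (L × W) →ₗ[K] (L × W) →ₗ[K] (L × W) :=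
  LinearMap.mk₂ K (fun x y => (br K x.1 y.1, ψ x.1 y.1))
    (by intros; simp [br]) (by intros; simp [br]) (by intros; simp [br]) (by intros; simp [br])

/-- The Lie superalgebra `L ⊕ W`. -/
instance : LieSuperalgebra K (CocycleExt hψ) where
  gr p := (gr K p : Submodule K L).prod (gr K p : Submodule K W)
  isCompl := isCompl_prod (Supermodule.isCompl (K := K) (M := L))
    (Supermodule.isCompl (K := K) (M := W))
  bracket := cocycleBracket ψ
  bracket_mem hx hy := ⟨LieSuperalgebra.bracket_mem hx.1 hy.1, hψ.even hx.1 hy.1⟩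
  skew hx hy := Prod.ext (LieSuperalgebra.skew hx.1 hy.1) (hψ.skew hx.1 hy.1)
  jacobi := by
    intro p q r x y z hx hy hz
    refine Prod.ext (LieSuperalgebra.jacobi hx.1 hy.1 hz.1) ?_
    have h1 := hψ.jacobi hx.1 hy.1 hz.1
    have h2 := hψ.skew (LieSuperalgebra.bracket_mem hy.1 hz.1) hx.1
    have h3 := hψ.skew (LieSuperalgebra.bracket_mem hz.1 hx.1) hy.1
    have h4 := LieSuperalgebra.skew (K := K) hz.1 hx.1
    change ψ x.1 (br K y.1 z.1) = ψ (br K x.1 y.1) z.1 + koszul p q • ψ y.1 (br K x.1 z.1)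
    unfold br at *
    rw [h2, h3, h4] at h1
    obtain rfl | rfl := parity_cases p <;> obtain rfl | rfl := parity_cases q <;>
      obtain rfl | rfl := parity_cases r <;>
      simp [parity_add_self] at h1 ⊢ <;> first
        | (rw [← sub_eq_zero, ← h1]; abel1)
        | (rw [← sub_eq_zero, ← neg_eq_zero, ← h1]; abel1)
  even_self hx := Prod.ext (LieSuperalgebra.even_self hx.1) (hψ.even_self hx.1)

/-- The projection `L ⊕ W → L`; its kernel is `W`. -/
def CocycleExt.proj : LieSuperHom K (CocycleExt hψ) L where
  toLinearMap := LinearMap.fst K L W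
  map_gr _ _ hx := hx.1
  map_br _ _ := rfl

end CocycleExtension

/-! ### Second homology -/

section Homology

variable (K L : Type*) [CommRing K] [AddCommGroup L] [Module K L] [LieSuperalgebra K L]

/-- The elements of `L ⊗ L` that vanish in the exterior square `Λ²L` (the first two families), and
the boundaries of the elements `x ∧ y ∧ z` (the third one). -/
inductive IsBoundaryGenerator : L ⊗[K] L → Prop
  | skew {p q : ZMod 2} {x y : L} (hx : x ∈ gr K p) (hy : y ∈ gr K q) :
      IsBoundaryGenerator (x ⊗ₜ y + koszul p q • (y ⊗ₜ x))
  | even_self {x : L} (hx : x ∈ gr K 0) : IsBoundaryGenerator (x ⊗ₜ x)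
  | jacobi {p q r : ZMod 2} {x y z : L} (hx : x ∈ gr K p) (hy : y ∈ gr K q) (hz : z ∈ gr K r) :
      IsBoundaryGenerator
        (koszul p r • (br K x y ⊗ₜ z) + koszul p q • (br K y z ⊗ₜ x)
          + koszul q r • (br K z x ⊗ₜ y))

/-- The preimage in `L ⊗ L` of the 2-boundaries, a submodule of `Λ²L`. -/
def boundaries₂ : Submodule K (L ⊗[K] L) := Submodule.span K {t | IsBoundaryGenerator K L t}

/-- The preimage in `L ⊗ L` of the 2-cycles, that is, of the kernel of
`Λ²L → L`, `x ∧ y ↦ [x, y]`. -/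
def cycles₂ : Submodule K (L ⊗[K] L) :=
  LinearMap.ker (TensorProduct.lift (LieSuperalgebra.bracket (K := K) (L := L)))

/-- The second homology `H₂(L)` with trivial coefficients: 2-cycles modulo 2-boundaries in the
Chevalley–Eilenberg complex `Λ³L → Λ²L → L`. -/
abbrev H₂ : Type _ := cycles₂ K L ⧸ (boundaries₂ K L).comap (cycles₂ K L).subtype

/-- The part of parity `p` of `L ⊗ L`. -/
def tensorGr (p : ZMod 2) : Submodule K (L ⊗[K] L) :=
  Submodule.span K {t | ∃ (q r : ZMod 2) (x y : L),
    q + r = p ∧ x ∈ gr K q ∧ y ∈ gr K r ∧ t = x ⊗ₜ y}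

/-- The part of parity `p` of `H₂(L)`: the classes of the cycles of parity `p`. -/
def H₂gr (p : ZMod 2) : Submodule K (H₂ K L) :=
  ((tensorGr K L p).comap (cycles₂ K L).subtype).map (Submodule.mkQ _)

end Homology

/-! ### Derived subalgebras -/

section Derived

theorem isCompl_comap_subtype {K M : Type*} [CommRing K] [AddCommGroup M] [Module K M]
    {a b N : Submodule K M} (h : IsCompl a b) (hN : N ≤ (N ⊓ a) ⊔ (N ⊓ b)) :
    IsCompl (a.comap N.subtype) (b.comap N.subtype) := by
  constructor
  · rw [Submodule.disjoint_def]
    intro x hx hy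
    exact Subtype.ext (Submodule.disjoint_def.1 h.disjoint x.1 hx hy)
  · rw [codisjoint_iff, eq_top_iff]
    rintro ⟨x, hx⟩ -
    obtain ⟨y, hy, z, hz, rfl⟩ := Submodule.mem_sup.1 (hN hx)
    exact Submodule.mem_sup.2 ⟨⟨y, hy.1⟩, hy.2, ⟨z, hz.1⟩, hz.2, rfl⟩

theorem exists_parts {K M : Type*} [CommRing K] [AddCommGroup M] [Module K M] [Supermodule K M]
    (x : M) : ∃ y ∈ (gr K 0 : Submodule K M), ∃ z ∈ (gr K 1 : Submodule K M), y + z = x :=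
  Submodule.mem_sup.1 (by
    rw [(Supermodule.isCompl (K := K) (M := M)).sup_eq_top]; trivial)

variable (K L : Type*) [CommRing K] [AddCommGroup L] [Module K L] [LieSuperalgebra K L]

/-- `[L, L]`, the submodule spanned by all brackets. -/
def derivedSubmodule : Submodule K L := Submodule.span K {z | ∃ x y : L, z = br K x y}

theorem br_mem_derived (x y : L) : br K x y ∈ derivedSubmodule K L :=
  Submodule.subset_span ⟨x, y, rfl⟩

theorem derived_homogeneous : derivedSubmodule K L ≤
    (derivedSubmodule K L ⊓ gr K 0) ⊔ (derivedSubmodule K L ⊓ gr K 1) := by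
  refine Submodule.span_le.2 ?_
  have key : ∀ (p q : ZMod 2) (x y : L), x ∈ gr K p → y ∈ gr K q → br K x y ∈
      (derivedSubmodule K L ⊓ gr K 0) ⊔ (derivedSubmodule K L ⊓ gr K 1) := by
    intro p q x y hx hy
    have h := LieSuperalgebra.bracket_mem (K := K) hx hy
    obtain h0 | h0 := parity_cases (p + q) <;> rw [h0] at h
    · exact Submodule.mem_sup_left ⟨br_mem_derived K L x y, h⟩
    · exact Submodule.mem_sup_right ⟨br_mem_derived K L x y, h⟩
  rintro _ ⟨x, y, rfl⟩
  obtain ⟨x0, hx0, x1, hx1, rfl⟩ := exists_parts (K := K) x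
  obtain ⟨y0, hy0, y1, hy1, rfl⟩ := exists_parts (K := K) y
  simp only [br, map_add, LinearMap.add_apply]
  exact add_mem (add_mem (key _ _ _ _ hx0 hy0) (key _ _ _ _ hx1 hy0))
    (add_mem (key _ _ _ _ hx0 hy1) (key _ _ _ _ hx1 hy1))

/-- The Lie superalgebra `[L, L]`. -/
abbrev Derived : Type _ := derivedSubmodule K L

instance : LieSuperalgebra K (Derived K L) where
  gr p := (gr K p : Submodule K L).comap (derivedSubmodule K L).subtype
  isCompl := isCompl_comap_subtype (Supermodule.isCompl (K := K) (M := L))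
    (derived_homogeneous K L)
  bracket := LinearMap.mk₂ K (fun x y => ⟨br K x.1 y.1, br_mem_derived K L _ _⟩)
    (by intros; ext; simp [br]) (by intros; ext; simp [br])
    (by intros; ext; simp [br]) (by intros; ext; simp [br])
  bracket_mem hx hy := LieSuperalgebra.bracket_mem (K := K) hx hy
  skew hx hy := Subtype.ext (LieSuperalgebra.skew (K := K) hx hy)
  jacobi hx hy hz := Subtype.ext (LieSuperalgebra.jacobi (K := K) hx hy hz)
  even_self hx := Subtype.ext (LieSuperalgebra.even_self (K := K) hx)

/-- The sub-superalgebra generated by a set `S`: the smallest submodule that contains `S` and is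
closed under the bracket. -/
def generatedSubalgebra (S : Set L) : Submodule K L :=
  sInf {N | S ⊆ N ∧ ∀ x ∈ N, ∀ y ∈ N, br K x y ∈ N}

end Derived

/-! ### Ideals generated by homogeneous elements, and the quotients -/

section Ideals

variable (K : Type*) {F : Type*} [CommRing K] [NonUnitalNonAssocRing F] [Module K F]

/-- The two-sided ideal generated by `S`. -/
def idealGen (S : Set F) : Submodule K F :=
  sInf {I | S ⊆ I ∧ ∀ x ∈ I, ∀ y : F, x * y ∈ I ∧ y * x ∈ I}

variable {K}

theorem subset_idealGen (S : Set F) : S ⊆ idealGen K S := by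
  intro s hs
  simp only [idealGen, SetLike.mem_coe, Submodule.mem_sInf]
  exact fun I hI => hI.1 hs

theorem idealGen_mul (S : Set F) {x : F} (hx : x ∈ idealGen K S) (y : F) :
    x * y ∈ idealGen K S ∧ y * x ∈ idealGen K S := by
  simp only [idealGen, Submodule.mem_sInf] at hx ⊢
  exact ⟨fun I hI => (hI.2 x (hx I hI) y).1, fun I hI => (hI.2 x (hx I hI) y).2⟩

theorem idealGen_le {S : Set F} {I : Submodule K F} (h : S ⊆ I)
    (h' : ∀ x ∈ I, ∀ y : F, x * y ∈ I ∧ y * x ∈ I) : idealGen K S ≤ I :=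
  sInf_le ⟨h, h'⟩

theorem idealGen_homogeneous (g : ZMod 2 → Submodule K F) (hg : IsCompl (g 0) (g 1))
    (hmul : ∀ {p q : ZMod 2} {x y : F}, x ∈ g p → y ∈ g q → x * y ∈ g (p + q))
    (S : Set F) (hS : ∀ s ∈ S, ∃ p, s ∈ g p) :
    idealGen K S ≤ (idealGen K S ⊓ g 0) ⊔ (idealGen K S ⊓ g 1) := by
  have hom : ∀ (p : ZMod 2) (x : F), x ∈ idealGen K S → x ∈ g p →
      x ∈ (idealGen K S ⊓ g 0) ⊔ (idealGen K S ⊓ g 1) := by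
    intro p x hx hp
    obtain rfl | rfl := parity_cases p
    · exact Submodule.mem_sup_left ⟨hx, hp⟩
    · exact Submodule.mem_sup_right ⟨hx, hp⟩
  refine idealGen_le (fun s hs => ?_) (fun x hx y => ?_)
  · obtain ⟨p, hp⟩ := hS s hs
    exact hom p s (subset_idealGen S hs) hp
  · obtain ⟨x0, hx0, x1, hx1, rfl⟩ := Submodule.mem_sup.1 hx
    obtain ⟨y0, hy0, y1, hy1, rfl⟩ :=
      Submodule.mem_sup.1 (hg.sup_eq_top ▸ Submodule.mem_top : y ∈ g 0 ⊔ g 1)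
    constructor
    · rw [add_mul, mul_add, mul_add]
      exact add_mem
        (add_mem (hom _ _ (idealGen_mul S hx0.1 _).1 (hmul hx0.2 hy0))
          (hom _ _ (idealGen_mul S hx0.1 _).1 (hmul hx0.2 hy1)))
        (add_mem (hom _ _ (idealGen_mul S hx1.1 _).1 (hmul hx1.2 hy0))
          (hom _ _ (idealGen_mul S hx1.1 _).1 (hmul hx1.2 hy1)))
    · rw [add_mul, mul_add, mul_add]
      exact add_mem
        (add_mem (hom _ _ (idealGen_mul S hx0.1 _).2 (hmul hy0 hx0.2))
          (hom _ _ (idealGen_mul S hx1.1 _).2 (hmul hy0 hx1.2)))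
        (add_mem (hom _ _ (idealGen_mul S hx0.1 _).2 (hmul hy1 hx0.2))
          (hom _ _ (idealGen_mul S hx1.1 _).2 (hmul hy1 hx1.2)))

theorem isCompl_map_mkQ {M : Type*} [AddCommGroup M] [Module K M]
    {a b I : Submodule K M} (h : IsCompl a b) (hI : I ≤ (I ⊓ a) ⊔ (I ⊓ b)) :
    IsCompl (a.map I.mkQ) (b.map I.mkQ) := by
  constructor
  · rw [Submodule.disjoint_def]
    rintro _ ⟨x, hx, rfl⟩ ⟨y, hy, hxy⟩
    have h1 : x - y ∈ I := by
      rw [← Submodule.ker_mkQ I, LinearMap.mem_ker, map_sub, hxy, sub_self]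
    obtain ⟨c, hc, d, hd, hcd⟩ := Submodule.mem_sup.1 (hI h1)
    have h2 : x - c = y + d := by
      rw [sub_eq_iff_eq_add, add_assoc, add_comm d c, hcd]; abel
    have h3 : x - c = 0 := Submodule.disjoint_def.1 h.disjoint _ (sub_mem hx hc.2)
      (h2 ▸ add_mem hy hd.2)
    have h4 : x ∈ I := by rw [sub_eq_zero.1 h3]; exact hc.1
    simpa using h4
  · rw [codisjoint_iff, ← Submodule.map_sup, h.sup_eq_top, Submodule.map_top,
      Submodule.range_mkQ]

end Ideals

/-! ### Lie superalgebras given by homogeneous generators and relations -/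

section Presentation

variable (K : Type*) [CommRing K] {X : Type*} (deg : X → ZMod 2)

/-- The parity of a nonassociative word. -/
def wordParity : FreeMagma X → ZMod 2
  | FreeMagma.of x => deg x
  | FreeMagma.mul a b => wordParity a + wordParity b

/-- The part of parity `p` of the free nonassociative algebra on `X`. -/
def freeGr (p : ZMod 2) : Submodule K (FreeNonUnitalNonAssocAlgebra K X) :=
  Submodule.span K {t | ∃ a : FreeMagma X, wordParity deg a = p ∧ t = MonoidAlgebra.single a 1}

theorem freeGr_coeff {p : ZMod 2} {x : FreeNonUnitalNonAssocAlgebra K X} (hx : x ∈ freeGr K deg p)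
    (a : FreeMagma X) (ha : wordParity deg a ≠ p) : x.coeff a = 0 := by
  induction hx using Submodule.span_induction with
  | mem x h =>
    obtain ⟨b, hb, rfl⟩ := h
    have : b ≠ a := by rintro rfl; exact ha hb
    simp [MonoidAlgebra.coeff_single, this]
  | zero => simp
  | add x y _ _ hx hy => simp [hx, hy]
  | smul c x _ hx => simp [hx]

theorem isCompl_freeGr : IsCompl (freeGr K deg 0) (freeGr K deg 1) := by
  constructor
  · rw [Submodule.disjoint_def]
    intro x h0 h1
    ext a
    obtain h | h := parity_cases (wordParity deg a)
    · exact freeGr_coeff K deg h1 a (by rw [h]; decide)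
    · exact freeGr_coeff K deg h0 a (by rw [h]; decide)
  · rw [codisjoint_iff, eq_top_iff]
    rintro x -
    induction x using MonoidAlgebra.induction_linear with
    | zero => exact zero_mem _
    | add x y hx hy => exact add_mem hx hy
    | single a c =>
      have h : (MonoidAlgebra.single a c : FreeNonUnitalNonAssocAlgebra K X)
          = c • MonoidAlgebra.single a 1 := by simp
      rw [h]
      refine Submodule.smul_mem _ _ ?_
      obtain h | h := parity_cases (wordParity deg a)
      · exact Submodule.mem_sup_left (Submodule.subset_span ⟨a, h, rfl⟩)
      · exact Submodule.mem_sup_right (Submodule.subset_span ⟨a, h, rfl⟩)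

theorem freeGr_mul {p q : ZMod 2} {x y : FreeNonUnitalNonAssocAlgebra K X}
    (hx : x ∈ freeGr K deg p) (hy : y ∈ freeGr K deg q) : x * y ∈ freeGr K deg (p + q) := by
  induction hx using Submodule.span_induction with
  | zero => simp
  | add x x' _ _ h h' => rw [add_mul]; exact add_mem h h'
  | smul c x _ h => rw [smul_mul_assoc]; exact Submodule.smul_mem _ _ h
  | mem x h =>
    obtain ⟨a, ha, rfl⟩ := h
    induction hy using Submodule.span_induction with
    | zero => simp
    | add y y' _ _ h h' => rw [mul_add]; exact add_mem h h'
    | smul c y _ h => rw [mul_smul_comm]; exact Submodule.smul_mem _ _ h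
    | mem y h =>
      obtain ⟨b, hb, rfl⟩ := h
      refine Submodule.subset_span ⟨a * b, ?_, by simp [MonoidAlgebra.single_mul_single]⟩
      rw [← ha, ← hb]; rfl

/-- The elements of the free nonassociative algebra that the axioms of a Lie superalgebra
require to vanish. -/
inductive IsLieSuperAxiom : FreeNonUnitalNonAssocAlgebra K X → Prop
  | skew {p q : ZMod 2} {x y : FreeNonUnitalNonAssocAlgebra K X}
      (hx : x ∈ freeGr K deg p) (hy : y ∈ freeGr K deg q) :
      IsLieSuperAxiom (x * y + koszul p q • (y * x))
  | jacobi {p q r : ZMod 2} {x y z : FreeNonUnitalNonAssocAlgebra K X}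
      (hx : x ∈ freeGr K deg p) (hy : y ∈ freeGr K deg q) (hz : z ∈ freeGr K deg r) :
      IsLieSuperAxiom (x * (y * z) - (x * y * z + koszul p q • (y * (x * z))))
  | even_self {x : FreeNonUnitalNonAssocAlgebra K X} (hx : x ∈ freeGr K deg 0) :
      IsLieSuperAxiom (x * x)

/-- A set of homogeneous relations. -/
def IsHomogeneousSet (R : Set (FreeNonUnitalNonAssocAlgebra K X)) : Prop :=
  ∀ r ∈ R, ∃ p, r ∈ freeGr K deg p

/-- The ideal of the free nonassociative algebra generated by the relations `R` and by the axioms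
of a Lie superalgebra. -/
def presentationIdeal (R : Set (FreeNonUnitalNonAssocAlgebra K X)) :
    Submodule K (FreeNonUnitalNonAssocAlgebra K X) :=
  idealGen K ({t | IsLieSuperAxiom K deg t} ∪ R)

theorem presentationIdeal_homogeneous {R : Set (FreeNonUnitalNonAssocAlgebra K X)}
    (hR : IsHomogeneousSet K deg R) :
    presentationIdeal K deg R ≤
      (presentationIdeal K deg R ⊓ freeGr K deg 0) ⊔
        (presentationIdeal K deg R ⊓ freeGr K deg 1) := by
  refine idealGen_homogeneous _ (isCompl_freeGr K deg) (freeGr_mul K deg) _ ?_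
  rintro s (hs | hs)
  · cases hs with
    | @skew p q x y hx hy =>
      exact ⟨p + q, add_mem (freeGr_mul K deg hx hy)
        (zsmul_mem (add_comm q p ▸ freeGr_mul K deg hy hx) _)⟩
    | @jacobi p q r x y z hx hy hz =>
      refine ⟨p + (q + r), sub_mem (freeGr_mul K deg hx (freeGr_mul K deg hy hz))
        (add_mem ?_ (zsmul_mem ?_ _))⟩
      · exact add_assoc p q r ▸ freeGr_mul K deg (freeGr_mul K deg hx hy) hz
      · exact add_left_comm q p r ▸ freeGr_mul K deg hy (freeGr_mul K deg hx hz)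
    | even_self hx => exact ⟨_, freeGr_mul K deg hx hx⟩
  · exact hR s hs

/-- The Lie superalgebra generated by the homogeneous elements of `X` subject to the homogeneous
relations `r = 0`, `r ∈ R`. -/
def Presented {R : Set (FreeNonUnitalNonAssocAlgebra K X)} (_ : IsHomogeneousSet K deg R) :
    Type _ := FreeNonUnitalNonAssocAlgebra K X ⧸ presentationIdeal K deg R

variable {R : Set (FreeNonUnitalNonAssocAlgebra K X)} (hR : IsHomogeneousSet K deg R)

instance : AddCommGroup (Presented K deg hR) :=
  inferInstanceAs (AddCommGroup (_ ⧸ presentationIdeal K deg R))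
instance : Module K (Presented K deg hR) :=
  inferInstanceAs (Module K (_ ⧸ presentationIdeal K deg R))

/-- The quotient map from the free nonassociative algebra. -/
def Presented.mk : FreeNonUnitalNonAssocAlgebra K X →ₗ[K] Presented K deg hR :=
  (presentationIdeal K deg R).mkQ

theorem Presented.mk_surjective : Function.Surjective (Presented.mk K deg hR) :=
  Submodule.mkQ_surjective _

theorem Presented.mk_eq_zero {x : FreeNonUnitalNonAssocAlgebra K X} :
    Presented.mk K deg hR x = 0 ↔ x ∈ presentationIdeal K deg R :=
  Submodule.Quotient.mk_eq_zero _

/-- The product of the free nonassociative algebra, with values in the quotient. -/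
def Presented.preBracket : FreeNonUnitalNonAssocAlgebra K X →ₗ[K]
    FreeNonUnitalNonAssocAlgebra K X →ₗ[K] Presented K deg hR :=
  (LinearMap.mul K (FreeNonUnitalNonAssocAlgebra K X)).compr₂ (Presented.mk K deg hR)

/-- The product with the left factor in the quotient. -/
def Presented.halfBracket : Presented K deg hR →ₗ[K]
    FreeNonUnitalNonAssocAlgebra K X →ₗ[K] Presented K deg hR :=
  (presentationIdeal K deg R).liftQ (Presented.preBracket K deg hR) fun _ hx =>
    LinearMap.ext fun y => (Presented.mk_eq_zero K deg hR).2
      (idealGen_mul (K := K) ({t | IsLieSuperAxiom K deg t} ∪ R) hx y).1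

/-- The bracket on a presented Lie superalgebra, induced by the product of the free
nonassociative algebra. -/
def Presented.bracket :
    Presented K deg hR →ₗ[K] Presented K deg hR →ₗ[K] Presented K deg hR :=
  ((presentationIdeal K deg R).liftQ (Presented.halfBracket K deg hR).flip fun y hy =>
    LinearMap.ext fun x => by
      obtain ⟨x, rfl⟩ := Presented.mk_surjective K deg hR x
      exact (Presented.mk_eq_zero K deg hR).2
        (idealGen_mul (K := K) ({t | IsLieSuperAxiom K deg t} ∪ R) hy x).2).flip

theorem Presented.bracket_mk (x y : FreeNonUnitalNonAssocAlgebra K X) :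
    Presented.bracket K deg hR (Presented.mk K deg hR x) (Presented.mk K deg hR y)
      = Presented.mk K deg hR (x * y) := rfl

theorem Presented.mk_axiom {x : FreeNonUnitalNonAssocAlgebra K X} (hx : IsLieSuperAxiom K deg x) :
    Presented.mk K deg hR x = 0 :=
  (Presented.mk_eq_zero K deg hR).2 (subset_idealGen _ (Or.inl hx))

instance : LieSuperalgebra K (Presented K deg hR) where
  gr p := (freeGr K deg p).map (Presented.mk K deg hR)
  isCompl := isCompl_map_mkQ (isCompl_freeGr K deg) (presentationIdeal_homogeneous K deg hR)
  bracket := Presented.bracket K deg hR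
  bracket_mem := by
    rintro p q _ _ ⟨x, hx, rfl⟩ ⟨y, hy, rfl⟩
    exact ⟨x * y, freeGr_mul K deg hx hy, rfl⟩
  skew := by
    rintro p q _ _ ⟨x, hx, rfl⟩ ⟨y, hy, rfl⟩
    have h := Presented.mk_axiom K deg hR (.skew hx hy)
    rw [map_add, map_zsmul] at h
    exact eq_neg_of_add_eq_zero_left h
  jacobi := by
    rintro p q r _ _ _ ⟨x, hx, rfl⟩ ⟨y, hy, rfl⟩ ⟨z, hz, rfl⟩
    have h := Presented.mk_axiom K deg hR (.jacobi hx hy hz)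
    rw [map_sub, map_add, map_zsmul] at h
    exact sub_eq_zero.1 h
  even_self := by
    rintro _ ⟨x, hx, rfl⟩
    exact Presented.mk_axiom K deg hR (.even_self hx)

end Presentation

/-! ### The Lie superalgebras attached to an associative superalgebra -/

/-- The parity of the indices: the first `m` are even, the last `n` are odd. -/
def indexParity (m n : ℕ) (i : Fin (m + n)) : ZMod 2 := if i.val < m then 0 else 1

section Matrices

variable {K : Type u} [CommRing K] {A : Type v} [Ring A] [Algebra K A]
  {I : Type*} (par : I → ZMod 2) (𝒜 : ZMod 2 → Submodule K A)

theorem isCompl_of_gradedAlgebra [GradedAlgebra 𝒜] : IsCompl (𝒜 0) (𝒜 1) :=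
  (DirectSum.isInternal_submodule_iff_isCompl 𝒜 (i := 0) (j := 1) (by decide)
    (by ext i; simpa using parity_cases i)).1 (DirectSum.Decomposition.isInternal 𝒜)

/-- The module of `I × I` matrices over `A`, where `I` is a graded index set. -/
@[nolint unusedArguments]
def SuperGL (_par : I → ZMod 2) (_𝒜 : ZMod 2 → Submodule K A) : Type _ := Matrix I I A

instance : AddCommGroup (SuperGL par 𝒜) := inferInstanceAs (AddCommGroup (Matrix I I A))
instance : Module K (SuperGL par 𝒜) := inferInstanceAs (Module K (Matrix I I A))

/-- The matrix `E_{ij}(a)`. -/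
def matrixUnit [DecidableEq I] (i j : I) (a : A) : SuperGL par 𝒜 := (Matrix.single i j a : Matrix I I A)

/-- The matrices of parity `p`: `E_{ij}(a)` has parity `|i| + |j| + |a|`. -/
def glGr (p : ZMod 2) : Submodule K (Matrix I I A) where
  carrier := {x | ∀ i j, x i j ∈ 𝒜 (par i + par j + p)}
  add_mem' hx hy i j := add_mem (hx i j) (hy i j)
  zero_mem' _ _ := zero_mem _
  smul_mem' c _ hx i j := Submodule.smul_mem _ c (hx i j)

variable [GradedAlgebra 𝒜]

/-- The component of parity `p` of a matrix. -/
def glProj (p : ZMod 2) : Matrix I I A →ₗ[K] Matrix I I A where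
  toFun x := Matrix.of fun i j => GradedAlgebra.proj 𝒜 (par i + par j + p) (x i j)
  map_add' x y := by ext i j; simp
  map_smul' c x := by ext i j; simp

theorem glProj_mem (p : ZMod 2) (x : Matrix I I A) : glProj par 𝒜 p x ∈ glGr par 𝒜 p :=
  fun i j => by
    simp only [glProj, LinearMap.coe_mk, AddHom.coe_mk, Matrix.of_apply, GradedAlgebra.proj_apply]
    exact SetLike.coe_mem _

theorem glProj_same {p : ZMod 2} {x : Matrix I I A} (hx : x ∈ glGr par 𝒜 p) :
    glProj par 𝒜 p x = x := by
  ext i j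
  simp only [glProj, LinearMap.coe_mk, AddHom.coe_mk, Matrix.of_apply, GradedAlgebra.proj_apply]
  exact DirectSum.decompose_of_mem_same 𝒜 (hx i j)

theorem glProj_ne {p q : ZMod 2} (h : p ≠ q) {x : Matrix I I A} (hx : x ∈ glGr par 𝒜 p) :
    glProj par 𝒜 q x = 0 := by
  ext i j
  simp only [glProj, LinearMap.coe_mk, AddHom.coe_mk, Matrix.of_apply, GradedAlgebra.proj_apply]
  exact DirectSum.decompose_of_mem_ne 𝒜 (hx i j) (fun h' => h (add_left_cancel h'))

theorem isCompl_glGr : IsCompl (glGr par 𝒜 0) (glGr par 𝒜 1) := by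
  constructor
  · rw [Submodule.disjoint_def]
    intro x h0 h1
    rw [← glProj_same par 𝒜 h0]
    exact glProj_ne par 𝒜 (by decide) h1
  · rw [codisjoint_iff, eq_top_iff]
    rintro x -
    refine Submodule.mem_sup.2 ⟨_, glProj_mem par 𝒜 0 x, _, glProj_mem par 𝒜 1 x, ?_⟩
    ext i j
    obtain ⟨y, hy, z, hz, hyz⟩ := Submodule.mem_sup.1
      ((isCompl_of_gradedAlgebra 𝒜).sup_eq_top ▸ Submodule.mem_top : x i j ∈ 𝒜 0 ⊔ 𝒜 1)
    simp only [glProj, LinearMap.coe_mk, AddHom.coe_mk, Matrix.of_apply, Matrix.add_apply,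
      GradedAlgebra.proj_apply, ← hyz, DirectSum.decompose_add, DirectSum.add_apply,
      Submodule.coe_add]
    obtain h | h := parity_cases (par i + par j) <;> rw [h]
    · rw [zero_add, zero_add, DirectSum.decompose_of_mem_same 𝒜 hy,
        DirectSum.decompose_of_mem_same 𝒜 hz, DirectSum.decompose_of_mem_ne 𝒜 hy (by decide),
        DirectSum.decompose_of_mem_ne 𝒜 hz (by decide)]
      abel
    · rw [add_zero, parity_add_self, DirectSum.decompose_of_mem_same 𝒜 hy,
        DirectSum.decompose_of_mem_same 𝒜 hz, DirectSum.decompose_of_mem_ne 𝒜 hy (by decide),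
        DirectSum.decompose_of_mem_ne 𝒜 hz (by decide)]
      abel

variable [Fintype I]

/-- The supercommutator, `[x, y] = x y - (-1)^{|x||y|} y x` for homogeneous `x` and `y`, extended
bilinearly. -/
def glBracket : Matrix I I A →ₗ[K] Matrix I I A →ₗ[K] Matrix I I A :=
  LinearMap.mk₂ K
    (fun x y => ∑ p : ZMod 2, ∑ q : ZMod 2,
      (glProj par 𝒜 p x * glProj par 𝒜 q y
        - koszul p q • (glProj par 𝒜 q y * glProj par 𝒜 p x)))
    (by
      intro x x' y
      simp only [map_add, add_mul, mul_add, smul_add, ← Finset.sum_add_distrib]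
      refine Finset.sum_congr rfl fun p _ => Finset.sum_congr rfl fun q _ => ?_
      abel)
    (by
      intro c x y
      simp only [map_smul, smul_mul_assoc, mul_smul_comm, Finset.smul_sum, smul_sub,
        smul_comm c])
    (by
      intro x y y'
      simp only [map_add, add_mul, mul_add, smul_add, ← Finset.sum_add_distrib]
      refine Finset.sum_congr rfl fun p _ => Finset.sum_congr rfl fun q _ => ?_
      abel)
    (by
      intro c x y
      simp only [map_smul, smul_mul_assoc, mul_smul_comm, Finset.smul_sum, smul_sub,
        smul_comm c])

theorem glGr_mul {p q : ZMod 2} {x y : Matrix I I A} (hx : x ∈ glGr par 𝒜 p)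
    (hy : y ∈ glGr par 𝒜 q) : x * y ∈ glGr par 𝒜 (p + q) := by
  intro i j
  rw [Matrix.mul_apply]
  refine sum_mem fun k _ => ?_
  have h := SetLike.mul_mem_graded (hx i k) (hy k j)
  have e : par i + par k + p + (par k + par j + q) = par i + par j + (p + q) := by
    linear_combination parity_add_self (par k)
  rwa [e] at h

/-- On homogeneous matrices the bracket is the supercommutator. -/
theorem glBracket_of_mem {p q : ZMod 2} {x y : Matrix I I A} (hx : x ∈ glGr par 𝒜 p)
    (hy : y ∈ glGr par 𝒜 q) : glBracket par 𝒜 x y = x * y - koszul p q • (y * x) := by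
  simp only [glBracket, LinearMap.mk₂_apply]
  rw [Finset.sum_eq_single p, Finset.sum_eq_single q, glProj_same par 𝒜 hx, glProj_same par 𝒜 hy]
  · intro r _ hr
    simp [glProj_ne par 𝒜 hr.symm hy]
  · simp
  · intro r _ hr
    simp [glProj_ne par 𝒜 hr.symm hx]
  · simp

theorem glBracket_mem {p q : ZMod 2} {x y : Matrix I I A} (hx : x ∈ glGr par 𝒜 p)
    (hy : y ∈ glGr par 𝒜 q) : glBracket par 𝒜 x y ∈ glGr par 𝒜 (p + q) := by
  rw [glBracket_of_mem par 𝒜 hx hy]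
  exact sub_mem (glGr_mul par 𝒜 hx hy) (zsmul_mem (add_comm q p ▸ glGr_mul par 𝒜 hy hx) _)

theorem glBracket_skew {p q : ZMod 2} {x y : Matrix I I A} (hx : x ∈ glGr par 𝒜 p)
    (hy : y ∈ glGr par 𝒜 q) :
    glBracket par 𝒜 x y = -(koszul p q • glBracket par 𝒜 y x) := by
  rw [glBracket_of_mem par 𝒜 hx hy, glBracket_of_mem par 𝒜 hy hx]
  obtain rfl | rfl := parity_cases p <;> obtain rfl | rfl := parity_cases q <;>
    simp [add_comm]

theorem glBracket_jacobi {p q r : ZMod 2} {x y z : Matrix I I A} (hx : x ∈ glGr par 𝒜 p)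
    (hy : y ∈ glGr par 𝒜 q) (hz : z ∈ glGr par 𝒜 r) :
    glBracket par 𝒜 x (glBracket par 𝒜 y z) = glBracket par 𝒜 (glBracket par 𝒜 x y) z
      + koszul p q • glBracket par 𝒜 y (glBracket par 𝒜 x z) := by
  have hxy := glBracket_mem par 𝒜 hx hy
  have hyz := glBracket_mem par 𝒜 hy hz
  have hxz := glBracket_mem par 𝒜 hx hz
  rw [glBracket_of_mem par 𝒜 hx hyz, glBracket_of_mem par 𝒜 hxy hz,
    glBracket_of_mem par 𝒜 hy hxz, glBracket_of_mem par 𝒜 hx hy,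
    glBracket_of_mem par 𝒜 hy hz, glBracket_of_mem par 𝒜 hx hz]
  obtain rfl | rfl := parity_cases p <;> obtain rfl | rfl := parity_cases q <;>
    obtain rfl | rfl := parity_cases r <;>
    simp [parity_add_self, mul_add, add_mul, mul_sub, sub_mul, mul_assoc] <;> abel1

theorem glBracket_even_self {x : Matrix I I A} (hx : x ∈ glGr par 𝒜 0) :
    glBracket par 𝒜 x x = 0 := by
  rw [glBracket_of_mem par 𝒜 hx hx]
  simp

/-- The Lie superalgebra `gl`. -/
instance : LieSuperalgebra K (SuperGL par 𝒜) where
  gr p := glGr par 𝒜 p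
  isCompl := isCompl_glGr par 𝒜
  bracket := glBracket par 𝒜
  bracket_mem hx hy := glBracket_mem par 𝒜 hx hy
  skew hx hy := glBracket_skew par 𝒜 hx hy
  jacobi hx hy hz := glBracket_jacobi par 𝒜 hx hy hz
  even_self hx := glBracket_even_self par 𝒜 hx

/-- The Lie superalgebra `sl = [gl, gl]`. -/
abbrev SuperSL : Type _ := Derived K (SuperGL par 𝒜)

end Matrices

/-! ### The Steinberg Lie superalgebra -/

section SteinbergAlgebra

variable {K : Type u} [CommRing K] {A : Type v} [Ring A] [Algebra K A]
  {I : Type*} (par : I → ZMod 2) (𝒜 : ZMod 2 → Submodule K A)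

/-- The generators `F_{ij}(a)`, `i ≠ j`, `a` homogeneous. -/
structure SteinbergGenerator (I : Type*) (𝒜 : ZMod 2 → Submodule K A) where
  i : I
  j : I
  ne : i ≠ j
  p : ZMod 2
  a : 𝒜 p

/-- `|F_{ij}(a)| = |i| + |j| + |a|`. -/
def SteinbergGenerator.deg (g : SteinbergGenerator I 𝒜) : ZMod 2 := par g.i + par g.j + g.p

/-- The generator `F_{ij}(a)`, `a` of parity `p`, in the free nonassociative algebra. -/
def freeF {i j : I} (h : i ≠ j) (p : ZMod 2) (a : 𝒜 p) :
    FreeNonUnitalNonAssocAlgebra K (SteinbergGenerator I 𝒜) :=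
  FreeNonUnitalNonAssocAlgebra.of K ⟨i, j, h, p, a⟩

theorem freeF_mem {i j : I} (h : i ≠ j) (p : ZMod 2) (a : 𝒜 p) :
    freeF 𝒜 h p a ∈ freeGr K (SteinbergGenerator.deg par 𝒜) (par i + par j + p) :=
  Submodule.subset_span ⟨FreeMagma.of ⟨i, j, h, p, a⟩, rfl, rfl⟩

variable [GradedAlgebra 𝒜]

/-- The relations of the Steinberg Lie superalgebra: `a ↦ F_{ij}(a)` is linear,
`[F_{ij}(a), F_{jk}(b)] = F_{ik}(ab)` for distinct `i, j, k`, and `[F_{ij}(a), F_{kl}(b)] = 0` for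
`j ≠ k`, `i ≠ l`. -/
inductive IsSteinbergRelation : FreeNonUnitalNonAssocAlgebra K (SteinbergGenerator I 𝒜) → Prop
  | add {i j : I} (h : i ≠ j) (p : ZMod 2) (a b : 𝒜 p) :
      IsSteinbergRelation (freeF 𝒜 h p (a + b) - (freeF 𝒜 h p a + freeF 𝒜 h p b))
  | smul {i j : I} (h : i ≠ j) (p : ZMod 2) (c : K) (a : 𝒜 p) :
      IsSteinbergRelation (freeF 𝒜 h p (c • a) - c • freeF 𝒜 h p a)
  | mul {i j k : I} (hij : i ≠ j) (hjk : j ≠ k) (hik : i ≠ k) (p q : ZMod 2) (a : 𝒜 p) (b : 𝒜 q) :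
      IsSteinbergRelation (freeF 𝒜 hij p a * freeF 𝒜 hjk q b
        - freeF 𝒜 hik (p + q) ⟨a.1 * b.1, SetLike.mul_mem_graded a.2 b.2⟩)
  | comm {i j k l : I} (hij : i ≠ j) (hkl : k ≠ l) (hjk : j ≠ k) (hil : i ≠ l) (p q : ZMod 2)
      (a : 𝒜 p) (b : 𝒜 q) :
      IsSteinbergRelation (freeF 𝒜 hij p a * freeF 𝒜 hkl q b)

theorem steinbergRelations_homogeneous :
    IsHomogeneousSet K (SteinbergGenerator.deg par 𝒜) {t | IsSteinbergRelation 𝒜 t} := by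
  intro t ht
  cases ht with
  | add h p a b =>
    exact ⟨_, sub_mem (freeF_mem par 𝒜 h p _)
      (add_mem (freeF_mem par 𝒜 h p _) (freeF_mem par 𝒜 h p _))⟩
  | smul h p c a =>
    exact ⟨_, sub_mem (freeF_mem par 𝒜 h p _) (Submodule.smul_mem _ c (freeF_mem par 𝒜 h p _))⟩
  | @mul i j k hij hjk hik p q a b =>
    refine ⟨_, sub_mem (freeGr_mul K _ (freeF_mem par 𝒜 hij p a) (freeF_mem par 𝒜 hjk q b)) ?_⟩
    have e : par i + par j + p + (par j + par k + q) = par i + par k + (p + q) := by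
      linear_combination parity_add_self (par j)
    rw [e]
    exact freeF_mem par 𝒜 hik (p + q) _
  | comm hij hkl hjk hil p q a b =>
    exact ⟨_, freeGr_mul K _ (freeF_mem par 𝒜 hij p a) (freeF_mem par 𝒜 hkl q b)⟩

/-- The Steinberg Lie superalgebra `st`. -/
abbrev Steinberg : Type _ :=
  Presented K (SteinbergGenerator.deg par 𝒜) (steinbergRelations_homogeneous par 𝒜)

/-- The element `F_{ij}(a)` of `st`, for an arbitrary `a ∈ A`: the sum of `F_{ij}(a₀)` and
`F_{ij}(a₁)`, where `a = a₀ + a₁` with `a₀` even and `a₁` odd. -/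
def stF {i j : I} (h : i ≠ j) (a : A) : Steinberg par 𝒜 :=
  ∑ p : ZMod 2, Presented.mk K (SteinbergGenerator.deg par 𝒜)
    (steinbergRelations_homogeneous par 𝒜) (freeF 𝒜 h p (DirectSum.decompose 𝒜 a p))

/-- `H_{ij}(a, b) = [F_{ij}(a), F_{ji}(b)]`. -/
def stH {i j : I} (h : i ≠ j) (a b : A) : Steinberg par 𝒜 := br K (stF par 𝒜 h a) (stF par 𝒜 h.symm b)

/-- The subalgebra of `st` generated by all `H_{ij}(a, b)`. -/
def stCartan : Submodule K (Steinberg par 𝒜) :=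
  generatedSubalgebra K (Steinberg par 𝒜)
    {x | ∃ (i j : I) (h : i ≠ j) (a b : A), x = stH par 𝒜 h a b}

end SteinbergAlgebra

/-! ### The supermodule `Π(A₂)⁶` -/

section Coefficients

variable {K : Type u} [CommRing K] {A : Type v} [Ring A] [Algebra K A]
  (𝒜 : ZMod 2 → Submodule K A) [GradedAlgebra 𝒜]

/-- The elements `m a` and `a b - (-1)^{|a||b|} b a`, for homogeneous `a` and `b`. -/
inductive IsSuperIdealGenerator (m : ℕ) : A → Prop
  | smul (p : ZMod 2) (a : A) (ha : a ∈ 𝒜 p) : IsSuperIdealGenerator m (m • a)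
  | comm (p q : ZMod 2) (a b : A) (ha : a ∈ 𝒜 p) (hb : b ∈ 𝒜 q) :
      IsSuperIdealGenerator m (a * b - koszul p q • (b * a))

/-- The ideal `𝓘_m` of `A` generated by these elements. -/
def superIdeal (m : ℕ) : Submodule K A := idealGen K {a | IsSuperIdealGenerator 𝒜 m a}

/-- The quotient `A_m = A / 𝓘_m`. -/
abbrev SuperQuotient (m : ℕ) : Type _ := A ⧸ superIdeal 𝒜 m

theorem superIdeal_homogeneous (m : ℕ) :
    superIdeal 𝒜 m ≤ (superIdeal 𝒜 m ⊓ 𝒜 0) ⊔ (superIdeal 𝒜 m ⊓ 𝒜 1) := by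
  refine idealGen_homogeneous 𝒜 (isCompl_of_gradedAlgebra 𝒜)
    (fun hx hy => SetLike.mul_mem_graded hx hy) _ ?_
  intro s hs
  cases hs with
  | smul p a ha => exact ⟨p, nsmul_mem ha m⟩
  | comm p q a b ha hb =>
    exact ⟨p + q, sub_mem (SetLike.mul_mem_graded ha hb)
      (zsmul_mem (add_comm q p ▸ SetLike.mul_mem_graded hb ha) _)⟩

instance (m : ℕ) : Supermodule K (SuperQuotient 𝒜 m) where
  gr p := (𝒜 p).map (superIdeal 𝒜 m).mkQ
  isCompl := isCompl_map_mkQ (isCompl_of_gradedAlgebra 𝒜) (superIdeal_homogeneous 𝒜 m)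

/-- The supermodule `Π(M)`: the module `M` with the parity changed. -/
def ParityShift (M : Type*) : Type _ := M

instance {M : Type*} [AddCommGroup M] : AddCommGroup (ParityShift M) :=
  inferInstanceAs (AddCommGroup M)
instance {M : Type*} [AddCommGroup M] [Module K M] : Module K (ParityShift M) :=
  inferInstanceAs (Module K M)
instance {M : Type*} [AddCommGroup M] [Module K M] [Supermodule K M] :
    Supermodule K (ParityShift M) where
  gr p := (gr K (p + 1) : Submodule K M)
  isCompl := (Supermodule.isCompl (K := K) (M := M)).symm

/-- A power of a supermodule. -/
instance {ι M : Type*} [AddCommGroup M] [Module K M] [Supermodule K M] :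
    Supermodule K (ι → M) where
  gr p := Submodule.pi Set.univ fun _ => gr K p
  isCompl := by
    constructor
    · rw [Submodule.disjoint_def]
      intro x h0 h1
      ext i
      exact Submodule.disjoint_def.1 (Supermodule.isCompl (K := K) (M := M)).disjoint _
        (h0 i trivial) (h1 i trivial)
    · rw [codisjoint_iff, eq_top_iff]
      rintro x -
      choose y hy z hz h using fun i => exists_parts (K := K) (x i)
      exact Submodule.mem_sup.2 ⟨y, fun i _ => hy i, z, fun i _ => hz i, funext h⟩

/-- The Klein subgroup of the symmetric group on four letters (numbered from `0` to `3`). A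
permutation `σ` stands for the quadruple `(σ 0, σ 1, σ 2, σ 3)`, and the elements of the subgroup
are the quadruples `(0,1,2,3)`, `(2,1,0,3)`, `(0,3,2,1)` and `(2,3,0,1)`. -/
def kleinSubgroup : Subgroup (Equiv.Perm (Fin 4)) where
  carrier := {1, Equiv.swap 0 2, Equiv.swap 1 3, Equiv.swap 0 2 * Equiv.swap 1 3}
  one_mem' := by simp
  mul_mem' := by
    rintro a b (rfl | rfl | rfl | rfl) (rfl | rfl | rfl | rfl) <;>
      simp only [Set.mem_insert_iff, Set.mem_singleton_iff] <;> decide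
  inv_mem' := by
    rintro a (rfl | rfl | rfl | rfl) <;>
      simp only [Set.mem_insert_iff, Set.mem_singleton_iff] <;> decide

/-- The supermodule `W = Π(A₂)⁶`, with one copy of `Π(A₂)` for each of the six cosets of the Klein
subgroup. -/
abbrev WModule : Type _ :=
  (Equiv.Perm (Fin 4) ⧸ kleinSubgroup) → ParityShift (SuperQuotient 𝒜 2)

open Classical in
/-- `ε_{θ(σ)}(ā)`: the class of `a` in the copy attached to the coset of the quadruple `σ`, and zero
in the other ones. -/
def epsilon (σ : Equiv.Perm (Fin 4)) (a : A) : WModule 𝒜 :=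
  Pi.single (QuotientGroup.mk σ) (show ParityShift (SuperQuotient 𝒜 2) from (superIdeal 𝒜 2).mkQ a)

/-- The parity of the four indices for `(m, n) = (3, 1)`: the first three are even, the last one is
odd. -/
abbrev par31 : Fin 4 → ZMod 2 := indexParity 3 1

/-- The description of the bilinear map `ψ : st(3,1,A) × st(3,1,A) → W` on the summands of
`st(3,1,A) = 𝓝⁺ ⊕ 𝓗 ⊕ 𝓝⁻`: `ψ(F_{ij}(a), F_{kl}(b))` is the class of `ab` in the copy attached to
the coset of `(i,j,k,l)` if `i, j, k, l` are distinct and zero otherwise, and `ψ(x, y) = 0` if `x`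
or `y` belongs to `𝓗`. -/
structure IsSteinbergCocycle (ψ : Steinberg par31 𝒜 →ₗ[K] Steinberg par31 𝒜 →ₗ[K] WModule 𝒜) : Prop where
  distinct : ∀ (σ : Equiv.Perm (Fin 4)) (h : σ 0 ≠ σ 1) (h' : σ 2 ≠ σ 3) (a b : A),
    ψ (stF par31 𝒜 h a) (stF par31 𝒜 h' b) = epsilon 𝒜 σ (a * b)
  not_distinct : ∀ (i j k l : Fin 4) (h : i ≠ j) (h' : k ≠ l) (a b : A),
    (i = k ∨ i = l ∨ j = k ∨ j = l) → ψ (stF par31 𝒜 h a) (stF par31 𝒜 h' b) = 0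
  left : ∀ x y : Steinberg par31 𝒜, x ∈ stCartan par31 𝒜 → ψ x y = 0
  right : ∀ x y : Steinberg par31 𝒜, y ∈ stCartan par31 𝒜 → ψ x y = 0

end Coefficients

end SuperLie

end

open SuperLie

noncomputable section

namespace SuperLie

/-! ### Homogeneous components and perfect Lie superalgebras -/

section Basic

variable {K L M E : Type*} [CommRing K] [AddCommGroup L] [Module K L] [LieSuperalgebra K L]
  [AddCommGroup M] [Module K M] [LieSuperalgebra K M]
  [AddCommGroup E] [Module K E] [LieSuperalgebra K E]

/-! Everything reduces to the bijectivity of one map. For a perfect `L`, the quotient `UniversalExt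
K L` of `L ⊗ L` by the 2-boundaries, with `[u, v] = δu ∧ δv` and `δ(x ∧ y) = [x, y]`, is a perfect
central extension of `L` with kernel `H₂(L)`. The bracket of a central extension `E → M` depends
only on images in `M`, so for any homomorphism `f : L → M` the rule `x ∧ y ↦ [x', y']`, with `x'`,
`y'` over `f x`, `f y`, defines a homomorphism to `E` over `M` (`UniversalExt.lift`); perfectness
makes it unique (`IsCentralExtension.hom_unique`). Let `Q` be the map `x ∧ y ↦ ([x, y], ψ(x, y))`
(`toCocycleExt`). If `Q` is bijective for `L = st(3,1,A)`, then (1) follows, (3) is read off on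
kernels (`exists_H₂_equiv`), and (2) follows because `st → sl` is itself a central extension
(`stToSL_isCentralExtension`).

Existence of `ψ`. In `A₂` we have `2 = 0`, so all Koszul signs disappear and `A₂` is a commutative
ring. On `gl(3,1,A)` take, for each Klein coset, the polarized determinant over `A₂` of the 2×2
block with rows `i, k` and columns `j, l`. Modulo 2 its coboundary is a combination of traces
(`block_cocycle`), and elements of `[gl, gl]` have trace zero in `A₂`; so its pullback to the
perfect algebra `st` is a cocycle. It vanishes on `𝓗` because `𝓗` maps to diagonal matrices and the
blocks only contain off-diagonal entries. Uniqueness holds because the root vectors and the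
`[F_{ij}(a), F_{ji}(b)]` span `st`.

Upper bound for the kernel. In a central extension of `st`, lift `F_{ij}(a)` to the bracket of lifts
of `F_{ik}(a)` and `F_{kj}(1)`. A fourth index shows that this does not depend on `k`, and that
brackets of lifts in a common row or column vanish when they should. The only relations that can
fail are `[F_{ij}(a), F_{kl}(b)] = 0` for four distinct indices. Factoring `F_{kl}` through `i` or
`j` exchanges the rows or the columns of such a bracket, with a sign. Exactly one of the four
indices is odd, so the two rows or the two columns have different parity, and a double exchange
yields `-1`: the bracket is killed by 2 (`lift_distinct_neg`). The exchanges, now free of signs,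
show that it depends only on the class of `ab` in `A₂` and on the Klein coset
(`superIdeal_le_ker_quadMap`, `quadMap_klein`). If the extension is perfect, these brackets fill the
whole kernel, which is thus a quotient of `𝓦` (`exists_kernelMap_eq`).

Comparison. For the universal extension, `Q` sends the element of the kernel attached to `w ∈ 𝓦` to
`(0, w)` (`toCocycleExt_kernelMap`). So no further collapse occurs, and `Q` is bijective. -/

theorem LieSuperHom.ext {f g : LieSuperHom K L M} (h : ∀ x, f x = g x) : f = g := by
  cases f; cases g; congr; exact LinearMap.ext h

theorem LieSuperHom.mem_gr (f : LieSuperHom K L M) {p : ZMod 2} {x : L} (hx : x ∈ gr K p) :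
    f x ∈ gr K p := f.map_gr p x hx

theorem LieSuperHom.br (f : LieSuperHom K L M) (x y : L) : f (br K x y) = br K (f x) (f y) :=
  f.map_br x y

/-- The identity homomorphism. -/
def LieSuperHom.id : LieSuperHom K L L where
  toLinearMap := LinearMap.id
  map_gr _ _ hx := hx
  map_br _ _ := rfl

theorem gr_eq_zero {V : Type*} [AddCommGroup V] [Module K V] [Supermodule K V] {x : V}
    (h0 : x ∈ gr K 0) (h1 : x ∈ gr K 1) : x = 0 :=
  Submodule.disjoint_def.1 (Supermodule.isCompl (K := K) (M := V)).disjoint x h0 h1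

/-- To prove a linear statement it suffices to check it on homogeneous elements. -/
theorem homogeneous_induction {V : Type*} [AddCommGroup V] [Module K V] [Supermodule K V]
    {P : V → Prop} (hadd : ∀ x y, P x → P y → P (x + y))
    (h : ∀ (p : ZMod 2) (x : V), x ∈ gr K p → P x) (x : V) : P x := by
  obtain ⟨y, hy, z, hz, rfl⟩ := exists_parts (K := K) x
  exact hadd _ _ (h _ _ hy) (h _ _ hz)

/-- The kernel of an even map contains the homogeneous components of its elements. -/
theorem exists_parts_ker {V W : Type*} [AddCommGroup V] [Module K V] [Supermodule K V]
    [AddCommGroup W] [Module K W] [Supermodule K W] (f : V →ₗ[K] W)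
    (hf : ∀ (p : ZMod 2) (x : V), x ∈ gr K p → f x ∈ gr K p) {x : V} (hx : f x = 0) :
    ∃ y ∈ (gr K 0 : Submodule K V), ∃ z ∈ (gr K 1 : Submodule K V),
      y + z = x ∧ f y = 0 ∧ f z = 0 := by
  obtain ⟨y, hy, z, hz, rfl⟩ := exists_parts (K := K) x
  have h : f y = f (-z) := by
    rw [map_add] at hx
    rw [map_neg]; exact eq_neg_of_add_eq_zero_left hx
  have hy0 : f y = 0 := gr_eq_zero (K := K) (hf 0 y hy) (h ▸ hf 1 _ (neg_mem hz))
  exact ⟨y, hy, z, hz, rfl, hy0, by simpa [hy0] using hx⟩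

/-- The component of the right parity of any preimage already works, as the other one must map to
zero. Skew symmetry and the Jacobi identity hold only for homogeneous elements, so identities
transported along a surjection need such lifts. -/
theorem exists_homogeneous_lift {V W : Type*} [AddCommGroup V] [Module K V] [Supermodule K V]
    [AddCommGroup W] [Module K W] [Supermodule K W] (f : V →ₗ[K] W)
    (hf : ∀ (p : ZMod 2) (x : V), x ∈ gr K p → f x ∈ gr K p) (hs : Function.Surjective f)
    {p : ZMod 2} {x : W} (hx : x ∈ gr K p) : ∃ y ∈ (gr K p : Submodule K V), f y = x := by
  obtain ⟨y, rfl⟩ := hs x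
  obtain ⟨a, ha, b, hb, rfl⟩ := exists_parts (K := K) y
  rw [map_add] at hx ⊢
  obtain rfl | rfl := parity_cases p
  · refine ⟨a, ha, ?_⟩
    have : f b ∈ gr K 0 := by simpa using sub_mem hx (hf 0 a ha)
    rw [gr_eq_zero this (hf 1 b hb), add_zero]
  · refine ⟨b, hb, ?_⟩
    have : f a ∈ gr K 1 := by simpa using sub_mem hx (hf 1 b hb)
    rw [gr_eq_zero (hf 0 a ha) this, zero_add]

/-- Centrality is formulated with the central element on the left. Skew symmetry moves it to the
right only for homogeneous elements, so its two components must be central separately. -/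
theorem br_eq_zero_symm {x : L} (h : ∀ y : L, br K x y = 0)
    {a b : L} (ha : a ∈ gr K 0) (hb : b ∈ gr K 1) (hab : a + b = x)
    (h0 : ∀ y : L, br K a y = 0) (y : L) : br K y x = 0 := by
  have h1 : ∀ y : L, br K b y = 0 := fun y => by
    have := h y
    rw [← hab] at this
    simpa [br, h0 y] using (show br K a y + br K b y = 0 by simpa [br] using this)
  refine homogeneous_induction (K := K) (P := fun y => br K y x = 0) ?_ ?_ y
  · intro y z hy hz
    simp only [br, map_add, LinearMap.add_apply] at *
    rw [hy, hz, add_zero]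
  · intro p y hy
    have e0 := LieSuperalgebra.skew (K := K) hy ha
    have e1 := LieSuperalgebra.skew (K := K) hy hb
    have z0 := h0 y
    have z1 := h1 y
    simp only [br] at *
    rw [← hab, map_add, e0, e1, z0, z1]
    simp

/-- The submodule `[L, L]` is all of `L`. -/
def IsPerfect (K L : Type*) [CommRing K] [AddCommGroup L] [Module K L] [LieSuperalgebra K L] :
    Prop := derivedSubmodule K L = ⊤

theorem IsPerfect.induction (hL : IsPerfect K L) {P : L → Prop} (h0 : P 0)
    (hadd : ∀ x y, P x → P y → P (x + y)) (hsmul : ∀ (c : K) x, P x → P (c • x))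
    (hbr : ∀ x y, P (br K x y)) (x : L) : P x := by
  have hx : x ∈ derivedSubmodule K L := by rw [hL]; trivial
  induction hx using Submodule.span_induction with
  | mem x h => obtain ⟨y, z, rfl⟩ := h; exact hbr y z
  | zero => exact h0
  | add x y _ _ h h' => exact hadd _ _ h h'
  | smul c x _ h => exact hsmul _ _ h

end Basic

/-! ### Brackets of a central extension as functions on the base -/

section CentralExtension

variable {K L M E : Type*} [CommRing K] [AddCommGroup L] [Module K L] [LieSuperalgebra K L]
  [AddCommGroup M] [Module K M] [LieSuperalgebra K M]
  [AddCommGroup E] [Module K E] [LieSuperalgebra K E]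
  {g : LieSuperHom K E M} (hg : IsCentralExtension g)

include hg

theorem IsCentralExtension.br_left {x : E} (hx : g x = 0) (y : E) : br K x y = 0 := hg.2 x hx y

theorem IsCentralExtension.br_right {x : E} (hx : g x = 0) (y : E) : br K y x = 0 := by
  obtain ⟨a, ha, b, hb, hab, ga, -⟩ := exists_parts_ker g.toLinearMap g.map_gr hx
  exact br_eq_zero_symm (hg.2 x hx) ha hb hab (hg.2 a ga) y

theorem IsCentralExtension.br_congr {x x' y y' : E} (hx : g x = g x') (hy : g y = g y') :
    br K x y = br K x' y' := by
  have h1 := hg.br_left (x := x - x') (by rw [map_sub, hx, sub_self]) y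
  have h2 := hg.br_right (x := y - y') (by rw [map_sub, hy, sub_self]) x'
  simp only [br, map_sub, LinearMap.sub_apply] at *
  rw [sub_eq_zero.1 h1, sub_eq_zero.1 h2]

/-- The bracket of a central extension `E` of `M`, as a bilinear map on `M`. -/
def IsCentralExtension.lift : M →ₗ[K] M →ₗ[K] E :=
  -- `Function.surjInv` is only a set-theoretic section. Bilinearity holds because the bracket
  -- ignores the central ambiguity of the lifts (`br_congr`).
  LinearMap.mk₂ K (fun x y => br K (Function.surjInv hg.1 x) (Function.surjInv hg.1 y))
    (fun x x' y => by
      have h := hg.br_congr (x := Function.surjInv hg.1 (x + x'))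
        (x' := Function.surjInv hg.1 x + Function.surjInv hg.1 x')
        (by simp only [map_add, Function.surjInv_eq]) (rfl : g (Function.surjInv hg.1 y) = _)
      simpa only [br, map_add, LinearMap.add_apply] using h)
    (fun c x y => by
      have h := hg.br_congr (x := Function.surjInv hg.1 (c • x))
        (x' := c • Function.surjInv hg.1 x)
        (by simp only [map_smul, Function.surjInv_eq]) (rfl : g (Function.surjInv hg.1 y) = _)
      simpa only [br, map_smul, LinearMap.smul_apply] using h)
    (fun x y y' => by
      have h := hg.br_congr (y := Function.surjInv hg.1 (y + y'))
        (y' := Function.surjInv hg.1 y + Function.surjInv hg.1 y')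
        (rfl : g (Function.surjInv hg.1 x) = _) (by simp only [map_add, Function.surjInv_eq])
      simpa only [br, map_add, LinearMap.add_apply] using h)
    (fun c x y => by
      have h := hg.br_congr (y := Function.surjInv hg.1 (c • y))
        (y' := c • Function.surjInv hg.1 y)
        (rfl : g (Function.surjInv hg.1 x) = _) (by simp only [map_smul, Function.surjInv_eq])
      simpa only [br, map_smul, LinearMap.smul_apply] using h)

theorem IsCentralExtension.lift_apply (x y : E) : hg.lift (g x) (g y) = br K x y :=
  hg.br_congr (Function.surjInv_eq hg.1 _) (Function.surjInv_eq hg.1 _)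

theorem IsCentralExtension.map_lift (x y : M) : g (hg.lift x y) = br K x y := by
  obtain ⟨x, rfl⟩ := hg.1 x
  obtain ⟨y, rfl⟩ := hg.1 y
  rw [hg.lift_apply, g.br]

theorem IsCentralExtension.exists_lift {p : ZMod 2} {x : M} (hx : x ∈ gr K p) :
    ∃ y ∈ (gr K p : Submodule K E), g y = x :=
  exists_homogeneous_lift g.toLinearMap g.map_gr hg.1 hx

theorem IsCentralExtension.lift_mem {p q : ZMod 2} {x y : M} (hx : x ∈ gr K p)
    (hy : y ∈ gr K q) : hg.lift x y ∈ gr K (p + q) := by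
  obtain ⟨x, hx', rfl⟩ := hg.exists_lift hx
  obtain ⟨y, hy', rfl⟩ := hg.exists_lift hy
  rw [hg.lift_apply]
  exact LieSuperalgebra.bracket_mem hx' hy'

theorem IsCentralExtension.lift_skew {p q : ZMod 2} {x y : M} (hx : x ∈ gr K p)
    (hy : y ∈ gr K q) : hg.lift x y = -(koszul p q • hg.lift y x) := by
  obtain ⟨x, hx', rfl⟩ := hg.exists_lift hx
  obtain ⟨y, hy', rfl⟩ := hg.exists_lift hy
  rw [hg.lift_apply, hg.lift_apply]
  exact LieSuperalgebra.skew hx' hy'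

theorem IsCentralExtension.lift_self {x : M} (hx : x ∈ gr K 0) : hg.lift x x = 0 := by
  obtain ⟨x, hx', rfl⟩ := hg.exists_lift hx
  rw [hg.lift_apply]
  exact LieSuperalgebra.even_self hx'

theorem IsCentralExtension.lift_jacobi {p q r : ZMod 2} {x y z : M} (hx : x ∈ gr K p)
    (hy : y ∈ gr K q) (hz : z ∈ gr K r) :
    hg.lift x (br K y z) = hg.lift (br K x y) z + koszul p q • hg.lift y (br K x z) := by
  obtain ⟨x, hx', rfl⟩ := hg.exists_lift hx
  obtain ⟨y, hy', rfl⟩ := hg.exists_lift hy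
  obtain ⟨z, hz', rfl⟩ := hg.exists_lift hz
  rw [← g.br, ← g.br, ← g.br, hg.lift_apply, hg.lift_apply, hg.lift_apply]
  exact LieSuperalgebra.jacobi hx' hy' hz'

theorem IsCentralExtension.lift_br {p q : ZMod 2} {x y : M}
    (hx : x ∈ gr K p) (hy : y ∈ gr K q) (z : M) :
    hg.lift x (br K y z) = hg.lift (br K x y) z + koszul p q • hg.lift y (br K x z) := by
  refine homogeneous_induction (K := K) (P := fun z => hg.lift x (br K y z) =
    hg.lift (br K x y) z + koszul p q • hg.lift y (br K x z)) ?_ ?_ z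
  · intro z z' h h'
    simp only [br, map_add, smul_add] at *
    rw [h, h']
    abel
  · intro r z hz
    exact hg.lift_jacobi hx hy hz

/-- Two homomorphisms from a perfect Lie superalgebra to a central extension of `M` agree as
soon as they agree over `M`. -/
theorem IsCentralExtension.hom_unique (hL : IsPerfect K L) {h h' : LieSuperHom K L E}
    (e : ∀ x, g (h x) = g (h' x)) : h = h' := by
  refine LieSuperHom.ext fun x => hL.induction (P := fun x => h x = h' x) ?_ ?_ ?_ ?_ x
  · rw [map_zero, map_zero]
  · intro x y hx hy
    rw [map_add, map_add, hx, hy]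
  · intro c x hx
    rw [map_smul, map_smul, hx]
  · intro x y
    rw [h.br, h'.br]
    exact hg.br_congr (e x) (e y)

/-- The composite of two central extensions is a central extension if the source is perfect. -/
theorem IsCentralExtension.comp {f : LieSuperHom K L E} (hf : IsCentralExtension f)
    (hL : IsPerfect K L) : IsCentralExtension (g.comp f) := by
  refine ⟨hg.1.comp hf.1, fun x hx => ?_⟩
  have key : ∀ (p : ZMod 2) (x : L), x ∈ gr K p → g (f x) = 0 → ∀ y, br K x y = 0 := by
    intro p x hp hx
    -- A homogeneous `x` in the kernel of the composite has `f x` central in `E`, so `[x, y]` lies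
    -- in the kernel of `f` for all `y` and is central. By the Jacobi identity `x` then kills all
    -- brackets `[y, z]`, and these span.
    have hxy : ∀ y, f (br K x y) = 0 := fun y => by
      rw [f.br]; exact hg.2 _ hx _
    refine hL.induction (P := fun y => br K x y = 0) (by simp [br]) ?_ ?_ ?_
    · intro y z hy hz
      simp only [br, map_add] at *
      rw [hy, hz, add_zero]
    · intro c y hy
      simp only [br, map_smul] at *
      rw [hy, smul_zero]
    · intro y z
      refine homogeneous_induction (K := K) (P := fun y => br K x (br K y z) = 0) ?_ ?_ y
      · intro y y' h h'
        simp only [br, map_add, LinearMap.add_apply] at *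
        rw [h, h', add_zero]
      intro q y hy
      refine homogeneous_induction (K := K) (P := fun z => br K x (br K y z) = 0) ?_ ?_ z
      · intro y y' h h'
        simp only [br, map_add] at *
        rw [h, h', add_zero]
      intro r z hz
      have := LieSuperalgebra.jacobi (K := K) hp hy hz
      have h1 := hf.br_left (hxy y) z
      have h2 := hf.br_right (hxy z) y
      simp only [br] at *
      rw [this, h1, h2]
      simp
  obtain ⟨a, ha, b, hb, rfl, ga, gb⟩ := exists_parts_ker (g.comp f).toLinearMap (g.comp f).map_gr hx
  intro y
  have h1 := key 0 a ha ga y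
  have h2 := key 1 b hb gb y
  simp only [br, map_add, LinearMap.add_apply] at *
  rw [h1, h2, add_zero]

end CentralExtension

/-! ### The universal central extension of a perfect Lie superalgebra -/

section UniversalExtension

variable (K L : Type*) [CommRing K] [AddCommGroup L] [Module K L] [LieSuperalgebra K L]

/-- The projection of a supermodule onto its part of parity `p`. -/
def grProj (p : ZMod 2) : L →ₗ[K] L :=
  Submodule.projection _ _ (Supermodule.isCompl (K := K) (M := L)) ∘ₗ
    (if p = 0 then LinearMap.id else 0) +
  Submodule.projection _ _ (Supermodule.isCompl (K := K) (M := L)).symm ∘ₗ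
    (if p = 0 then 0 else LinearMap.id)

variable {K L}

theorem grProj_same {p : ZMod 2} {x : L} (hx : x ∈ gr K p) : grProj K L p x = x := by
  obtain rfl | rfl := parity_cases p
  · simpa [grProj] using hx
  · simpa [grProj] using hx

theorem grProj_ne {p q : ZMod 2} (hpq : p ≠ q) {x : L} (hx : x ∈ gr K p) :
    grProj K L q x = 0 := by
  obtain rfl | rfl := parity_cases p <;> obtain rfl | rfl := parity_cases q
  · exact absurd rfl hpq
  · simpa [grProj] using hx
  · simpa [grProj] using hx
  · exact absurd rfl hpq

variable (K L)

theorem isCompl_tensorGr : IsCompl (tensorGr K L 0) (tensorGr K L 1) := by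
  constructor
  · rw [Submodule.disjoint_def]
    -- This projector is the identity on even tensors and zero on odd ones, which makes the two
    -- parts disjoint without any flatness of the homogeneous parts.
    let P : L ⊗[K] L →ₗ[K] L ⊗[K] L :=
      TensorProduct.map (grProj K L 0) (grProj K L 0) +
        TensorProduct.map (grProj K L 1) (grProj K L 1)
    have h0 : ∀ t ∈ tensorGr K L 0, P t = t := by
      intro t ht
      induction ht using Submodule.span_induction with
      | zero => simp
      | add x y _ _ hx hy => rw [map_add, hx, hy]
      | smul c x _ hx => rw [map_smul, hx]
      | mem t h =>
        obtain ⟨q, r, x, y, hqr, hx, hy, rfl⟩ := h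
        obtain rfl | rfl := parity_cases q <;> obtain rfl | rfl := parity_cases r
        · simp [P, grProj_same hx, grProj_same hy, grProj_ne (zero_ne_one) hx]
        · exact absurd hqr (by decide)
        · exact absurd hqr (by decide)
        · simp [P, grProj_same hx, grProj_same hy, grProj_ne (one_ne_zero) hx]
    have h1 : ∀ t ∈ tensorGr K L 1, P t = 0 := by
      intro t ht
      induction ht using Submodule.span_induction with
      | zero => simp
      | add x y _ _ hx hy => rw [map_add, hx, hy, add_zero]
      | smul c x _ hx => rw [map_smul, hx, smul_zero]
      | mem t h =>
        obtain ⟨q, r, x, y, hqr, hx, hy, rfl⟩ := h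
        obtain rfl | rfl := parity_cases q <;> obtain rfl | rfl := parity_cases r
        · exact absurd hqr (by decide)
        · simp [P, grProj_ne (zero_ne_one) hx, grProj_ne (one_ne_zero) hy]
        · simp [P, grProj_ne (zero_ne_one) hy, grProj_ne (one_ne_zero) hx]
        · exact absurd hqr (by decide)
    intro t ht0 ht1
    rw [← h0 t ht0, h1 t ht1]
  · rw [codisjoint_iff, eq_top_iff]
    rintro t -
    induction t using TensorProduct.induction_on with
    | zero => exact zero_mem _
    | add x y hx hy => exact add_mem hx hy
    | tmul x y =>
      have key : ∀ (p q : ZMod 2) (x y : L), x ∈ gr K p → y ∈ gr K q →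
          x ⊗ₜ[K] y ∈ tensorGr K L 0 ⊔ tensorGr K L 1 := by
        intro p q x y hx hy
        have h : x ⊗ₜ[K] y ∈ tensorGr K L (p + q) :=
          Submodule.subset_span ⟨p, q, x, y, rfl, hx, hy, rfl⟩
        obtain e | e := parity_cases (p + q) <;> rw [e] at h
        · exact Submodule.mem_sup_left h
        · exact Submodule.mem_sup_right h
      obtain ⟨x0, hx0, x1, hx1, rfl⟩ := exists_parts (K := K) x
      obtain ⟨y0, hy0, y1, hy1, rfl⟩ := exists_parts (K := K) y
      rw [TensorProduct.add_tmul, TensorProduct.tmul_add, TensorProduct.tmul_add]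
      exact add_mem (add_mem (key _ _ _ _ hx0 hy0) (key _ _ _ _ hx0 hy1))
        (add_mem (key _ _ _ _ hx1 hy0) (key _ _ _ _ hx1 hy1))

variable {K L} in
theorem tmul_mem_tensorGr {p q : ZMod 2} {x y : L} (hx : x ∈ gr K p) (hy : y ∈ gr K q) :
    x ⊗ₜ[K] y ∈ tensorGr K L (p + q) :=
  Submodule.subset_span ⟨p, q, x, y, rfl, hx, hy, rfl⟩

theorem boundaries₂_homogeneous : boundaries₂ K L ≤
    (boundaries₂ K L ⊓ tensorGr K L 0) ⊔ (boundaries₂ K L ⊓ tensorGr K L 1) := by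
  refine Submodule.span_le.2 fun t ht => ?_
  have key : ∃ p, t ∈ tensorGr K L p := by
    cases ht with
    | @skew p q x y hx hy =>
      exact ⟨p + q, add_mem (tmul_mem_tensorGr hx hy)
        (zsmul_mem (add_comm q p ▸ tmul_mem_tensorGr hy hx) _)⟩
    | even_self hx => exact ⟨_, tmul_mem_tensorGr hx hx⟩
    | @jacobi p q r x y z hx hy hz =>
      refine ⟨p + q + r, add_mem (add_mem (zsmul_mem ?_ _) (zsmul_mem ?_ _)) (zsmul_mem ?_ _)⟩
      · exact tmul_mem_tensorGr (LieSuperalgebra.bracket_mem hx hy) hz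
      · rw [show p + q + r = q + r + p by ring]
        exact tmul_mem_tensorGr (LieSuperalgebra.bracket_mem hy hz) hx
      · rw [show p + q + r = r + p + q by ring]
        exact tmul_mem_tensorGr (LieSuperalgebra.bracket_mem hz hx) hy
  have hb : t ∈ boundaries₂ K L := Submodule.subset_span ht
  obtain ⟨p, hp⟩ := key
  obtain rfl | rfl := parity_cases p
  · exact Submodule.mem_sup_left ⟨hb, hp⟩
  · exact Submodule.mem_sup_right ⟨hb, hp⟩

theorem boundaries₂_le_cycles₂ : boundaries₂ K L ≤ cycles₂ K L := by
  refine Submodule.span_le.2 fun t ht => ?_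
  change TensorProduct.lift (LieSuperalgebra.bracket (K := K) (L := L)) t = 0
  cases ht with
  | skew hx hy =>
    have := LieSuperalgebra.skew (K := K) hx hy
    rw [map_add, map_zsmul, TensorProduct.lift.tmul, TensorProduct.lift.tmul, this,
      neg_add_cancel]
  | even_self hx => exact LieSuperalgebra.even_self hx
  | @jacobi p q r x y z hx hy hz =>
    have h1 := LieSuperalgebra.jacobi (K := K) hx hy hz
    have h2 := LieSuperalgebra.skew (K := K) (LieSuperalgebra.bracket_mem (K := K) hy hz) hx
    have h3 := LieSuperalgebra.skew (K := K) (LieSuperalgebra.bracket_mem (K := K) hz hx) hy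
    have h4 := LieSuperalgebra.skew (K := K) hz hx
    simp only [map_add, map_zsmul, TensorProduct.lift.tmul, br]
    rw [h2, h3, h4, h1]
    obtain rfl | rfl := parity_cases p <;> obtain rfl | rfl := parity_cases q <;>
      obtain rfl | rfl := parity_cases r <;>
      simp [parity_add_self]

/-- The quotient of `L ⊗ L` by the 2-boundaries. -/
def UniversalExt : Type _ := L ⊗[K] L ⧸ boundaries₂ K L

instance : AddCommGroup (UniversalExt K L) :=
  inferInstanceAs (AddCommGroup (_ ⧸ boundaries₂ K L))
instance : Module K (UniversalExt K L) :=
  inferInstanceAs (Module K (_ ⧸ boundaries₂ K L))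

/-- The class of a tensor. -/
def UniversalExt.mk : L ⊗[K] L →ₗ[K] UniversalExt K L := (boundaries₂ K L).mkQ

theorem UniversalExt.mk_surjective : Function.Surjective (UniversalExt.mk K L) :=
  Submodule.mkQ_surjective _

variable {K L} in
theorem UniversalExt.mk_eq_zero {t : L ⊗[K] L} :
    UniversalExt.mk K L t = 0 ↔ t ∈ boundaries₂ K L := Submodule.Quotient.mk_eq_zero _

variable {K L} in
theorem UniversalExt.mk_generator {t : L ⊗[K] L} (h : IsBoundaryGenerator K L t) :
    UniversalExt.mk K L t = 0 := UniversalExt.mk_eq_zero.2 (Submodule.subset_span h)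

/-- The map `x ∧ y ↦ [x, y]`. -/
def UniversalExt.toBase : UniversalExt K L →ₗ[K] L :=
  (boundaries₂ K L).liftQ (TensorProduct.lift (LieSuperalgebra.bracket (K := K) (L := L)))
    (boundaries₂_le_cycles₂ K L)

@[simp] theorem UniversalExt.toBase_mk (t : L ⊗[K] L) :
    UniversalExt.toBase K L (UniversalExt.mk K L t)
      = TensorProduct.lift (LieSuperalgebra.bracket (K := K) (L := L)) t := rfl

theorem lift_bracket_mem {p : ZMod 2} {t : L ⊗[K] L} (ht : t ∈ tensorGr K L p) :
    TensorProduct.lift (LieSuperalgebra.bracket (K := K) (L := L)) t ∈ gr K p := by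
  induction ht using Submodule.span_induction with
  | zero => rw [map_zero]; exact zero_mem _
  | add x y _ _ hx hy => rw [map_add]; exact add_mem hx hy
  | smul c x _ hx => rw [map_smul]; exact Submodule.smul_mem _ _ hx
  | mem t h =>
    obtain ⟨q, r, x, y, rfl, hx, hy, rfl⟩ := h
    exact LieSuperalgebra.bracket_mem hx hy

/-- The Lie superalgebra structure `[u, v] = δ u ∧ δ v`, where `δ (x ∧ y) = [x, y]`. -/
instance : LieSuperalgebra K (UniversalExt K L) where
  gr p := (tensorGr K L p).map (UniversalExt.mk K L)
  isCompl := isCompl_map_mkQ (isCompl_tensorGr K L) (boundaries₂_homogeneous K L)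
  bracket := ((TensorProduct.mk K L L).compr₂ (UniversalExt.mk K L)).compl₁₂
    (UniversalExt.toBase K L) (UniversalExt.toBase K L)
  bracket_mem := by
    rintro p q _ _ ⟨s, hs, rfl⟩ ⟨t, ht, rfl⟩
    exact ⟨_, tmul_mem_tensorGr (lift_bracket_mem K L hs) (lift_bracket_mem K L ht), rfl⟩
  skew := by
    rintro p q _ _ ⟨s, hs, rfl⟩ ⟨t, ht, rfl⟩
    have h := UniversalExt.mk_generator
      (.skew (lift_bracket_mem K L hs) (lift_bracket_mem K L ht))
    rw [map_add, map_zsmul] at h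
    exact eq_neg_of_add_eq_zero_left h
  jacobi := by
    rintro p q r _ _ _ ⟨s, hs, rfl⟩ ⟨t, ht, rfl⟩ ⟨u, hu, rfl⟩
    have hs' := lift_bracket_mem K L hs
    have ht' := lift_bracket_mem K L ht
    have hu' := lift_bracket_mem K L hu
    simp only [LinearMap.compl₁₂_apply, LinearMap.compr₂_apply, TensorProduct.mk_apply,
      UniversalExt.toBase_mk, TensorProduct.lift.tmul]
    generalize TensorProduct.lift (LieSuperalgebra.bracket (K := K) (L := L)) s = x at *
    generalize TensorProduct.lift (LieSuperalgebra.bracket (K := K) (L := L)) t = y at *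
    generalize TensorProduct.lift (LieSuperalgebra.bracket (K := K) (L := L)) u = z at *
    have h1 := UniversalExt.mk_generator (.jacobi hs' ht' hu')
    have h2 := UniversalExt.mk_generator (.skew (LieSuperalgebra.bracket_mem (K := K) ht' hu') hs')
    have h3 := UniversalExt.mk_generator (.skew (LieSuperalgebra.bracket_mem (K := K) hu' hs') ht')
    have h4 := LieSuperalgebra.skew (K := K) hu' hs'
    simp only [map_add, map_zsmul, br] at h1 h2 h3
    have h2' := eq_neg_of_add_eq_zero_left h2
    have h3' := eq_neg_of_add_eq_zero_left h3
    rw [h2', h3', h4] at h1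
    obtain rfl | rfl := parity_cases p <;> obtain rfl | rfl := parity_cases q <;>
      obtain rfl | rfl := parity_cases r <;>
      simp [parity_add_self, TensorProduct.tmul_neg] at h1 ⊢ <;> first
        | (rw [← sub_eq_zero, ← h1]; abel1)
        | (rw [← sub_eq_zero, ← neg_eq_zero, ← h1]; abel1)
  even_self := by
    rintro _ ⟨s, hs, rfl⟩
    exact UniversalExt.mk_generator (.even_self (lift_bracket_mem K L hs))

theorem UniversalExt.br_def (s t : UniversalExt K L) : br K s t
    = UniversalExt.mk K L (UniversalExt.toBase K L s ⊗ₜ UniversalExt.toBase K L t) := rfl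

/-- The projection of the universal extension to `L`. -/
def UniversalExt.proj : LieSuperHom K (UniversalExt K L) L where
  toLinearMap := UniversalExt.toBase K L
  map_gr := by
    rintro p _ ⟨s, hs, rfl⟩
    exact lift_bracket_mem K L hs
  map_br _ _ := rfl

variable {K L}

/-- The bracket factors through the images in `L`, so the kernel is central by construction;
surjectivity of `δ` is perfectness of `L`. -/
theorem UniversalExt.proj_isCentralExtension (hL : IsPerfect K L) :
    IsCentralExtension (UniversalExt.proj K L) := by
  refine ⟨fun x => ?_, fun x hx y => ?_⟩
  · refine hL.induction (P := fun x => ∃ y, UniversalExt.proj K L y = x) ⟨0, map_zero _⟩ ?_ ?_ ?_ x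
    · rintro _ _ ⟨a, rfl⟩ ⟨b, rfl⟩
      exact ⟨a + b, map_add _ _ _⟩
    · rintro c _ ⟨a, rfl⟩
      exact ⟨c • a, map_smul _ _ _⟩
    · exact fun x y => ⟨UniversalExt.mk K L (x ⊗ₜ y), rfl⟩
  · rw [UniversalExt.br_def, show UniversalExt.toBase K L x = 0 from hx]
    simp

/-- Lifting `x` and `y` through the surjection `δ` exhibits the class of `x ⊗ y` as a bracket. -/
theorem UniversalExt.isPerfect (hL : IsPerfect K L) : IsPerfect K (UniversalExt K L) := by
  refine eq_top_iff.2 fun u _ => ?_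
  obtain ⟨t, rfl⟩ := UniversalExt.mk_surjective K L u
  induction t using TensorProduct.induction_on with
  | zero => rw [map_zero]; exact zero_mem _
  | add x y hx hy => rw [map_add]; exact add_mem (hx trivial) (hy trivial)
  | tmul x y =>
    obtain ⟨a, rfl⟩ := (UniversalExt.proj_isCentralExtension hL).1 x
    obtain ⟨b, rfl⟩ := (UniversalExt.proj_isCentralExtension hL).1 y
    exact br_mem_derived K _ a b

section Lift

variable {M E : Type*} [AddCommGroup M] [Module K M] [LieSuperalgebra K M]
  [AddCommGroup E] [Module K E] [LieSuperalgebra K E]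
  {g : LieSuperHom K E M} (hg : IsCentralExtension g) (f : LieSuperHom K L M)

/-- The bracket of `E`, read on `M`, inherits skew symmetry, the vanishing on even diagonal pairs
and the Jacobi identity from `E`; pulled back along `f`, these are the three families of boundary
generators. -/
theorem boundaries₂_le_ker_lift : boundaries₂ K L ≤
    LinearMap.ker (TensorProduct.lift (hg.lift.compl₁₂ f.toLinearMap f.toLinearMap)) := by
  refine Submodule.span_le.2 fun t ht => ?_
  change TensorProduct.lift _ t = 0
  cases ht with
  | skew hx hy =>
    rw [map_add, map_zsmul, TensorProduct.lift.tmul, TensorProduct.lift.tmul,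
      LinearMap.compl₁₂_apply, LinearMap.compl₁₂_apply,
      hg.lift_skew (f.mem_gr hx) (f.mem_gr hy)]
    exact neg_add_cancel _
  | even_self hx => exact hg.lift_self (f.mem_gr hx)
  | @jacobi p q r x y z hx hy hz =>
    have hx' := f.mem_gr hx
    have hy' := f.mem_gr hy
    have hz' := f.mem_gr hz
    have h1 := hg.lift_jacobi hx' hy' hz'
    have h2 := hg.lift_skew (LieSuperalgebra.bracket_mem (K := K) hy' hz') hx'
    have h3 := hg.lift_skew (LieSuperalgebra.bracket_mem (K := K) hz' hx') hy'
    have h4 := LieSuperalgebra.skew (K := K) hz' hx'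
    simp only [map_add, map_zsmul, TensorProduct.lift.tmul, LinearMap.compl₁₂_apply, f.br, br]
    simp only [br] at h1
    rw [h2, h3, h4]
    have h5 := sub_eq_zero.2 h1
    obtain rfl | rfl := parity_cases p <;> obtain rfl | rfl := parity_cases q <;>
      obtain rfl | rfl := parity_cases r <;>
      simp [parity_add_self] at h5 ⊢ <;> first
        | (rw [← h5]; abel1)
        | (rw [← neg_eq_zero, ← h5]; abel1)

/-- The linear map `x ∧ y ↦ [x', y']` to a central extension `g : E → M`, where `x'` and `y'`
are lifts of `f x` and `f y`. -/
def UniversalExt.liftLinear : UniversalExt K L →ₗ[K] E :=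
  (boundaries₂ K L).liftQ _ (boundaries₂_le_ker_lift hg f)

theorem UniversalExt.liftLinear_mk (x y : L) :
    UniversalExt.liftLinear hg f (UniversalExt.mk K L (x ⊗ₜ y)) = hg.lift (f x) (f y) := rfl

theorem UniversalExt.map_liftLinear (u : UniversalExt K L) :
    g (UniversalExt.liftLinear hg f u) = f (UniversalExt.toBase K L u) := by
  obtain ⟨t, rfl⟩ := UniversalExt.mk_surjective K L u
  induction t using TensorProduct.induction_on with
  | zero => simp only [map_zero]
  | add x y hx hy => simp only [map_add, hx, hy]
  | tmul x y =>
    rw [liftLinear_mk, toBase_mk, TensorProduct.lift.tmul, hg.map_lift]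
    exact (f.br x y).symm

/-- The linear map `liftLinear` is a homomorphism. -/
def UniversalExt.lift : LieSuperHom K (UniversalExt K L) E where
  toLinearMap := UniversalExt.liftLinear hg f
  map_gr := by
    rintro p _ ⟨s, hs, rfl⟩
    change UniversalExt.liftLinear hg f (UniversalExt.mk K L s) ∈ _
    induction hs using Submodule.span_induction with
    | zero => rw [map_zero, map_zero]; exact zero_mem _
    | add x y _ _ hx hy => rw [map_add, map_add]; exact add_mem hx hy
    | smul c x _ hx => rw [map_smul, map_smul]; exact Submodule.smul_mem _ _ hx
    | mem t h =>
      obtain ⟨q, r, x, y, rfl, hx, hy, rfl⟩ := h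
      exact hg.lift_mem (f.mem_gr hx) (f.mem_gr hy)
  map_br u v := by
    change UniversalExt.liftLinear hg f (br K u v) =
      br K (UniversalExt.liftLinear hg f u) (UniversalExt.liftLinear hg f v)
    rw [UniversalExt.br_def, UniversalExt.liftLinear_mk, ← UniversalExt.map_liftLinear hg,
      ← UniversalExt.map_liftLinear hg, hg.lift_apply]

theorem UniversalExt.map_lift (u : UniversalExt K L) :
    g (UniversalExt.lift hg f u) = f (UniversalExt.proj K L u) :=
  UniversalExt.map_liftLinear hg f u

end Lift

end UniversalExtension

/-! ### Maps out of Lie superalgebras given by generators and relations -/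

section Free

/-- The type `E`, regarded as a nonassociative ring whose product is the bracket. -/
@[nolint unusedArguments]
def BracketRing (K E : Type*) [CommRing K] [AddCommGroup E] [Module K E]
    [LieSuperalgebra K E] : Type _ := E

section

variable {K E : Type*} [CommRing K] [AddCommGroup E] [Module K E] [LieSuperalgebra K E]

instance : AddCommGroup (BracketRing K E) := inferInstanceAs (AddCommGroup E)
instance : Module K (BracketRing K E) := inferInstanceAs (Module K E)
instance : LieSuperalgebra K (BracketRing K E) := inferInstanceAs (LieSuperalgebra K E)

instance : NonUnitalNonAssocRing (BracketRing K E) :=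
  { (inferInstance : AddCommGroup (BracketRing K E)) with
    mul := fun x y => br K x y
    left_distrib := fun x y z =>
      map_add (LieSuperalgebra.bracket (K := K) (L := BracketRing K E) x) y z
    right_distrib := fun x y z =>
      LinearMap.map_add₂ (LieSuperalgebra.bracket (K := K) (L := BracketRing K E)) x y z
    zero_mul := fun x =>
      LinearMap.map_zero₂ (LieSuperalgebra.bracket (K := K) (L := BracketRing K E)) x
    mul_zero := fun x =>
      map_zero (LieSuperalgebra.bracket (K := K) (L := BracketRing K E) x) }

instance : IsScalarTower K (BracketRing K E) (BracketRing K E) :=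
  ⟨fun c x y =>
    LinearMap.map_smul₂ (LieSuperalgebra.bracket (K := K) (L := BracketRing K E)) c x y⟩

instance : SMulCommClass K (BracketRing K E) (BracketRing K E) :=
  ⟨fun c x y =>
    (map_smul (LieSuperalgebra.bracket (K := K) (L := BracketRing K E) x) c y).symm⟩

end

variable {K : Type*} [CommRing K] {X : Type*} (deg : X → ZMod 2)
  {E : Type*} [AddCommGroup E] [Module K E] [LieSuperalgebra K E] (φ : X → E)

/-- The extension of a map `φ : X → E` to the free nonassociative algebra on `X`. -/
def freeLift : FreeNonUnitalNonAssocAlgebra K X →ₗ[K] E where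
  toFun t := FreeNonUnitalNonAssocAlgebra.lift K (A := BracketRing K E) φ t
  map_add' := map_add (FreeNonUnitalNonAssocAlgebra.lift K (A := BracketRing K E) φ)
  map_smul' := map_smul (FreeNonUnitalNonAssocAlgebra.lift K (A := BracketRing K E) φ)

theorem freeLift_of (x : X) :
    freeLift φ (FreeNonUnitalNonAssocAlgebra.of K x) = φ x :=
  FreeNonUnitalNonAssocAlgebra.lift_of_apply K (A := BracketRing K E) φ x

theorem freeLift_mul (s t : FreeNonUnitalNonAssocAlgebra K X) :
    freeLift φ (s * t) = br K (freeLift φ s) (freeLift φ t) :=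
  map_mul (FreeNonUnitalNonAssocAlgebra.lift K (A := BracketRing K E) φ) s t

theorem single_mul_word (a b : FreeMagma X) :
    (MonoidAlgebra.single (a * b) 1 : FreeNonUnitalNonAssocAlgebra K X)
      = MonoidAlgebra.single a 1 * MonoidAlgebra.single b 1 := by
  simp [MonoidAlgebra.single_mul_single]

variable {φ deg}

theorem freeLift_mem (hφ : ∀ x, φ x ∈ gr K (deg x)) {p : ZMod 2}
    {t : FreeNonUnitalNonAssocAlgebra K X} (ht : t ∈ freeGr K deg p) : freeLift φ t ∈ gr K p := by
  induction ht using Submodule.span_induction with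
  | zero => rw [map_zero]; exact zero_mem _
  | add x y _ _ hx hy => rw [map_add]; exact add_mem hx hy
  | smul c x _ hx => rw [map_smul]; exact Submodule.smul_mem _ _ hx
  | mem t h =>
    obtain ⟨a, rfl, rfl⟩ := h
    induction a with
    | ih1 x =>
      exact (freeLift_of (K := K) φ x).symm ▸ hφ x
    | ih2 a b ha hb =>
      rw [single_mul_word, freeLift_mul]
      exact LieSuperalgebra.bracket_mem ha hb

theorem freeLift_axiom (hφ : ∀ x, φ x ∈ gr K (deg x)) {t : FreeNonUnitalNonAssocAlgebra K X}
    (ht : IsLieSuperAxiom K deg t) : freeLift φ t = 0 := by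
  cases ht with
  | skew hx hy =>
    rw [map_add, map_zsmul, freeLift_mul, freeLift_mul, br,
      LieSuperalgebra.skew (freeLift_mem hφ hx) (freeLift_mem hφ hy), neg_add_cancel]
  | jacobi hx hy hz =>
    simp only [map_sub, map_add, map_zsmul, freeLift_mul]
    exact sub_eq_zero.2 (LieSuperalgebra.jacobi (freeLift_mem hφ hx) (freeLift_mem hφ hy)
      (freeLift_mem hφ hz))
  | even_self hx =>
    rw [freeLift_mul]
    exact LieSuperalgebra.even_self (freeLift_mem hφ hx)

/-- Relations that hold modulo a central submodule generate an ideal with the same property. -/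
theorem presentationIdeal_le_comap (hφ : ∀ x, φ x ∈ gr K (deg x))
    {R : Set (FreeNonUnitalNonAssocAlgebra K X)} {C : Submodule K E}
    (hC : ∀ c ∈ C, ∀ y, br K c y = 0 ∧ br K y c = 0) (hR : ∀ r ∈ R, freeLift φ r ∈ C) :
    presentationIdeal K deg R ≤ C.comap (freeLift φ) := by
  refine idealGen_le ?_ ?_
  · rintro t (ht | ht)
    · change freeLift φ t ∈ C
      rw [freeLift_axiom hφ ht]
      exact zero_mem _
    · exact hR t ht
  · intro x hx y
    constructor <;> rw [Submodule.mem_comap, freeLift_mul]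
    · rw [(hC _ hx _).1]; exact zero_mem _
    · rw [(hC _ hx _).2]; exact zero_mem _

/-- The universal property of a Lie superalgebra given by generators and relations. -/
def Presented.lift (φ : X → E) (hφ : ∀ x, φ x ∈ gr K (deg x))
    {R : Set (FreeNonUnitalNonAssocAlgebra K X)}
    (hR : IsHomogeneousSet K deg R) (h : ∀ r ∈ R, freeLift φ r = 0) :
    LieSuperHom K (Presented K deg hR) E where
  toLinearMap := (presentationIdeal K deg R).liftQ (freeLift φ) (by
    refine (presentationIdeal_le_comap hφ (C := ⊥) ?_ ?_)
    · rintro _ rfl y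
      simp [br]
    · exact h)
  map_gr := by
    rintro p _ ⟨t, ht, rfl⟩
    exact freeLift_mem hφ ht
  map_br := by
    intro x y
    obtain ⟨s, rfl⟩ := Presented.mk_surjective K deg hR x
    obtain ⟨t, rfl⟩ := Presented.mk_surjective K deg hR y
    exact freeLift_mul φ s t

/-- The Jacobi identity, with an arbitrary last argument. -/
theorem br_br_left {p q : ZMod 2} {x y : E} (hx : x ∈ gr K p) (hy : y ∈ gr K q) (z : E) :
    br K (br K x y) z = br K x (br K y z) - koszul p q • br K y (br K x z) := by
  refine homogeneous_induction (K := K)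
    (P := fun z => br K (br K x y) z = br K x (br K y z) - koszul p q • br K y (br K x z)) ?_ ?_ z
  · intro z z' h h'
    simp only [br, map_add, smul_add] at *
    rw [h, h']
    abel
  · intro r z hz
    have := LieSuperalgebra.jacobi (K := K) hx hy hz
    simp only [br] at *
    rw [this, add_sub_cancel_right]

theorem br_br_right {p q : ZMod 2} {x y : E} (hx : x ∈ gr K p) (hy : y ∈ gr K q) (z : E) :
    br K x (br K y z) = br K (br K x y) z + koszul p q • br K y (br K x z) := by
  rw [br_br_left hx hy, sub_add_cancel]

theorem br_skew {p q : ZMod 2} {x y : E} (hx : x ∈ gr K p) (hy : y ∈ gr K q) :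
    br K x y = -(koszul p q • br K y x) := LieSuperalgebra.skew hx hy

/-- A submodule of a presented Lie superalgebra that contains the generators and is stable
under bracketing with them is everything. -/
theorem Presented.eq_top {R : Set (FreeNonUnitalNonAssocAlgebra K X)}
    (hR : IsHomogeneousSet K deg R) {N : Submodule K (Presented K deg hR)}
    (hN : ∀ x, Presented.mk K deg hR (FreeNonUnitalNonAssocAlgebra.of K x) ∈ N)
    (hN' : ∀ x, ∀ n ∈ N, br K (Presented.mk K deg hR (FreeNonUnitalNonAssocAlgebra.of K x)) n ∈ N) :
    N = ⊤ := by
  have hom : ∀ a : FreeMagma X, Presented.mk K deg hR (MonoidAlgebra.single a 1)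
      ∈ gr K (wordParity deg a) := fun a => ⟨_, Submodule.subset_span ⟨a, rfl, rfl⟩, rfl⟩
  have hmul : ∀ a b : FreeMagma X, Presented.mk K deg hR (MonoidAlgebra.single (a * b) 1)
      = br K (Presented.mk K deg hR (MonoidAlgebra.single a 1))
        (Presented.mk K deg hR (MonoidAlgebra.single b 1)) := fun a b => by
    rw [single_mul_word]; rfl
  -- By the Jacobi identity, bracketing with a product of words is a combination of iterated
  -- brackets with its factors; so stability under the generators gives stability under all words.
  have had : ∀ a : FreeMagma X, ∀ n ∈ N,
      br K (Presented.mk K deg hR (MonoidAlgebra.single a 1)) n ∈ N := by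
    intro a
    induction a with
    | ih1 x => exact hN' x
    | ih2 a b ha hb =>
      intro n hn
      rw [hmul, br_br_left (hom a) (hom b)]
      exact sub_mem (ha _ (hb _ hn)) (zsmul_mem (hb _ (ha _ hn)) _)
  have hword : ∀ a : FreeMagma X, Presented.mk K deg hR (MonoidAlgebra.single a 1) ∈ N := by
    intro a
    induction a with
    | ih1 x => exact hN x
    | ih2 a b ha hb =>
      rw [hmul]
      exact had a _ hb
  refine eq_top_iff.2 fun x _ => ?_
  obtain ⟨t, rfl⟩ := Presented.mk_surjective K deg hR x
  induction t using MonoidAlgebra.induction_linear with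
  | zero => rw [map_zero]; exact zero_mem _
  | add x y hx hy => rw [map_add]; exact add_mem (hx trivial) (hy trivial)
  | single a c =>
    have h : (MonoidAlgebra.single a c : FreeNonUnitalNonAssocAlgebra K X)
        = c • MonoidAlgebra.single a 1 := by simp
    rw [h, map_smul]
    exact Submodule.smul_mem _ _ (hword a)

end Free

/-! ### Families satisfying the Steinberg relations modulo a submodule -/

section Generators

variable {K : Type u} [CommRing K] {A : Type v} [Ring A] [Algebra K A]
  {I : Type*} {par : I → ZMod 2} (𝒜 : ZMod 2 → Submodule K A)
  {E : Type*} [AddCommGroup E] [Module K E] [LieSuperalgebra K E]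
  (f : I → I → A →ₗ[K] E)

/-- The values `f_{ij}(a)` on the generators. -/
def genLift (g : SteinbergGenerator I 𝒜) : E := f g.i g.j g.a

theorem freeLift_freeF {i j : I} (h : i ≠ j) (p : ZMod 2) (a : 𝒜 p) :
    freeLift (genLift 𝒜 f) (freeF 𝒜 h p a) = f i j a := freeLift_of _ _

variable (par) in
/-- Elements `f_{ij}(a)` that satisfy the relations of `st` modulo a submodule `C`. -/
structure IsSteinbergFamily (C : Submodule K E) : Prop where
  mem : ∀ {i j : I} (_ : i ≠ j) {p : ZMod 2} {a : A}, a ∈ 𝒜 p → f i j a ∈ gr K (par i + par j + p)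
  mul : ∀ {i j k : I} (_ : i ≠ j) (_ : j ≠ k) (_ : i ≠ k) {p q : ZMod 2} {a b : A},
    a ∈ 𝒜 p → b ∈ 𝒜 q → br K (f i j a) (f j k b) - f i k (a * b) ∈ C
  comm : ∀ {i j k l : I} (_ : i ≠ j) (_ : k ≠ l) (_ : j ≠ k) (_ : i ≠ l) {p q : ZMod 2} {a b : A},
    a ∈ 𝒜 p → b ∈ 𝒜 q → br K (f i j a) (f k l b) ∈ C

variable {𝒜 f} {C : Submodule K E}

theorem IsSteinbergFamily.genLift_mem (hf : IsSteinbergFamily par 𝒜 f C)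
    (g : SteinbergGenerator I 𝒜) :
    genLift 𝒜 f g ∈ gr K (SteinbergGenerator.deg par 𝒜 g) := hf.mem g.ne g.a.2

end Generators

/-! ### Root vectors of the Steinberg Lie superalgebra and its universal property -/

section Steinberg

variable {K : Type u} [CommRing K] {A : Type v} [Ring A] [Algebra K A]
  {I : Type*} (par : I → ZMod 2) (𝒜 : ZMod 2 → Submodule K A) [GradedAlgebra 𝒜]

theorem graded_induction {P : A → Prop} (hadd : ∀ a b, P a → P b → P (a + b))
    (h : ∀ (p : ZMod 2) (a : A), a ∈ 𝒜 p → P a) (a : A) : P a := by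
  obtain ⟨b, hb, c, hc, rfl⟩ := Submodule.mem_sup.1
    ((isCompl_of_gradedAlgebra 𝒜).sup_eq_top ▸ Submodule.mem_top : a ∈ 𝒜 0 ⊔ 𝒜 1)
  exact hadd _ _ (h _ _ hb) (h _ _ hc)

/-- The class of a generator `F_{ij}(a)`. -/
def stGen {i j : I} (h : i ≠ j) (p : ZMod 2) (a : 𝒜 p) : Steinberg par 𝒜 :=
  Presented.mk K (SteinbergGenerator.deg par 𝒜) (steinbergRelations_homogeneous par 𝒜)
    (freeF 𝒜 h p a)

variable {𝒜} in
theorem Steinberg.mk_relation {t : FreeNonUnitalNonAssocAlgebra K (SteinbergGenerator I 𝒜)}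
    (h : IsSteinbergRelation 𝒜 t) : Presented.mk K (SteinbergGenerator.deg par 𝒜)
      (steinbergRelations_homogeneous par 𝒜) t = 0 :=
  (Presented.mk_eq_zero K _ _).2 (subset_idealGen _ (Or.inr h))

theorem stGen_add {i j : I} (h : i ≠ j) (p : ZMod 2) (a b : 𝒜 p) :
    stGen par 𝒜 h p (a + b) = stGen par 𝒜 h p a + stGen par 𝒜 h p b := by
  have := Steinberg.mk_relation par (.add h p a b)
  rw [map_sub, map_add] at this
  exact sub_eq_zero.1 this

theorem stGen_smul {i j : I} (h : i ≠ j) (p : ZMod 2) (c : K) (a : 𝒜 p) :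
    stGen par 𝒜 h p (c • a) = c • stGen par 𝒜 h p a := by
  have := Steinberg.mk_relation par (.smul h p c a)
  rw [map_sub, map_smul] at this
  exact sub_eq_zero.1 this

theorem stGen_zero {i j : I} (h : i ≠ j) (p : ZMod 2) : stGen par 𝒜 h p 0 = 0 := by
  simpa using stGen_smul par 𝒜 h p 0 0

theorem stF_eq_sum {i j : I} (h : i ≠ j) (a : A) :
    stF par 𝒜 h a = ∑ p : ZMod 2, stGen par 𝒜 h p (DirectSum.decompose 𝒜 a p) := rfl

theorem stF_of_mem {i j : I} (h : i ≠ j) (p : ZMod 2) (a : 𝒜 p) :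
    stF par 𝒜 h a = stGen par 𝒜 h p a := by
  rw [stF_eq_sum, Finset.sum_eq_single p]
  · rw [DirectSum.decompose_coe, DirectSum.of_eq_same]
  · intro q _ hq
    rw [DirectSum.decompose_coe, DirectSum.of_eq_of_ne _ _ _ hq, stGen_zero]
  · simp

open Classical in
/-- The linear map `a ↦ F_{ij}(a)`, extended by zero to `i = j`. -/
def rootMap (i j : I) : A →ₗ[K] Steinberg par 𝒜 where
  toFun a := if h : i ≠ j then stF par 𝒜 h a else 0
  map_add' a b := by
    split_ifs with h
    · simp only [stF_eq_sum, DirectSum.decompose_add, DirectSum.add_apply, stGen_add,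
        Finset.sum_add_distrib]
    · simp
  map_smul' c a := by
    split_ifs with h
    · simp only [stF_eq_sum, DirectSum.decompose_smul, DirectSum.smul_apply, stGen_smul,
        Finset.smul_sum, RingHom.id_apply]
    · simp

theorem rootMap_eq {i j : I} (h : i ≠ j) (a : A) : rootMap par 𝒜 i j a = stF par 𝒜 h a :=
  dif_pos h

theorem rootMap_of_mem {i j : I} (h : i ≠ j) {p : ZMod 2} {a : A} (ha : a ∈ 𝒜 p) :
    rootMap par 𝒜 i j a = stGen par 𝒜 h p ⟨a, ha⟩ := by
  rw [rootMap_eq _ _ h, ← stF_of_mem]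

theorem rootMap_mem (i j : I) {p : ZMod 2} {a : A} (ha : a ∈ 𝒜 p) :
    rootMap par 𝒜 i j a ∈ gr K (par i + par j + p) := by
  by_cases h : i = j
  · rw [show rootMap par 𝒜 i j a = 0 from dif_neg (by simpa using h)]
    exact zero_mem _
  · rw [rootMap_of_mem par 𝒜 h ha]
    exact ⟨_, freeF_mem par 𝒜 h p ⟨a, ha⟩, rfl⟩

theorem rootMap_br {i j k : I} (hij : i ≠ j) (hjk : j ≠ k) (hik : i ≠ k) (a b : A) :
    br K (rootMap par 𝒜 i j a) (rootMap par 𝒜 j k b) = rootMap par 𝒜 i k (a * b) := by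
  refine graded_induction 𝒜 (P := fun a => br K (rootMap par 𝒜 i j a) (rootMap par 𝒜 j k b)
    = rootMap par 𝒜 i k (a * b)) ?_ ?_ a
  · intro a a' h h'
    simp only [br, map_add, LinearMap.add_apply, add_mul] at *
    rw [h, h']
  intro p a ha
  refine graded_induction 𝒜 (P := fun b => br K (rootMap par 𝒜 i j a) (rootMap par 𝒜 j k b)
    = rootMap par 𝒜 i k (a * b)) ?_ ?_ b
  · intro b b' h h'
    simp only [br, map_add, mul_add] at *
    rw [h, h']
  intro q b hb
  rw [rootMap_of_mem par 𝒜 hij ha, rootMap_of_mem par 𝒜 hjk hb,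
    rootMap_of_mem par 𝒜 hik (SetLike.mul_mem_graded ha hb)]
  have := Steinberg.mk_relation par (.mul hij hjk hik p q ⟨a, ha⟩ ⟨b, hb⟩)
  rw [map_sub] at this
  exact sub_eq_zero.1 this

theorem rootMap_comm {i j k l : I} (hij : i ≠ j) (hkl : k ≠ l) (hjk : j ≠ k) (hil : i ≠ l)
    (a b : A) : br K (rootMap par 𝒜 i j a) (rootMap par 𝒜 k l b) = 0 := by
  refine graded_induction 𝒜 (P := fun a => br K (rootMap par 𝒜 i j a) (rootMap par 𝒜 k l b)
    = 0) ?_ ?_ a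
  · intro a a' h h'
    simp only [br, map_add, LinearMap.add_apply] at *
    rw [h, h', add_zero]
  intro p a ha
  refine graded_induction 𝒜 (P := fun b => br K (rootMap par 𝒜 i j a) (rootMap par 𝒜 k l b)
    = 0) ?_ ?_ b
  · intro b b' h h'
    simp only [br, map_add] at *
    rw [h, h', add_zero]
  intro q b hb
  rw [rootMap_of_mem par 𝒜 hij ha, rootMap_of_mem par 𝒜 hkl hb]
  exact Steinberg.mk_relation par (.comm hij hkl hjk hil p q ⟨a, ha⟩ ⟨b, hb⟩)

/-- A submodule of `st` that contains the `F_{ij}(a)` and is stable under bracketing with them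
is everything. -/
theorem Steinberg.eq_top {N : Submodule K (Steinberg par 𝒜)}
    (hN : ∀ (i j : I) (_ : i ≠ j) (p : ZMod 2) (a : A) (_ : a ∈ 𝒜 p), rootMap par 𝒜 i j a ∈ N)
    (hN' : ∀ (i j : I) (_ : i ≠ j) (p : ZMod 2) (a : A) (_ : a ∈ 𝒜 p),
      ∀ n ∈ N, br K (rootMap par 𝒜 i j a) n ∈ N) : N = ⊤ := by
  refine Presented.eq_top _ ?_ ?_
  · rintro ⟨i, j, h, p, a⟩
    have := hN i j h p a a.2
    rwa [rootMap_of_mem par 𝒜 h a.2] at this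
  · rintro ⟨i, j, h, p, a⟩
    have := hN' i j h p a a.2
    rwa [rootMap_of_mem par 𝒜 h a.2] at this

section Lift

variable {E : Type*} [AddCommGroup E] [Module K E] [LieSuperalgebra K E]
  (f : I → I → A →ₗ[K] E)

variable {par 𝒜 f} {C : Submodule K E}

theorem IsSteinbergFamily.relation (hf : IsSteinbergFamily par 𝒜 f C)
    {t : FreeNonUnitalNonAssocAlgebra K (SteinbergGenerator I 𝒜)}
    (ht : IsSteinbergRelation 𝒜 t) : freeLift (genLift 𝒜 f) t ∈ C := by
  cases ht with
  | add h p a b =>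
    simp only [map_sub, map_add, freeLift_freeF, Submodule.coe_add, sub_self, zero_mem]
  | smul h p c a =>
    simp only [map_sub, map_smul, freeLift_freeF, Submodule.coe_smul, sub_self, zero_mem]
  | mul hij hjk hik p q a b =>
    simp only [map_sub, freeLift_mul, freeLift_freeF]
    exact hf.mul hij hjk hik a.2 b.2
  | comm hij hkl hjk hil p q a b =>
    simp only [freeLift_mul, freeLift_freeF]
    exact hf.comm hij hkl hjk hil a.2 b.2

/-- The universal property of `st`. -/
def Steinberg.lift (hf : IsSteinbergFamily par 𝒜 f ⊥) : LieSuperHom K (Steinberg par 𝒜) E :=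
  Presented.lift (genLift 𝒜 f) hf.genLift_mem (steinbergRelations_homogeneous par 𝒜)
    fun _ hr => hf.relation hr

theorem Steinberg.lift_rootMap (hf : IsSteinbergFamily par 𝒜 f ⊥) {i j : I} (h : i ≠ j) (a : A) :
    Steinberg.lift hf (rootMap par 𝒜 i j a) = f i j a := by
  refine graded_induction 𝒜
    (P := fun a => Steinberg.lift hf (rootMap par 𝒜 i j a) = f i j a) ?_ ?_ a
  · intro a b ha hb
    simp only [map_add, ha, hb]
  · intro p a ha
    rw [rootMap_of_mem par 𝒜 h ha]
    exact freeLift_freeF 𝒜 f h p ⟨a, ha⟩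

end Lift

end Steinberg

/-! ### Root vectors and Cartan part -/

section Structure

variable {K : Type u} [CommRing K] {A : Type v} [Ring A] [Algebra K A]
  (par : Fin 4 → ZMod 2) (𝒜 : ZMod 2 → Submodule K A) [GradedAlgebra 𝒜]

theorem exists_ne_ne (i j : Fin 4) : ∃ k, k ≠ i ∧ k ≠ j := by
  revert i j; decide

theorem rootMap_self (i : Fin 4) (a : A) : rootMap par 𝒜 i i a = 0 := dif_neg (by simp)

/-- With a third index `k`, `F_{ij}(a) = [F_{ik}(a), F_{kj}(1)]`. -/
theorem Steinberg.isPerfect : IsPerfect K (Steinberg par 𝒜) := by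
  refine Steinberg.eq_top par 𝒜 ?_ ?_
  · intro i j h p a _
    obtain ⟨k, hi, hj⟩ := exists_ne_ne i j
    rw [← mul_one a, ← rootMap_br par 𝒜 hi.symm hj h]
    exact br_mem_derived K _ _ _
  · intro i j _ p a _ n _
    exact br_mem_derived K _ _ _

theorem rootMap_br_symm {i j k : Fin 4} (hij : i ≠ j) (hjk : j ≠ k) (hik : i ≠ k)
    {p q : ZMod 2} {a b : A} (ha : a ∈ 𝒜 p) (hb : b ∈ 𝒜 q) :
    br K (rootMap par 𝒜 j k b) (rootMap par 𝒜 i j a) =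
      -(koszul (par j + par k + q) (par i + par j + p) • rootMap par 𝒜 i k (a * b)) := by
  rw [br_skew (rootMap_mem par 𝒜 j k hb) (rootMap_mem par 𝒜 i j ha),
    rootMap_br par 𝒜 hij hjk hik]

/-- `F_{ji}` acts on `F_{kl}(c)` nontrivially only for `k = i` or `l = j`, and then `F_{ij}` brings
the result back to the root `(k, l)`. The case `(k, l) = (i, j)` must be left out, since there the
first bracket is a Cartan element. -/
theorem rootMap_br_br_mem {i j k l : Fin 4} (hij : i ≠ j) (hkl : k ≠ l)
    (h : ¬(k = i ∧ l = j)) (h' : ¬(k = j ∧ l = i)) {p q r : ZMod 2} {a b c : A}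
    (ha : a ∈ 𝒜 p) (hb : b ∈ 𝒜 q) (hc : c ∈ 𝒜 r) :
    br K (rootMap par 𝒜 i j a) (br K (rootMap par 𝒜 j i b) (rootMap par 𝒜 k l c))
      ∈ LinearMap.range (rootMap par 𝒜 k l) := by
  by_cases hki : k = i
  · subst hki
    have hlj : l ≠ j := fun e => h ⟨rfl, e⟩
    rw [rootMap_br par 𝒜 hij.symm hkl hlj.symm, rootMap_br par 𝒜 hij hlj.symm hkl]
    exact ⟨_, rfl⟩
  by_cases hlj : l = j
  · subst hlj
    rw [rootMap_br_symm par 𝒜 hkl hij.symm hki hc hb]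
    have e := rootMap_br_symm par 𝒜 hki hij hkl (SetLike.mul_mem_graded hc hb) ha
    simp only [br, map_neg, map_zsmul] at e ⊢
    rw [e]
    exact neg_mem (zsmul_mem (neg_mem (zsmul_mem (LinearMap.mem_range_self _ _) _)) _)
  rw [rootMap_comm par 𝒜 hij.symm hkl (Ne.symm hki) (Ne.symm hlj)]
  simp only [br, map_zero, zero_mem]

theorem cartan_br_mem_of_ne {i j k l : Fin 4} (hij : i ≠ j) (hkl : k ≠ l)
    (h : ¬(k = i ∧ l = j)) (h' : ¬(k = j ∧ l = i)) {p q : ZMod 2} {a b : A} (c : A)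
    (ha : a ∈ 𝒜 p) (hb : b ∈ 𝒜 q) :
    br K (br K (rootMap par 𝒜 i j a) (rootMap par 𝒜 j i b)) (rootMap par 𝒜 k l c)
      ∈ LinearMap.range (rootMap par 𝒜 k l) := by
  refine graded_induction 𝒜 (P := fun c => br K (br K (rootMap par 𝒜 i j a)
      (rootMap par 𝒜 j i b)) (rootMap par 𝒜 k l c) ∈ LinearMap.range (rootMap par 𝒜 k l)) ?_ ?_ c
  · intro c d hc hd
    have := add_mem hc hd
    simp only [br, map_add] at this ⊢
    exact this
  · intro r c hc
    rw [br_br_left (rootMap_mem par 𝒜 i j ha) (rootMap_mem par 𝒜 j i hb)]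
    exact sub_mem (rootMap_br_br_mem par 𝒜 hij hkl h h' ha hb hc)
      (zsmul_mem (rootMap_br_br_mem par 𝒜 hij.symm hkl h' h hb ha hc) _)

/-- The elements `H_{ij}(a, b)` stabilize the root spaces. -/
theorem cartan_br_mem {i j k l : Fin 4} (hij : i ≠ j) (hkl : k ≠ l) {p q : ZMod 2} {a b : A}
    (c : A) (ha : a ∈ 𝒜 p) (hb : b ∈ 𝒜 q) :
    br K (br K (rootMap par 𝒜 i j a) (rootMap par 𝒜 j i b)) (rootMap par 𝒜 k l c)
      ∈ LinearMap.range (rootMap par 𝒜 k l) := by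
  by_cases h : (k = i ∧ l = j) ∨ (k = j ∧ l = i)
  -- On the two roots supported on `{i, j}` the direct computation breaks down. Writing `F_{kl}(c) =
  -- [F_{km}(c), F_{ml}(1)]` with a third index `m` and applying the Jacobi identity reduces to
  -- roots already treated.
  · obtain ⟨m, hmi, hmj⟩ := exists_ne_ne i j
    have hmk : m ≠ k := by
      obtain ⟨rfl, rfl⟩ | ⟨rfl, rfl⟩ := h
      exacts [hmi, hmj]
    have hml : m ≠ l := by
      obtain ⟨rfl, rfl⟩ | ⟨rfl, rfl⟩ := h
      exacts [hmj, hmi]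
    refine graded_induction 𝒜 (P := fun c => br K (br K (rootMap par 𝒜 i j a)
      (rootMap par 𝒜 j i b)) (rootMap par 𝒜 k l c) ∈ LinearMap.range (rootMap par 𝒜 k l)) ?_ ?_ c
    · intro c d hc hd
      have := add_mem hc hd
      simp only [br, map_add] at this ⊢
      exact this
    intro r c hc
    obtain ⟨d, hd⟩ := cartan_br_mem_of_ne par 𝒜 hij hmk.symm (k := k) (l := m)
      (fun e => hmj e.2) (fun e => hmi e.2) c ha hb
    obtain ⟨e, he⟩ := cartan_br_mem_of_ne par 𝒜 hij hml (k := m) (l := l)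
      (fun e => hmi e.1) (fun e => hmj e.1) 1 ha hb
    have h1 := rootMap_br par 𝒜 hmk.symm hml hkl c 1
    rw [mul_one] at h1
    rw [← h1, br_br_right (LieSuperalgebra.bracket_mem (rootMap_mem par 𝒜 i j ha)
      (rootMap_mem par 𝒜 j i hb)) (rootMap_mem par 𝒜 k m hc), ← hd, ← he,
      rootMap_br par 𝒜 hmk.symm hml hkl, rootMap_br par 𝒜 hmk.symm hml hkl]
    exact add_mem (LinearMap.mem_range_self _ _) (zsmul_mem (LinearMap.mem_range_self _ _) _)
  · exact cartan_br_mem_of_ne par 𝒜 hij hkl (fun e => h (.inl e)) (fun e => h (.inr e)) c ha hb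

/-- The elements `F_{ij}(a)`. -/
def rootSet : Set (Steinberg par 𝒜) := {x | ∃ i j : Fin 4, i ≠ j ∧ ∃ a, x = rootMap par 𝒜 i j a}

/-- The elements `[F_{ij}(a), F_{ji}(b)]` for homogeneous `a` and `b`. -/
def cartanSet : Set (Steinberg par 𝒜) := {x | ∃ i j : Fin 4, i ≠ j ∧ ∃ (p q : ZMod 2) (a b : A),
  a ∈ 𝒜 p ∧ b ∈ 𝒜 q ∧ x = br K (rootMap par 𝒜 i j a) (rootMap par 𝒜 j i b)}

variable {par 𝒜} in
theorem cartanSet_br_mem {h : Steinberg par 𝒜} (hh : h ∈ Submodule.span K (cartanSet par 𝒜))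
    {k l : Fin 4} (hkl : k ≠ l) (c : A) :
    br K h (rootMap par 𝒜 k l c) ∈ LinearMap.range (rootMap par 𝒜 k l) := by
  induction hh using Submodule.span_induction with
  | zero => simp [br]
  | add x y _ _ hx hy =>
    have := add_mem hx hy
    simp only [br, map_add, LinearMap.add_apply] at this ⊢
    exact this
  | smul r x _ hx =>
    have := Submodule.smul_mem _ r hx
    simp only [br, map_smul, LinearMap.smul_apply] at this ⊢
    exact this
  | mem x hx =>
    obtain ⟨i, j, hij, p, q, a, b, ha, hb, rfl⟩ := hx
    exact cartan_br_mem par 𝒜 hij hkl c ha hb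

/-- The sum of the two spans is stable under every `F_{ij}(a)`: two root vectors bracket to a root
vector, to an element of the Cartan part or to zero, and the Cartan part preserves each root space.
-/
theorem Steinberg.span_eq_top :
    Submodule.span K (rootSet par 𝒜) ⊔ Submodule.span K (cartanSet par 𝒜) = ⊤ := by
  refine Steinberg.eq_top par 𝒜 ?_ ?_
  · intro i j h p a _
    exact Submodule.mem_sup_left (Submodule.subset_span ⟨i, j, h, a, rfl⟩)
  intro i j hij p a ha n hn
  obtain ⟨y, hy, z, hz, rfl⟩ := Submodule.mem_sup.1 hn
  simp only [br, map_add]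
  refine add_mem ?_ ?_
  · clear hn
    induction hy using Submodule.span_induction with
    | zero => simp
    | add x y _ _ hx hy => rw [map_add]; exact add_mem hx hy
    | smul r x _ hx => rw [map_smul]; exact Submodule.smul_mem _ _ hx
    | mem x hx =>
      obtain ⟨k, l, hkl, b, rfl⟩ := hx
      refine graded_induction 𝒜 (P := fun b => br K (rootMap par 𝒜 i j a) (rootMap par 𝒜 k l b)
        ∈ Submodule.span K (rootSet par 𝒜) ⊔ Submodule.span K (cartanSet par 𝒜)) ?_ ?_ b
      · intro c d hc hd
        have := add_mem hc hd
        simp only [br, map_add] at this ⊢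
        exact this
      intro q b hb
      by_cases hjk : j = k
      · subst hjk
        by_cases hil : i = l
        · subst hil
          exact Submodule.mem_sup_right
            (Submodule.subset_span ⟨i, j, hij, p, q, a, b, ha, hb, rfl⟩)
        · rw [rootMap_br par 𝒜 hij hkl hil]
          exact Submodule.mem_sup_left (Submodule.subset_span ⟨i, l, hil, _, rfl⟩)
      · by_cases hil : i = l
        · subst hil
          rw [rootMap_br_symm par 𝒜 hkl hij (Ne.symm hjk) hb ha]
          have hm : rootMap par 𝒜 k j (b * a) ∈ Submodule.span K (rootSet par 𝒜) :=
            Submodule.subset_span ⟨k, j, Ne.symm hjk, _, rfl⟩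
          exact Submodule.mem_sup_left (neg_mem (zsmul_mem hm _))
        · rw [rootMap_comm par 𝒜 hij hkl hjk hil]
          exact zero_mem _
  · clear hn
    refine Submodule.mem_sup_left ?_
    induction hz using Submodule.span_induction with
    | zero => simp
    | add x y _ _ hx hy => rw [map_add]; exact add_mem hx hy
    | smul r x _ hx => rw [map_smul]; exact Submodule.smul_mem _ _ hx
    | mem x hx =>
      have hx' := hx
      obtain ⟨k, l, hkl, q, r, b, c, hb, hc, rfl⟩ := hx
      obtain ⟨d, hd⟩ := cartanSet_br_mem (Submodule.subset_span hx') hij a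
      have := br_skew (rootMap_mem par 𝒜 i j ha)
        (LieSuperalgebra.bracket_mem (K := K) (rootMap_mem par 𝒜 k l hb)
          (rootMap_mem par 𝒜 l k hc))
      simp only [br] at this hd ⊢
      rw [this, ← hd]
      have hm : rootMap par 𝒜 i j d ∈ Submodule.span K (rootSet par 𝒜) :=
        Submodule.subset_span ⟨i, j, hij, d, rfl⟩
      exact neg_mem (zsmul_mem hm _)

/-- Every element of `st` is the sum of root vectors and an element of the Cartan part. -/
theorem Steinberg.exists_decomposition (x : Steinberg par 𝒜) : ∃ c : Fin 4 → Fin 4 → A,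
    ∃ h ∈ Submodule.span K (cartanSet par 𝒜), ∑ i, ∑ j, rootMap par 𝒜 i j (c i j) + h = x := by
  obtain ⟨y, hy, h, hh, rfl⟩ := Submodule.mem_sup.1
    (Steinberg.span_eq_top par 𝒜 ▸ Submodule.mem_top :
      x ∈ Submodule.span K (rootSet par 𝒜) ⊔ Submodule.span K (cartanSet par 𝒜))
  suffices ∃ c : Fin 4 → Fin 4 → A, ∑ i, ∑ j, rootMap par 𝒜 i j (c i j) = y by
    obtain ⟨c, rfl⟩ := this
    exact ⟨c, h, hh, rfl⟩
  induction hy using Submodule.span_induction with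
  | zero => exact ⟨0, by simp⟩
  | add x y _ _ hx hy =>
    obtain ⟨c, rfl⟩ := hx
    obtain ⟨d, rfl⟩ := hy
    exact ⟨c + d, by simp [Finset.sum_add_distrib]⟩
  | smul r x _ hx =>
    obtain ⟨c, rfl⟩ := hx
    exact ⟨r • c, by simp [Finset.smul_sum]⟩
  | mem x hx =>
    obtain ⟨i, j, -, a, rfl⟩ := hx
    refine ⟨fun k l => if k = i ∧ l = j then a else 0, ?_⟩
    rw [Finset.sum_eq_single i, Finset.sum_eq_single j]
    · simp
    · intro k _ hk
      simp [hk]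
    · simp
    · intro k _ hk
      simp [hk]
    · simp

end Structure

/-! ### The homomorphism to `sl` -/

section SpecialLinear

variable {K : Type u} [CommRing K] {A : Type v} [Ring A] [Algebra K A]
  (par : Fin 4 → ZMod 2) (𝒜 : ZMod 2 → Submodule K A) [GradedAlgebra 𝒜]

/-- The linear map `a ↦ E_{ij}(a)`. -/
def unitMap (i j : Fin 4) : A →ₗ[K] SuperGL par 𝒜 where
  toFun a := matrixUnit par 𝒜 i j a
  map_add' a b := Matrix.single_add i j a b
  map_smul' c a := (Matrix.smul_single c i j a).symm

omit [GradedAlgebra 𝒜] in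
theorem unitMap_apply (i j : Fin 4) (a : A) :
    unitMap par 𝒜 i j a = (Matrix.single i j a : Matrix (Fin 4) (Fin 4) A) := rfl

theorem unitMap_mem (i j : Fin 4) {p : ZMod 2} {a : A} (ha : a ∈ 𝒜 p) :
    unitMap par 𝒜 i j a ∈ gr K (par i + par j + p) := by
  intro k l
  by_cases h : i = k ∧ j = l
  · obtain ⟨rfl, rfl⟩ := h
    rw [unitMap_apply, Matrix.single_apply_same, show par i + par j + (par i + par j + p) = p by
      linear_combination parity_add_self (par i + par j)]
    exact ha
  · rw [unitMap_apply, Matrix.single_apply_of_ne _ _ _ _ _ h]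
    exact zero_mem _

theorem unitMap_br (i j k l : Fin 4) {p q : ZMod 2} {a b : A} (ha : a ∈ 𝒜 p) (hb : b ∈ 𝒜 q) :
    br K (unitMap par 𝒜 i j a) (unitMap par 𝒜 k l b) =
      (if j = k then unitMap par 𝒜 i l (a * b) else 0)
        - koszul (par i + par j + p) (par k + par l + q) •
          (if l = i then unitMap par 𝒜 k j (b * a) else 0) := by
  refine (glBracket_of_mem par 𝒜 (unitMap_mem par 𝒜 i j ha) (unitMap_mem par 𝒜 k l hb)).trans ?_
  congr 1
  · split_ifs with h
    · subst h
      exact Matrix.single_mul_single_same ..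
    · exact Matrix.single_mul_single_of_ne _ _ _ _ h _
  · congr 1
    split_ifs with h
    · subst h
      exact Matrix.single_mul_single_same ..
    · exact Matrix.single_mul_single_of_ne _ _ _ _ h _

theorem unitMap_isSteinbergFamily : IsSteinbergFamily par 𝒜 (unitMap par 𝒜) ⊥ where
  mem _ _ _ ha := unitMap_mem par 𝒜 _ _ ha
  mul _ _ hik _ _ _ _ ha hb := by
    rw [unitMap_br par 𝒜 _ _ _ _ ha hb, if_pos rfl, if_neg (Ne.symm hik), smul_zero, sub_zero,
      sub_self]
    exact zero_mem _
  comm _ _ hjk hil _ _ _ _ ha hb := by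
    rw [unitMap_br par 𝒜 _ _ _ _ ha hb, if_neg hjk, if_neg (Ne.symm hil), smul_zero, sub_zero]
    exact zero_mem _

/-- The homomorphism `st → gl`. -/
def stToGL : LieSuperHom K (Steinberg par 𝒜) (SuperGL par 𝒜) :=
  Steinberg.lift (unitMap_isSteinbergFamily par 𝒜)

theorem stToGL_rootMap {i j : Fin 4} (h : i ≠ j) (a : A) :
    stToGL par 𝒜 (rootMap par 𝒜 i j a) = unitMap par 𝒜 i j a := Steinberg.lift_rootMap _ h a

/-- A homomorphism from a perfect Lie superalgebra takes its values in the derived algebra. -/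
def LieSuperHom.toDerived {L M : Type*} [AddCommGroup L] [Module K L] [LieSuperalgebra K L]
    [AddCommGroup M] [Module K M] [LieSuperalgebra K M] (f : LieSuperHom K L M)
    (hL : IsPerfect K L) : LieSuperHom K L (Derived K M) where
  toLinearMap := f.toLinearMap.codRestrict _ fun x =>
    hL.induction (P := fun x => f x ∈ derivedSubmodule K M) (by rw [map_zero]; exact zero_mem _)
      (fun x y hx hy => by rw [map_add]; exact add_mem hx hy)
      (fun c x hx => by rw [map_smul]; exact Submodule.smul_mem _ _ hx)
      (fun x y => by rw [f.br]; exact br_mem_derived K M _ _) x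
  map_gr _ _ hx := f.mem_gr hx
  map_br x y := Subtype.ext (f.br x y)

/-- The homomorphism `st → sl`. -/
def stToSL : LieSuperHom K (Steinberg par 𝒜) (SuperSL par 𝒜) :=
  (stToGL par 𝒜).toDerived (Steinberg.isPerfect par 𝒜)

theorem stToSL_coe (x : Steinberg par 𝒜) :
    (stToSL par 𝒜 x : SuperGL par 𝒜) = stToGL par 𝒜 x := rfl

theorem unitMap_mem_range {i j : Fin 4} (h : i ≠ j) (a : A) :
    unitMap par 𝒜 i j a ∈ LinearMap.range (stToGL par 𝒜).toLinearMap :=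
  ⟨_, stToGL_rootMap par 𝒜 h a⟩

theorem br_mem_range {x y : SuperGL par 𝒜} (hx : x ∈ LinearMap.range (stToGL par 𝒜).toLinearMap)
    (hy : y ∈ LinearMap.range (stToGL par 𝒜).toLinearMap) :
    br K x y ∈ LinearMap.range (stToGL par 𝒜).toLinearMap := by
  obtain ⟨x, rfl⟩ := hx
  obtain ⟨y, rfl⟩ := hy
  exact ⟨_, (stToGL par 𝒜).br x y⟩

theorem unitMap_br_mem_range (i j k l : Fin 4) {p q : ZMod 2} {a b : A} (ha : a ∈ 𝒜 p)
    (hb : b ∈ 𝒜 q) : br K (unitMap par 𝒜 i j a) (unitMap par 𝒜 k l b)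
      ∈ LinearMap.range (stToGL par 𝒜).toLinearMap := by
  by_cases hij : i = j
  · by_cases hkl : k = l
    · subst hij hkl
      by_cases hik : i = k
      · subst hik
        -- `[E_{ii}(a), E_{ii}(b)]` is recovered from off-diagonal brackets through an auxiliary
        -- index `m`: subtract `(-1)^{|a||b|} [E_{im}(1), E_{mi}(ba)]` from `[E_{im}(a),
        -- E_{mi}(b)]`. The two contributions in `E_{mm}(ba)` have the same sign and cancel.
        obtain ⟨m, hm, -⟩ := exists_ne_ne i i
        have h1 := br_mem_range par 𝒜 (unitMap_mem_range par 𝒜 hm.symm a)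
          (unitMap_mem_range par 𝒜 hm b)
        have h2 := br_mem_range par 𝒜 (unitMap_mem_range par 𝒜 hm.symm 1)
          (unitMap_mem_range par 𝒜 hm (b * a))
        rw [unitMap_br par 𝒜 _ _ _ _ ha hb] at h1
        rw [unitMap_br par 𝒜 _ _ _ _ SetLike.GradedOne.one_mem
          (SetLike.mul_mem_graded hb ha)] at h2
        rw [unitMap_br par 𝒜 _ _ _ _ ha hb]
        have h3 := sub_mem h1 (zsmul_mem h2 (koszul p q))
        simp only [if_true, one_mul, mul_one] at h3 ⊢
        convert h3 using 1
        obtain e | e := parity_cases (par i) <;> obtain e' | e' := parity_cases (par m) <;>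
          obtain rfl | rfl := parity_cases p <;> obtain rfl | rfl := parity_cases q <;>
          simp [e, e', parity_add_self] <;> abel
      · rw [unitMap_br par 𝒜 _ _ _ _ ha hb, if_neg hik, if_neg (Ne.symm hik), smul_zero, sub_zero]
        exact zero_mem _
    · subst hij
      rw [unitMap_br par 𝒜 _ _ _ _ ha hb]
      refine sub_mem ?_ (zsmul_mem ?_ _)
      · split_ifs with h
        · exact unitMap_mem_range par 𝒜 (h ▸ hkl) _
        · exact zero_mem _
      · split_ifs with h
        · exact unitMap_mem_range par 𝒜 (h ▸ hkl) _
        · exact zero_mem _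
  · by_cases hkl : k = l
    · subst hkl
      rw [unitMap_br par 𝒜 _ _ _ _ ha hb]
      refine sub_mem ?_ (zsmul_mem ?_ _)
      · split_ifs with h
        · exact unitMap_mem_range par 𝒜 (h ▸ hij) _
        · exact zero_mem _
      · split_ifs with h
        · exact unitMap_mem_range par 𝒜 (h ▸ hij) _
        · exact zero_mem _
    · exact br_mem_range par 𝒜 (unitMap_mem_range par 𝒜 hij a) (unitMap_mem_range par 𝒜 hkl b)

theorem unitMap_span : Submodule.span K {x : SuperGL par 𝒜 | ∃ (i j : Fin 4) (p : ZMod 2) (a : A),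
    a ∈ 𝒜 p ∧ x = unitMap par 𝒜 i j a} = ⊤ := by
  refine eq_top_iff.2 fun x _ => ?_
  rw [show x = ∑ i, ∑ j, unitMap par 𝒜 i j (x i j) from Matrix.matrix_eq_sum_single x]
  refine sum_mem fun i _ => sum_mem fun j _ => ?_
  refine graded_induction 𝒜 (P := fun a => unitMap par 𝒜 i j a ∈ _) ?_ ?_ (x i j)
  · intro a b ha hb
    rw [map_add]
    exact add_mem ha hb
  · intro p a ha
    exact Submodule.subset_span ⟨i, j, p, a, ha, rfl⟩

theorem derived_le_range :
    derivedSubmodule K (SuperGL par 𝒜) ≤ LinearMap.range (stToGL par 𝒜).toLinearMap := by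
  refine Submodule.span_le.2 ?_
  rintro _ ⟨x, y, rfl⟩
  have hx : x ∈ Submodule.span K {x : SuperGL par 𝒜 | ∃ (i j : Fin 4) (p : ZMod 2) (a : A),
    a ∈ 𝒜 p ∧ x = unitMap par 𝒜 i j a} := unitMap_span par 𝒜 ▸ Submodule.mem_top
  have hy : y ∈ Submodule.span K {x : SuperGL par 𝒜 | ∃ (i j : Fin 4) (p : ZMod 2) (a : A),
    a ∈ 𝒜 p ∧ x = unitMap par 𝒜 i j a} := unitMap_span par 𝒜 ▸ Submodule.mem_top
  induction hx, hy using Submodule.span_induction₂ with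
  | mem_mem x y hx hy =>
    obtain ⟨i, j, p, a, ha, rfl⟩ := hx
    obtain ⟨k, l, q, b, hb, rfl⟩ := hy
    exact unitMap_br_mem_range par 𝒜 i j k l ha hb
  | zero_left => simp [br]
  | zero_right => simp [br]
  | add_left _ _ _ _ _ _ h h' =>
    simp only [br, map_add, LinearMap.add_apply] at *
    exact add_mem h h'
  | add_right _ _ _ _ _ _ h h' =>
    simp only [br, map_add] at *
    exact add_mem h h'
  | smul_left c _ _ _ _ h =>
    simp only [br, map_smul, LinearMap.smul_apply] at *
    exact Submodule.smul_mem _ c h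
  | smul_right c _ _ _ _ h =>
    simp only [br, map_smul] at *
    exact Submodule.smul_mem _ c h

/-- The diagonal matrices. -/
def diagonalMatrices : Submodule K (SuperGL par 𝒜) where
  carrier := {x | ∀ i j, i ≠ j → x i j = 0}
  add_mem' {x y} hx hy i j h := by
    change x i j + y i j = 0
    rw [hx i j h, hy i j h, add_zero]
  zero_mem' _ _ _ := rfl
  smul_mem' c x hx i j h := by
    change c • x i j = 0
    rw [hx i j h, smul_zero]

theorem glProj_diagonal (p : ZMod 2) {x : SuperGL par 𝒜} (hx : x ∈ diagonalMatrices par 𝒜) :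
    (glProj par 𝒜 p x : SuperGL par 𝒜) ∈ diagonalMatrices par 𝒜 := by
  intro i j h
  change GradedAlgebra.proj 𝒜 (par i + par j + p) (x i j) = 0
  rw [hx i j h, map_zero]

omit [GradedAlgebra 𝒜] in
theorem mul_diagonal {x y : Matrix (Fin 4) (Fin 4) A}
    (hx : (x : SuperGL par 𝒜) ∈ diagonalMatrices par 𝒜)
    (hy : (y : SuperGL par 𝒜) ∈ diagonalMatrices par 𝒜) :
    (x * y : Matrix (Fin 4) (Fin 4) A) ∈ diagonalMatrices par 𝒜 := by
  intro i j h
  rw [Matrix.mul_apply]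
  refine Finset.sum_eq_zero fun k _ => ?_
  by_cases hik : i = k
  · subst hik
    rw [show y i j = 0 from hy i j h, mul_zero]
  · rw [show x i k = 0 from hx i k hik, zero_mul]

theorem br_diagonal {x y : SuperGL par 𝒜} (hx : x ∈ diagonalMatrices par 𝒜)
    (hy : y ∈ diagonalMatrices par 𝒜) : br K x y ∈ diagonalMatrices par 𝒜 := by
  change (∑ p : ZMod 2, ∑ q : ZMod 2, (glProj par 𝒜 p x * glProj par 𝒜 q y
    - koszul p q • (glProj par 𝒜 q y * glProj par 𝒜 p x)) : Matrix (Fin 4) (Fin 4) A)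
      ∈ diagonalMatrices par 𝒜
  refine Submodule.sum_mem _ fun p _ => Submodule.sum_mem _ fun q _ => ?_
  have hx' := glProj_diagonal par 𝒜 p hx
  have hy' := glProj_diagonal par 𝒜 q hy
  exact Submodule.sub_mem _ (mul_diagonal par 𝒜 hx' hy') (zsmul_mem (mul_diagonal par 𝒜 hy' hx') _)

theorem br_unitMap_diagonal {i j : Fin 4} (a b : A) :
    br K (unitMap par 𝒜 i j a) (unitMap par 𝒜 j i b) ∈ diagonalMatrices par 𝒜 := by
  refine graded_induction 𝒜 (P := fun a => br K (unitMap par 𝒜 i j a) (unitMap par 𝒜 j i b) ∈ _)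
    ?_ ?_ a
  · intro a a' h h'
    simp only [br, map_add, LinearMap.add_apply] at *
    exact add_mem h h'
  intro p a ha
  refine graded_induction 𝒜 (P := fun b => br K (unitMap par 𝒜 i j a) (unitMap par 𝒜 j i b) ∈ _)
    ?_ ?_ b
  · intro a a' h h'
    simp only [br, map_add] at *
    exact add_mem h h'
  intro q b hb
  have hd : ∀ (k : Fin 4) (c : A), unitMap par 𝒜 k k c ∈ diagonalMatrices par 𝒜 := by
    intro k c l m hlm
    exact Matrix.single_apply_of_ne _ _ _ _ _ (fun h => hlm (h.1.symm.trans h.2))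
  rw [unitMap_br par 𝒜 _ _ _ _ ha hb, if_pos rfl, if_pos rfl]
  exact sub_mem (hd _ _) (zsmul_mem (hd _ _) _)

/-- The diagonal matrices form a subalgebra containing the images of all `H_{ij}(a, b)`. Thus any
form that involves only off-diagonal entries vanishes on `𝓗`. -/
theorem stToGL_cartan {x : Steinberg par 𝒜} (hx : x ∈ stCartan par 𝒜) :
    stToGL par 𝒜 x ∈ diagonalMatrices par 𝒜 := by
  suffices stCartan par 𝒜 ≤ (diagonalMatrices par 𝒜).comap (stToGL par 𝒜).toLinearMap from this hx
  refine sInf_le ⟨?_, ?_⟩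
  · rintro _ ⟨i, j, h, a, b, rfl⟩
    change stToGL par 𝒜 (stH par 𝒜 h a b) ∈ diagonalMatrices par 𝒜
    rw [stH, (stToGL par 𝒜).br, ← rootMap_eq, ← rootMap_eq, stToGL_rootMap par 𝒜 h,
      stToGL_rootMap par 𝒜 h.symm]
    exact br_unitMap_diagonal par 𝒜 a b
  · intro x hx y hy
    change stToGL par 𝒜 (br K x y) ∈ diagonalMatrices par 𝒜
    rw [(stToGL par 𝒜).br]
    exact br_diagonal par 𝒜 hx hy

theorem cartanSet_subset : cartanSet par 𝒜 ⊆ stCartan par 𝒜 := by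
  rintro _ ⟨i, j, h, p, q, a, b, -, -, rfl⟩
  refine Submodule.mem_sInf.2 fun N hN => hN.1 ⟨i, j, h, a, b, ?_⟩
  rw [stH, rootMap_eq _ _ h, rootMap_eq _ _ h.symm]

/-- In a decomposition into root vectors plus a Cartan element, the coefficients of the root vectors
are the off-diagonal entries of the image, because the Cartan part maps to diagonal matrices. If the
image vanishes, so do these coefficients. -/
theorem stToGL_ker_le {x : Steinberg par 𝒜} (hx : stToGL par 𝒜 x = 0) :
    x ∈ Submodule.span K (cartanSet par 𝒜) := by
  obtain ⟨c, h, hh, rfl⟩ := Steinberg.exists_decomposition par 𝒜 x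
  have hd := stToGL_cartan par 𝒜 (Submodule.span_le.2 (cartanSet_subset par 𝒜) hh)
  have key : ∀ i j, rootMap par 𝒜 i j (c i j) = 0 := by
    intro i j
    by_cases hij : i = j
    · subst hij; exact rootMap_self par 𝒜 i _
    have hs : stToGL par 𝒜 (∑ k, ∑ l, rootMap par 𝒜 k l (c k l)) i j = c i j := by
      have : stToGL par 𝒜 (∑ k, ∑ l, rootMap par 𝒜 k l (c k l))
          = (Matrix.of fun k l => if k = l then 0 else c k l : Matrix (Fin 4) (Fin 4) A) := by
        rw [Matrix.matrix_eq_sum_single (Matrix.of fun k l => if k = l then 0 else c k l)]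
        simp only [map_sum]
        refine Finset.sum_congr rfl fun k _ => Finset.sum_congr rfl fun l _ => ?_
        by_cases hkl : k = l
        · subst hkl
          rw [rootMap_self, map_zero]
          simp
          rfl
        · rw [stToGL_rootMap par 𝒜 hkl, unitMap_apply]
          simp [hkl]
          rfl
      rw [this]
      simp [hij]
    have h0 : stToGL par 𝒜 (∑ k, ∑ l, rootMap par 𝒜 k l (c k l)) i j
        + stToGL par 𝒜 h i j = 0 := by
      rw [map_add] at hx
      exact congrFun (congrFun hx i) j
    rw [hs, hd i j hij, add_zero] at h0
    rw [h0, map_zero]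
  rw [Finset.sum_eq_zero fun i _ => Finset.sum_eq_zero fun j _ => key i j, zero_add]
  exact hh

theorem rootMap_eq_zero {i j : Fin 4} (h : i ≠ j) {a : A}
    (ha : stToGL par 𝒜 (rootMap par 𝒜 i j a) = 0) : a = 0 := by
  rw [stToGL_rootMap par 𝒜 h] at ha
  have := congrFun (congrFun ha i) j
  rwa [show unitMap par 𝒜 i j a i j = a from Matrix.single_apply_same ..] at this

/-- An element `x` of the kernel lies in the Cartan part, so `[x, F_{ij}(a)]` is some `F_{ij}(b)`.
Its image `E_{ij}(b)` is zero, hence `b = 0`. So `x` commutes with the generators; by the Jacobi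
identity, applied to the homogeneous components of `x`, it is central. -/
theorem stToSL_isCentralExtension : IsCentralExtension (stToSL par 𝒜) := by
  constructor
  · rintro ⟨y, hy⟩
    obtain ⟨x, rfl⟩ := derived_le_range par 𝒜 hy
    exact ⟨x, rfl⟩
  intro x hx y
  have hker : ∀ (p : ZMod 2) (x : Steinberg par 𝒜), x ∈ gr K p → stToGL par 𝒜 x = 0 →
      ∀ y, br K x y = 0 := by
    intro p x hp hx y
    have hroot : ∀ {i j : Fin 4} (_ : i ≠ j) (a : A), br K x (rootMap par 𝒜 i j a) = 0 := by
      intro i j hij a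
      obtain ⟨b, hb⟩ := cartanSet_br_mem (stToGL_ker_le par 𝒜 hx) hij a
      have h0 : stToGL par 𝒜 (rootMap par 𝒜 i j b) = 0 := by
        rw [hb, (stToGL par 𝒜).br, hx]
        simp [br]
      rw [← hb, rootMap_eq_zero par 𝒜 hij h0, map_zero]
    have htop : LinearMap.ker (LieSuperalgebra.bracket (K := K) x) = ⊤ := by
      refine Steinberg.eq_top par 𝒜 (fun i j hij q a ha => hroot hij a) ?_
      intro i j hij q a ha n hn
      change br K x (br K _ n) = 0
      rw [br_br_right hp (rootMap_mem par 𝒜 i j ha), hroot hij a,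
        show br K x n = 0 from hn]
      simp [br]
    exact (htop ▸ Submodule.mem_top : y ∈ LinearMap.ker (LieSuperalgebra.bracket (K := K) x))
  obtain ⟨a, ha, b, hb, rfl, ga, gb⟩ := exists_parts_ker (stToGL par 𝒜).toLinearMap
    (stToGL par 𝒜).map_gr (congrArg Subtype.val hx)
  have h1 := hker 0 a ha ga y
  have h2 := hker 1 b hb gb y
  simp only [br, map_add, LinearMap.add_apply] at *
  rw [h1, h2, add_zero]

end SpecialLinear

/-- In characteristic two, the polarization of the determinant of the block with rows `0, 2` and
columns `1, 3` is a cocycle on the matrices of trace zero. -/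
theorem block_cocycle {R : Type*} [CommRing R] (h2 : (2 : R) = 0) (X Y Z : Fin 4 → Fin 4 → R)
    (hX : ∑ i, X i i = 0) (hY : ∑ i, Y i i = 0) (hZ : ∑ i, Z i i = 0)
    (B : (Fin 4 → Fin 4 → R) → (Fin 4 → Fin 4 → R) → Fin 4 → Fin 4 → R)
    (hB : ∀ P Q i j, B P Q i j = ∑ m, (P i m * Q m j + Q i m * P m j))
    (D : (Fin 4 → Fin 4 → R) → (Fin 4 → Fin 4 → R) → R)
    (hD : ∀ P Q, D P Q = P 0 1 * Q 2 3 + P 2 1 * Q 0 3 + P 0 3 * Q 2 1 + P 2 3 * Q 0 1) :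
    D (B X Y) Z + D (B Y Z) X + D (B Z X) Y = 0 := by
  simp only [hD, hB, Fin.sum_univ_four] at *
  linear_combination
    -- Up to a multiple of 2, the cyclic sum is `tr X · D(Y, Z) + tr Y · D(Z, X) + tr Z · D(X, Y)`.
    -- The factor of `h2` is half of the difference.
    (Y 0 1 * Z 2 3 + Y 2 1 * Z 0 3 + Y 0 3 * Z 2 1 + Y 2 3 * Z 0 1) * hX
    + (Z 0 1 * X 2 3 + Z 2 1 * X 0 3 + Z 0 3 * X 2 1 + Z 2 3 * X 0 1) * hY
    + (X 0 1 * Y 2 3 + X 2 1 * Y 0 3 + X 0 3 * Y 2 1 + X 2 3 * Y 0 1) * hZ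
    + (X 0 2 * Y 2 1 * Z 2 3 + X 2 1 * Y 0 2 * Z 2 3 + X 0 3 * Y 3 1 * Z 2 3 + X 3 1 * Y 0 3 * Z 
      2 3 + X 2 0 * Y 0 1 * Z 0 3 + X 0 1 * Y 2 0 * Z 0 3 + X 2 3 * Y 3 1 * Z 0 3 + X 3 1 * Y 2 
      3 * Z 0 3 + X 0 1 * Y 1 3 * Z 2 1 + X 1 3 * Y 0 1 * Z 2 1 + X 0 2 * Y 2 3 * Z 2 1 + X 2 3 
      * Y 0 2 * Z 2 1 + X 2 0 * Y 0 3 * Z 0 1 + X 0 3 * Y 2 0 * Z 0 1 + X 2 1 * Y 1 3 * Z 0 1 + 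
      X 1 3 * Y 2 1 * Z 0 1 + X 2 3 * Y 2 1 * Z 0 2 + X 2 3 * Y 0 3 * Z 3 1 + X 0 3 * Y 0 1 * Z 
      2 0 + X 0 3 * Y 2 3 * Z 3 1 + X 2 1 * Y 0 1 * Z 1 3 + X 2 1 * Y 2 3 * Z 0 2 + X 0 1 * Y 0 
      3 * Z 2 0 + X 0 1 * Y 2 1 * Z 1 3) * h2

/-! ### The cocycle: polarized 2×2 minors over `A₂` -/

section Cocycle

variable {K : Type u} [CommRing K] {A : Type v} [Ring A] [Algebra K A]
  (𝒜 : ZMod 2 → Submodule K A) [GradedAlgebra 𝒜]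

section QuotientRing

variable (m : ℕ)

/-- The ideal `𝓘_m`, as an ideal of the ring `A`. -/
def superIdealIdeal : Ideal A where
  carrier := superIdeal 𝒜 m
  add_mem' := add_mem
  zero_mem' := zero_mem _
  smul_mem' a _ hx := (idealGen_mul _ hx a).2

instance : (superIdealIdeal 𝒜 m).IsTwoSided := ⟨fun b hx => (idealGen_mul _ hx b).1⟩

/-- The quotient `A_m`, as a ring. -/
abbrev SuperRing : Type _ := A ⧸ superIdealIdeal 𝒜 m

omit [GradedAlgebra 𝒜] in
theorem superRing_mk_eq_zero {a : A} :
    Ideal.Quotient.mk (superIdealIdeal 𝒜 m) a = 0 ↔ a ∈ superIdeal 𝒜 m :=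
  Ideal.Quotient.eq_zero_iff_mem

theorem superRing_natCast : (m : SuperRing 𝒜 m) = 0 := by
  have : Ideal.Quotient.mk (superIdealIdeal 𝒜 m) (m • (1 : A)) = 0 :=
    (superRing_mk_eq_zero 𝒜 m).2
      (subset_idealGen _ (.smul 0 1 SetLike.GradedOne.one_mem))
  simpa using this

theorem superRing_two : (2 : SuperRing 𝒜 2) = 0 := by exact_mod_cast superRing_natCast 𝒜 2

theorem superRing_neg (x : SuperRing 𝒜 2) : -x = x := by
  rw [neg_eq_iff_add_eq_zero, ← two_mul, superRing_two, zero_mul]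

theorem superRing_koszul (p q : ZMod 2) (x : SuperRing 𝒜 2) : koszul p q • x = x := by
  obtain rfl | rfl := parity_cases p <;> obtain rfl | rfl := parity_cases q <;>
    simp [superRing_neg]

/-- As `2 = 0` in the quotient, signs are invisible, and the supercommutation imposed by the ideal
is ordinary commutation. -/
instance : CommRing (SuperRing 𝒜 2) :=
  { (inferInstance : Ring (SuperRing 𝒜 2)) with
    mul_comm := by
      intro x y
      obtain ⟨a, rfl⟩ := Ideal.Quotient.mk_surjective x
      obtain ⟨b, rfl⟩ := Ideal.Quotient.mk_surjective y
      refine graded_induction 𝒜 (P := fun a => Ideal.Quotient.mk (superIdealIdeal 𝒜 2) a *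
        Ideal.Quotient.mk (superIdealIdeal 𝒜 2) b = Ideal.Quotient.mk (superIdealIdeal 𝒜 2) b *
        Ideal.Quotient.mk (superIdealIdeal 𝒜 2) a) ?_ ?_ a
      · intro a a' h h'
        rw [map_add, add_mul, mul_add, h, h']
      intro p a ha
      refine graded_induction 𝒜 (P := fun b => Ideal.Quotient.mk (superIdealIdeal 𝒜 2) a *
        Ideal.Quotient.mk (superIdealIdeal 𝒜 2) b = Ideal.Quotient.mk (superIdealIdeal 𝒜 2) b *
        Ideal.Quotient.mk (superIdealIdeal 𝒜 2) a) ?_ ?_ b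
      · intro a a' h h'
        rw [map_add, add_mul, mul_add, h, h']
      intro q b hb
      have h : Ideal.Quotient.mk (superIdealIdeal 𝒜 2) (a * b - koszul p q • (b * a)) = 0 :=
        (superRing_mk_eq_zero 𝒜 2).2 (subset_idealGen _ (.comm p q a b ha hb))
      rw [map_sub, map_zsmul, superRing_koszul, sub_eq_zero] at h
      simpa using h }

end QuotientRing

omit [GradedAlgebra 𝒜] in
theorem superQuotient_mk_eq_zero {a : A} : (superIdeal 𝒜 2).mkQ a = 0 ↔
    Ideal.Quotient.mk (superIdealIdeal 𝒜 2) a = 0 := by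
  rw [superRing_mk_eq_zero]
  simp

/-- The class of `a` in `Π(A₂)`. -/
def classMap : A →ₗ[K] ParityShift (SuperQuotient 𝒜 2) := (superIdeal 𝒜 2).mkQ

omit [GradedAlgebra 𝒜] in
theorem classMap_eq_zero {a : A} : classMap 𝒜 a = 0 ↔
    Ideal.Quotient.mk (superIdealIdeal 𝒜 2) a = 0 := superQuotient_mk_eq_zero 𝒜

omit [GradedAlgebra 𝒜] in
theorem classMap_eq {a b : A} : classMap 𝒜 a = classMap 𝒜 b ↔
    Ideal.Quotient.mk (superIdealIdeal 𝒜 2) a = Ideal.Quotient.mk (superIdealIdeal 𝒜 2) b := by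
  rw [← sub_eq_zero, ← map_sub, classMap_eq_zero, map_sub, sub_eq_zero]

omit [GradedAlgebra 𝒜] in
theorem classMap_surjective : Function.Surjective (classMap 𝒜) := Submodule.mkQ_surjective _

theorem classMap_mem {p : ZMod 2} {a : A} (ha : a ∈ 𝒜 (p + 1)) : classMap 𝒜 a ∈ gr K p :=
  ⟨a, ha, rfl⟩

theorem classMap_koszul (p q : ZMod 2) (x : ParityShift (SuperQuotient 𝒜 2)) :
    koszul p q • x = x := by
  obtain ⟨a, rfl⟩ := classMap_surjective 𝒜 x
  rw [← map_zsmul, classMap_eq, map_zsmul, superRing_koszul]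

theorem wModule_koszul (p q : ZMod 2) (x : WModule 𝒜) : koszul p q • x = x :=
  funext fun c => classMap_koszul 𝒜 p q (x c)

theorem wModule_neg (x : WModule 𝒜) : -x = x := by
  simpa using wModule_koszul 𝒜 1 1 x

omit [GradedAlgebra 𝒜] in
theorem epsilon_apply (σ : Equiv.Perm (Fin 4)) (a : A) (c : Equiv.Perm (Fin 4) ⧸ kleinSubgroup)
    [Decidable (c = QuotientGroup.mk σ)] :
    epsilon 𝒜 σ a c = if c = QuotientGroup.mk σ then classMap 𝒜 a else 0 := by
  classical
  by_cases h : c = QuotientGroup.mk σ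
  · rw [if_pos h, h]
    exact Pi.single_eq_same _ _
  · rw [if_neg h]
    exact Pi.single_eq_of_ne h _

/-- The linear map `a ↦ ε_{θ(σ)}(ā)`. -/
def epsilonMap (σ : Equiv.Perm (Fin 4)) : A →ₗ[K] WModule 𝒜 where
  toFun := epsilon 𝒜 σ
  map_add' a b := by
    classical
    funext c
    simp only [Pi.add_apply, epsilon_apply]
    split_ifs <;> simp
  map_smul' r a := by
    classical
    funext c
    simp only [Pi.smul_apply, epsilon_apply]
    split_ifs <;> simp

/-- The bilinear map `(x, y) ↦ ∑ ε_{θ(i,j,k,l)}(x_{ij} y_{kl})` on matrices. -/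
def glForm : SuperGL par31 𝒜 →ₗ[K] SuperGL par31 𝒜 →ₗ[K] WModule 𝒜 :=
  LinearMap.mk₂ K
    (fun x y => ∑ σ : Equiv.Perm (Fin 4), epsilonMap 𝒜 σ (x (σ 0) (σ 1) * y (σ 2) (σ 3)))
    (fun x x' y => by
      rw [← Finset.sum_add_distrib]
      refine Finset.sum_congr rfl fun σ _ => ?_
      rw [← map_add, ← add_mul]; rfl)
    (fun c x y => by
      rw [Finset.smul_sum]
      refine Finset.sum_congr rfl fun σ _ => ?_
      rw [← map_smul, ← smul_mul_assoc]; rfl)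
    (fun x y y' => by
      rw [← Finset.sum_add_distrib]
      refine Finset.sum_congr rfl fun σ _ => ?_
      rw [← map_add, ← mul_add]; rfl)
    (fun c x y => by
      rw [Finset.smul_sum]
      refine Finset.sum_congr rfl fun σ _ => ?_
      rw [← map_smul, ← mul_smul_comm]; rfl)

omit [GradedAlgebra 𝒜] in
theorem glForm_apply (x y : SuperGL par31 𝒜) : glForm 𝒜 x y =
    ∑ σ : Equiv.Perm (Fin 4), epsilon 𝒜 σ (x (σ 0) (σ 1) * y (σ 2) (σ 3)) := rfl

/-- Four terms, one for each element of the Klein subgroup, are what a single coset contributes to a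
sum over all permutations. -/
theorem sum_klein {V : Type*} [AddCommMonoid V] (F : Equiv.Perm (Fin 4) → V)
    [DecidablePred (· ∈ kleinSubgroup)] :
    ∑ ρ : Equiv.Perm (Fin 4), (if ρ ∈ kleinSubgroup then F ρ else 0) =
      F 1 + F (Equiv.swap 0 2) + F (Equiv.swap 1 3) + F (Equiv.swap 0 2 * Equiv.swap 1 3) := by
  have h : ∀ ρ : Equiv.Perm (Fin 4), ρ ∈ kleinSubgroup ↔ ρ ∈ ({1, Equiv.swap 0 2,
      Equiv.swap 1 3, Equiv.swap 0 2 * Equiv.swap 1 3} : Finset (Equiv.Perm (Fin 4))) := by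
    intro ρ
    simp only [Finset.mem_insert, Finset.mem_singleton]
    rfl
  simp only [h]
  rw [Finset.sum_ite_mem, Finset.univ_inter, Finset.sum_insert (by decide),
    Finset.sum_insert (by decide), Finset.sum_insert (by decide), Finset.sum_singleton]
  abel

omit [GradedAlgebra 𝒜] in
-- After translation by `τ⁻¹` only the Klein subgroup contributes to this coset. What remains is the
-- polarized determinant of the block with rows `τ 0, τ 2` and columns `τ 1, τ 3`; the signs of the
-- determinant do not matter because `2 = 0`.
theorem glForm_apply_mk (x y : SuperGL par31 𝒜) (τ : Equiv.Perm (Fin 4)) :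
    glForm 𝒜 x y (QuotientGroup.mk τ) = classMap 𝒜
      (x (τ 0) (τ 1) * y (τ 2) (τ 3) + x (τ 2) (τ 1) * y (τ 0) (τ 3)
        + x (τ 0) (τ 3) * y (τ 2) (τ 1) + x (τ 2) (τ 3) * y (τ 0) (τ 1)) := by
  classical
  rw [glForm_apply, Finset.sum_apply, ← Equiv.sum_comp (Equiv.mulLeft τ)]
  have h : ∀ ρ : Equiv.Perm (Fin 4),
      ((QuotientGroup.mk τ : Equiv.Perm (Fin 4) ⧸ kleinSubgroup)
        = QuotientGroup.mk (Equiv.mulLeft τ ρ)) ↔ ρ ∈ kleinSubgroup := by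
    intro ρ
    rw [QuotientGroup.eq, Equiv.coe_mulLeft, inv_mul_cancel_left]
  simp only [epsilon_apply, h]
  rw [sum_klein]
  simp only [map_add]
  rfl

/-- The four indices of each product include the odd one exactly once, so the product has parity `p
+ q + 1`. This extra 1 is the parity change `Π`. -/
theorem glForm_mem {p q : ZMod 2} {x y : SuperGL par31 𝒜} (hx : x ∈ gr K p) (hy : y ∈ gr K q) :
    glForm 𝒜 x y ∈ gr K (p + q) := by
  intro c _
  induction c using QuotientGroup.induction_on with | H τ => ?_
  rw [glForm_apply_mk]
  have hpar : par31 (τ 0) + par31 (τ 1) + par31 (τ 2) + par31 (τ 3) = 1 := by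
    rw [← Fin.sum_univ_four (fun i => par31 (τ i)), Equiv.sum_comp τ par31]
    decide
  have h : ∀ i j k l : Fin 4, par31 i + par31 j + par31 k + par31 l = 1 →
      x i j * y k l ∈ 𝒜 (p + q + 1) := by
    intro i j k l h
    have := SetLike.mul_mem_graded (hx i j) (hy k l)
    rwa [show par31 i + par31 j + p + (par31 k + par31 l + q) = p + q + 1 by
      rw [← h]; ring] at this
  refine classMap_mem 𝒜 (add_mem (add_mem (add_mem ?_ ?_) ?_) ?_) <;> apply h <;> rw [← hpar] <;>
    ring

theorem glForm_symm (x y : SuperGL par31 𝒜) : glForm 𝒜 x y = glForm 𝒜 y x := by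
  funext c
  induction c using QuotientGroup.induction_on with | H τ => ?_
  rw [glForm_apply_mk, glForm_apply_mk, classMap_eq]
  simp only [map_add, map_mul]
  ring

/-- In the polarized determinant of `x` with itself the four terms agree in pairs, so the value is
twice the determinant. -/
theorem glForm_self (x : SuperGL par31 𝒜) : glForm 𝒜 x x = 0 := by
  funext c
  induction c using QuotientGroup.induction_on with | H τ => ?_
  rw [glForm_apply_mk, Pi.zero_apply, classMap_eq_zero]
  simp only [map_add, map_mul]
  linear_combination (Ideal.Quotient.mk (superIdealIdeal 𝒜 2) (x (τ 0) (τ 1)) *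
    Ideal.Quotient.mk (superIdealIdeal 𝒜 2) (x (τ 2) (τ 3)) +
    Ideal.Quotient.mk (superIdealIdeal 𝒜 2) (x (τ 2) (τ 1)) *
    Ideal.Quotient.mk (superIdealIdeal 𝒜 2) (x (τ 0) (τ 3))) * superRing_two 𝒜

/-- The image of a matrix in the matrices over `A₂`. -/
def redMatrix (x : SuperGL par31 𝒜) (i j : Fin 4) : SuperRing 𝒜 2 :=
  Ideal.Quotient.mk (superIdealIdeal 𝒜 2) (x i j)

theorem redMatrix_br {p q : ZMod 2} {x y : SuperGL par31 𝒜} (hx : x ∈ gr K p) (hy : y ∈ gr K q)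
    (i j : Fin 4) : redMatrix 𝒜 (br K x y) i j =
      ∑ m, (redMatrix 𝒜 x i m * redMatrix 𝒜 y m j + redMatrix 𝒜 y i m * redMatrix 𝒜 x m j) := by
  have h : br K x y i j = ∑ m, x i m * y m j - koszul p q • ∑ m, y i m * x m j :=
    congrFun (congrFun (glBracket_of_mem par31 𝒜 hx hy) i) j
  rw [redMatrix, h, map_sub, map_zsmul, superRing_koszul, sub_eq_add_neg, superRing_neg,
    map_sum, map_sum, ← Finset.sum_add_distrib]
  simp only [map_mul]
  rfl

/-- The sum of the diagonal entries. -/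
def traceMap : SuperGL par31 𝒜 →ₗ[K] A where
  toFun x := ∑ i, x i i
  map_add' x y := Finset.sum_add_distrib (f := fun i => x i i) (g := fun i => y i i)
  map_smul' c x := (Finset.smul_sum (r := c) (f := fun i => x i i)).symm

omit [GradedAlgebra 𝒜] in
theorem traceMap_apply (x : SuperGL par31 𝒜) : traceMap 𝒜 x = ∑ i, x i i := rfl

/-- Over `A₂` the supercommutator is `xy + yx` and multiplication commutes, so its trace is `2
tr(xy) = 0`. -/
theorem redMatrix_trace {x : SuperGL par31 𝒜} (hx : x ∈ derivedSubmodule K (SuperGL par31 𝒜)) :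
    ∑ i, redMatrix 𝒜 x i i = 0 := by
  suffices h : derivedSubmodule K (SuperGL par31 𝒜) ≤
      (superIdeal 𝒜 2).comap (traceMap 𝒜) by
    have := (superRing_mk_eq_zero 𝒜 2).2 (h hx)
    rwa [traceMap_apply, map_sum] at this
  refine Submodule.span_le.2 ?_
  rintro _ ⟨x, y, rfl⟩
  refine homogeneous_induction (K := K) (P := fun x => br K x y ∈
    (superIdeal 𝒜 2).comap (traceMap 𝒜)) ?_ ?_ x
  · intro x x' h h'
    simp only [br, map_add, LinearMap.add_apply] at *
    exact add_mem h h'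
  intro p x hx
  refine homogeneous_induction (K := K) (P := fun y => br K x y ∈
    (superIdeal 𝒜 2).comap (traceMap 𝒜)) ?_ ?_ y
  · intro y y' h h'
    simp only [br, map_add] at *
    exact add_mem h h'
  intro q y hy
  refine (superRing_mk_eq_zero 𝒜 2).1 ?_
  rw [traceMap_apply, map_sum]
  change ∑ i, redMatrix 𝒜 (br K x y) i i = 0
  simp only [redMatrix_br 𝒜 hx hy, Finset.sum_add_distrib]
  rw [Finset.sum_comm (f := fun i m => redMatrix 𝒜 y i m * redMatrix 𝒜 x m i)]
  simp only [mul_comm (redMatrix 𝒜 y _ _)]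
  rw [← two_mul, superRing_two, zero_mul]

/-- Renumbering rows and columns by `τ` moves the block to rows `0, 2` and columns `1, 3`, where
`block_cocycle` applies. Membership in the derived algebra supplies the vanishing traces. -/
theorem glForm_cocycle {p q r : ZMod 2} {x y z : SuperGL par31 𝒜} (hx : x ∈ gr K p)
    (hy : y ∈ gr K q) (hz : z ∈ gr K r) (hx' : x ∈ derivedSubmodule K (SuperGL par31 𝒜))
    (hy' : y ∈ derivedSubmodule K (SuperGL par31 𝒜))
    (hz' : z ∈ derivedSubmodule K (SuperGL par31 𝒜)) :
    glForm 𝒜 (br K x y) z + glForm 𝒜 (br K y z) x + glForm 𝒜 (br K z x) y = 0 := by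
  funext c
  induction c using QuotientGroup.induction_on with | H τ => ?_
  rw [Pi.add_apply, Pi.add_apply, glForm_apply_mk, glForm_apply_mk, glForm_apply_mk, ← map_add,
    ← map_add, Pi.zero_apply, classMap_eq_zero]
  simp only [map_add, map_mul]
  have tr : ∀ {x : SuperGL par31 𝒜}, x ∈ derivedSubmodule K (SuperGL par31 𝒜) →
      ∑ i, redMatrix 𝒜 x (τ i) (τ i) = 0 := fun hx =>
    (Equiv.sum_comp τ fun i => redMatrix 𝒜 _ i i).trans (redMatrix_trace 𝒜 hx)
  have hbr : ∀ {p q : ZMod 2} {x y : SuperGL par31 𝒜} (_ : x ∈ gr K p) (_ : y ∈ gr K q)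
      (i j : Fin 4), redMatrix 𝒜 (br K x y) (τ i) (τ j) =
      ∑ m, (redMatrix 𝒜 x (τ i) (τ m) * redMatrix 𝒜 y (τ m) (τ j)
        + redMatrix 𝒜 y (τ i) (τ m) * redMatrix 𝒜 x (τ m) (τ j)) := by
    intro p q x y hx hy i j
    rw [redMatrix_br 𝒜 hx hy, ← Equiv.sum_comp τ]
  have := block_cocycle (superRing_two 𝒜) (fun i j => redMatrix 𝒜 x (τ i) (τ j))
    (fun i j => redMatrix 𝒜 y (τ i) (τ j)) (fun i j => redMatrix 𝒜 z (τ i) (τ j))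
    (tr hx') (tr hy') (tr hz') (fun P Q i j => ∑ m, (P i m * Q m j + Q i m * P m j))
    (fun _ _ _ _ => rfl)
    (fun P Q => P 0 1 * Q 2 3 + P 2 1 * Q 0 3 + P 0 3 * Q 2 1 + P 2 3 * Q 0 1) (fun _ _ => rfl)
  simp only [← hbr hx hy, ← hbr hy hz, ← hbr hz hx] at this
  exact this

/-- The cocycle `ψ`. -/
def steinbergCocycle : Steinberg par31 𝒜 →ₗ[K] Steinberg par31 𝒜 →ₗ[K] WModule 𝒜 :=
  (glForm 𝒜).compl₁₂ (stToGL par31 𝒜).toLinearMap (stToGL par31 𝒜).toLinearMap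

theorem steinbergCocycle_apply (x y : Steinberg par31 𝒜) :
    steinbergCocycle 𝒜 x y = glForm 𝒜 (stToGL par31 𝒜 x) (stToGL par31 𝒜 y) := rfl

theorem steinbergCocycle_isEvenSuperCocycle : IsEvenSuperCocycle (steinbergCocycle 𝒜) where
  even hx hy := glForm_mem 𝒜 ((stToGL par31 𝒜).mem_gr hx) ((stToGL par31 𝒜).mem_gr hy)
  skew _ _ := by
    rw [wModule_koszul, wModule_neg, steinbergCocycle_apply, steinbergCocycle_apply, glForm_symm]
  jacobi hx hy hz := by
    rw [wModule_koszul, wModule_koszul, wModule_koszul]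
    simp only [steinbergCocycle_apply, LieSuperHom.br]
    exact glForm_cocycle 𝒜 ((stToGL par31 𝒜).mem_gr hx) ((stToGL par31 𝒜).mem_gr hy)
      ((stToGL par31 𝒜).mem_gr hz) (stToSL par31 𝒜 _).2 (stToSL par31 𝒜 _).2 (stToSL par31 𝒜 _).2
  even_self _ := glForm_self 𝒜 _

omit [GradedAlgebra 𝒜] in
theorem glForm_unitMap (i j k l : Fin 4) (a b : A) :
    glForm 𝒜 (unitMap par31 𝒜 i j a) (unitMap par31 𝒜 k l b) =
      ∑ σ : Equiv.Perm (Fin 4), if i = σ 0 ∧ j = σ 1 ∧ k = σ 2 ∧ l = σ 3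
        then epsilonMap 𝒜 σ (a * b) else 0 := by
  rw [glForm_apply]
  refine Finset.sum_congr rfl fun σ _ => ?_
  rw [unitMap_apply, unitMap_apply, Matrix.single_apply, Matrix.single_apply]
  by_cases h1 : i = σ 0 ∧ j = σ 1
  · by_cases h2 : k = σ 2 ∧ l = σ 3
    · rw [if_pos h1, if_pos h2, if_pos ⟨h1.1, h1.2, h2⟩]; rfl
    · have h : ¬(i = σ 0 ∧ j = σ 1 ∧ k = σ 2 ∧ l = σ 3) := fun h => h2 h.2.2
      rw [if_neg h2, if_neg h, mul_zero]
      exact map_zero (epsilonMap 𝒜 σ)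
  · have h : ¬(i = σ 0 ∧ j = σ 1 ∧ k = σ 2 ∧ l = σ 3) := fun h => h1 ⟨h.1, h.2.1⟩
    rw [if_neg h1, if_neg h, zero_mul]
    exact map_zero (epsilonMap 𝒜 σ)

theorem steinbergCocycle_rootMap {i j k l : Fin 4} (hij : i ≠ j) (hkl : k ≠ l) (a b : A) :
    steinbergCocycle 𝒜 (rootMap par31 𝒜 i j a) (rootMap par31 𝒜 k l b) =
      ∑ σ : Equiv.Perm (Fin 4), if i = σ 0 ∧ j = σ 1 ∧ k = σ 2 ∧ l = σ 3
        then epsilonMap 𝒜 σ (a * b) else 0 := by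
  rw [steinbergCocycle_apply, stToGL_rootMap par31 𝒜 hij, stToGL_rootMap par31 𝒜 hkl,
    glForm_unitMap]

theorem steinbergCocycle_distinct (σ : Equiv.Perm (Fin 4)) (a b : A) :
    steinbergCocycle 𝒜 (rootMap par31 𝒜 (σ 0) (σ 1) a) (rootMap par31 𝒜 (σ 2) (σ 3) b) =
      epsilon 𝒜 σ (a * b) := by
  rw [steinbergCocycle_rootMap 𝒜 (σ.injective.ne (by decide)) (σ.injective.ne (by decide)),
    Finset.sum_eq_single σ]
  · rw [if_pos ⟨rfl, rfl, rfl, rfl⟩]; rfl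
  · intro τ _ hτ
    refine if_neg fun h => hτ (Equiv.ext fun i => ?_)
    fin_cases i
    exacts [h.1.symm, h.2.1.symm, h.2.2.1.symm, h.2.2.2.symm]
  · simp

theorem steinbergCocycle_not_distinct {i j k l : Fin 4} (hij : i ≠ j) (hkl : k ≠ l)
    (h : i = k ∨ i = l ∨ j = k ∨ j = l) (a b : A) :
    steinbergCocycle 𝒜 (rootMap par31 𝒜 i j a) (rootMap par31 𝒜 k l b) = 0 := by
  rw [steinbergCocycle_rootMap 𝒜 hij hkl]
  refine Finset.sum_eq_zero fun σ _ => if_neg ?_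
  rintro ⟨rfl, rfl, rfl, rfl⟩
  simp only [σ.injective.eq_iff] at h
  revert h
  decide

omit [GradedAlgebra 𝒜] in
theorem glForm_diagonal {x : SuperGL par31 𝒜} (hx : x ∈ diagonalMatrices par31 𝒜)
    (y : SuperGL par31 𝒜) : glForm 𝒜 x y = 0 := by
  rw [glForm_apply]
  refine Finset.sum_eq_zero fun σ _ => ?_
  rw [hx _ _ (σ.injective.ne (by decide)), zero_mul]
  exact map_zero (epsilonMap 𝒜 σ)

theorem steinbergCocycle_isSteinbergCocycle : IsSteinbergCocycle 𝒜 (steinbergCocycle 𝒜) where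
  distinct σ h h' a b := by
    rw [← rootMap_eq, ← rootMap_eq, steinbergCocycle_distinct]
  not_distinct i j k l h h' a b H := by
    rw [← rootMap_eq, ← rootMap_eq, steinbergCocycle_not_distinct 𝒜 h h' H]
  left x y hx := glForm_diagonal 𝒜 (stToGL_cartan par31 𝒜 hx) _
  right x y hy := by
    rw [steinbergCocycle_apply, glForm_symm, glForm_diagonal 𝒜 (stToGL_cartan par31 𝒜 hy)]

/-- Four distinct indices form a permutation. -/
theorem exists_perm {i j k l : Fin 4} (hij : i ≠ j) (hkl : k ≠ l)
    (h : ¬(i = k ∨ i = l ∨ j = k ∨ j = l)) :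
    ∃ σ : Equiv.Perm (Fin 4), σ 0 = i ∧ σ 1 = j ∧ σ 2 = k ∧ σ 3 = l := by
  push Not at h
  refine ⟨Equiv.ofBijective ![i, j, k, l] (Finite.injective_iff_bijective.1 ?_), rfl, rfl, rfl, rfl⟩
  intro a b hab
  fin_cases a <;> fin_cases b <;> simp_all

/-- Root vectors and Cartan elements span `st`, and the four conditions prescribe the value on every
pair of them, since four distinct indices always form a permutation. -/
theorem IsSteinbergCocycle.unique {ψ ψ' : Steinberg par31 𝒜 →ₗ[K] Steinberg par31 𝒜 →ₗ[K] WModule 𝒜}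
    (hψ : IsSteinbergCocycle 𝒜 ψ) (hψ' : IsSteinbergCocycle 𝒜 ψ') : ψ = ψ' := by
  have hspan : Submodule.span K (rootSet par31 𝒜 ∪ cartanSet par31 𝒜) = ⊤ := by
    rw [Submodule.span_union, Steinberg.span_eq_top]
  refine LinearMap.ext_on hspan fun x hx => LinearMap.ext_on hspan fun y hy => ?_
  obtain hx | hx := hx
  · obtain hy | hy := hy
    · obtain ⟨i, j, hij, a, rfl⟩ := hx
      obtain ⟨k, l, hkl, b, rfl⟩ := hy
      rw [rootMap_eq _ _ hij, rootMap_eq _ _ hkl]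
      by_cases h : i = k ∨ i = l ∨ j = k ∨ j = l
      · rw [hψ.not_distinct i j k l hij hkl a b h, hψ'.not_distinct i j k l hij hkl a b h]
      · obtain ⟨σ, rfl, rfl, rfl, rfl⟩ := exists_perm hij hkl h
        rw [hψ.distinct, hψ'.distinct]
    · rw [hψ.right _ _ (cartanSet_subset par31 𝒜 hy), hψ'.right _ _ (cartanSet_subset par31 𝒜 hy)]
  · rw [hψ.left _ _ (cartanSet_subset par31 𝒜 hx), hψ'.left _ _ (cartanSet_subset par31 𝒜 hx)]

end Cocycle

/-! ### Central extensions of the Steinberg Lie superalgebra -/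

theorem koszul_smul_of_neg {E : Type*} [AddCommGroup E] {x : E} (hx : -x = x) (p q : ZMod 2) :
    koszul p q • x = x := by
  obtain rfl | rfl := parity_cases p <;> obtain rfl | rfl := parity_cases q <;> simp [hx]

instance : Fintype (Equiv.Perm (Fin 4) ⧸ kleinSubgroup) := Fintype.ofFinite _

section CentralExtensionsOfSteinberg

variable {K : Type u} [CommRing K] {A : Type v} [Ring A] [Algebra K A]
  {𝒜 : ZMod 2 → Submodule K A} [GradedAlgebra 𝒜]

theorem exists_fourth (i j k : Fin 4) : ∃ l, l ≠ i ∧ l ≠ j ∧ l ≠ k := by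
  revert i j k; decide

theorem graded_one_mem : (1 : A) ∈ 𝒜 0 := SetLike.GradedOne.one_mem

/-! ### Lifted root vectors, for arbitrary parities of the four indices -/

section General

variable {par : Fin 4 → ZMod 2} {E : Type*} [AddCommGroup E] [Module K E] [LieSuperalgebra K E]
  {g : LieSuperHom K E (Steinberg par 𝒜)} (hg : IsCentralExtension g)

include hg

/-- Factor `F_{kj}(bc) = [F_{kl}(b), F_{lj}(c)]` and apply the Jacobi identity: `F_{ik}` commutes
with `F_{lj}`, so only the term with `[F_{ik}(a), F_{kl}(b)] = F_{il}(ab)` survives. -/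
theorem lift_root_change {i j k l : Fin 4} (hij : i ≠ j) (hik : i ≠ k) (hil : i ≠ l) (hkj : k ≠ j)
    (hkl : k ≠ l) (hlj : l ≠ j) {p q : ZMod 2} {a b : A} (ha : a ∈ 𝒜 p) (hb : b ∈ 𝒜 q) (c : A) :
    hg.lift (rootMap par 𝒜 i k a) (rootMap par 𝒜 k j (b * c)) =
      hg.lift (rootMap par 𝒜 i l (a * b)) (rootMap par 𝒜 l j c) := by
  rw [← rootMap_br par 𝒜 hkl hlj hkj, hg.lift_br (rootMap_mem par 𝒜 i k ha)
    (rootMap_mem par 𝒜 k l hb), rootMap_br par 𝒜 hik hkl hil, rootMap_comm par 𝒜 hik hlj hkl hij]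
  simp

theorem lift_root_mul {i j k l : Fin 4} (hij : i ≠ j) (hik : i ≠ k) (hil : i ≠ l) (hkj : k ≠ j)
    (hkl : k ≠ l) (hlj : l ≠ j) {p q : ZMod 2} {a b : A} (ha : a ∈ 𝒜 p) (hb : b ∈ 𝒜 q) :
    hg.lift (rootMap par 𝒜 i k a) (rootMap par 𝒜 k j b) =
      hg.lift (rootMap par 𝒜 i l (a * b)) (rootMap par 𝒜 l j 1) := by
  simpa using lift_root_change hg hij hik hil hkj hkl hlj ha hb 1

theorem lift_root_mul_self {i j k l : Fin 4} (hij : i ≠ j) (hik : i ≠ k) (hil : i ≠ l)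
    (hkj : k ≠ j) (hkl : k ≠ l) (hlj : l ≠ j) {p q : ZMod 2} {a b : A} (ha : a ∈ 𝒜 p)
    (hb : b ∈ 𝒜 q) :
    hg.lift (rootMap par 𝒜 i k a) (rootMap par 𝒜 k j b) =
      hg.lift (rootMap par 𝒜 i k (a * b)) (rootMap par 𝒜 k j 1) := by
  rw [lift_root_mul hg hij hik hil hkj hkl hlj ha hb]
  simpa using lift_root_change hg hij hil hik hlj hkl.symm hkj (SetLike.mul_mem_graded ha hb)
    graded_one_mem 1

/-- The canonical lift of `a ↦ F_{ij}(a)`. -/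
def rootLift (i j : Fin 4) : A →ₗ[K] E :=
  (hg.lift.flip (rootMap par 𝒜 (exists_ne_ne i j).choose j 1)) ∘ₗ
    rootMap par 𝒜 i (exists_ne_ne i j).choose

/-- The middle index can be traded for any other one by `lift_root_change`. If `k` is already the
index chosen in `rootLift`, a detour through the fourth index and back moves the whole product `ab`
to the left factor. -/
theorem rootLift_mul {i j k : Fin 4} (hij : i ≠ j) (hik : i ≠ k) (hkj : k ≠ j) {p q : ZMod 2}
    {a b : A} (ha : a ∈ 𝒜 p) (hb : b ∈ 𝒜 q) :
    hg.lift (rootMap par 𝒜 i k a) (rootMap par 𝒜 k j b) = rootLift hg i j (a * b) := by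
  change _ = hg.lift (rootMap par 𝒜 i (exists_ne_ne i j).choose (a * b))
    (rootMap par 𝒜 (exists_ne_ne i j).choose j 1)
  obtain ⟨hmi, hmj⟩ := (exists_ne_ne i j).choose_spec
  generalize (exists_ne_ne i j).choose = m at *
  by_cases hkm : k = m
  · subst hkm
    obtain ⟨l, hli, hlj, hlk⟩ := exists_fourth i j k
    exact lift_root_mul_self hg hij hik hli.symm hkj hlk.symm hlj ha hb
  · exact lift_root_mul hg hij hik hmi.symm hkj hkm hmj ha hb

theorem map_rootLift {i j : Fin 4} (hij : i ≠ j) (a : A) :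
    g (rootLift hg i j a) = rootMap par 𝒜 i j a := by
  obtain ⟨hmi, hmj⟩ := (exists_ne_ne i j).choose_spec
  change g (hg.lift _ _) = _
  rw [hg.map_lift, rootMap_br par 𝒜 hmi.symm hmj hij, mul_one]

theorem rootLift_mem {i j : Fin 4} {p : ZMod 2} {a : A} (ha : a ∈ 𝒜 p) :
    rootLift hg i j a ∈ gr K (par i + par j + p) := by
  have := hg.lift_mem (rootMap_mem par 𝒜 i (exists_ne_ne i j).choose ha)
    (rootMap_mem par 𝒜 (exists_ne_ne i j).choose j (graded_one_mem (𝒜 := 𝒜)))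
  change hg.lift (rootMap par 𝒜 i (exists_ne_ne i j).choose a)
    (rootMap par 𝒜 (exists_ne_ne i j).choose j 1) ∈ _
  generalize (exists_ne_ne i j).choose = m at *
  rwa [show par i + par m + p + (par m + par j + 0) = par i + par j + p by
    linear_combination parity_add_self (par m)] at this

theorem br_rootLift {i j k l : Fin 4} (hij : i ≠ j) (hkl : k ≠ l) (a b : A) :
    br K (rootLift hg i j a) (rootLift hg k l b) =
      hg.lift (rootMap par 𝒜 i j a) (rootMap par 𝒜 k l b) := by
  rw [← hg.lift_apply, map_rootLift hg hij, map_rootLift hg hkl]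

/-- A common row or column leaves an index `m` free. In `F_{kl}(b) = [F_{km}(b), F_{ml}(1)]` both
factors commute with `F_{ij}(a)` already in `st`, so both terms of the Jacobi identity vanish. -/
theorem lift_root_eq_zero {i j k l : Fin 4} (hij : i ≠ j) (hkl : k ≠ l) (hjk : j ≠ k) (hil : i ≠ l)
    (h : i = k ∨ j = l) {p q : ZMod 2} {a b : A} (ha : a ∈ 𝒜 p) (hb : b ∈ 𝒜 q) :
    hg.lift (rootMap par 𝒜 i j a) (rootMap par 𝒜 k l b) = 0 := by
  obtain ⟨m, hmi, hmj, hmk, hml⟩ : ∃ m, m ≠ i ∧ m ≠ j ∧ m ≠ k ∧ m ≠ l := by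
    obtain rfl | rfl := h
    · obtain ⟨m, h1, h2, h3⟩ := exists_fourth i j l
      exact ⟨m, h1, h2, h1, h3⟩
    · obtain ⟨m, h1, h2, h3⟩ := exists_fourth i j k
      exact ⟨m, h1, h2, h3, h2⟩
  rw [← mul_one b, ← rootMap_br par 𝒜 hmk.symm hml hkl, hg.lift_br (rootMap_mem par 𝒜 i j ha)
    (rootMap_mem par 𝒜 k m hb), rootMap_comm par 𝒜 hij hmk.symm hjk hmi.symm,
    rootMap_comm par 𝒜 hij hml hmj.symm hil]
  simp

/-- Exchange of the rows `i` and `k`: factor `F_{kl}` through `i`. Then `F_{il}(c)` commutes with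
`F_{ij}(a)`, and `[F_{ij}(a), F_{ki}(b)]` is `F_{kj}(ba)` up to sign. -/
theorem lift_distinct_rows {i j k l : Fin 4} (hij : i ≠ j) (hik : i ≠ k) (hil : i ≠ l)
    (hjk : j ≠ k) (hkl : k ≠ l) {p q : ZMod 2} {a b : A} (ha : a ∈ 𝒜 p)
    (hb : b ∈ 𝒜 q) (c : A) :
    hg.lift (rootMap par 𝒜 i j a) (rootMap par 𝒜 k l (b * c)) =
      -(koszul (par i + par j + p) (par k + par i + q) •
        hg.lift (rootMap par 𝒜 k j (b * a)) (rootMap par 𝒜 i l c)) := by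
  have h0 : br K (rootMap par 𝒜 i j a) (rootMap par 𝒜 i l c) = 0 :=
    rootMap_comm par 𝒜 hij hil hij.symm hil a c
  rw [← rootMap_br par 𝒜 hik.symm hil hkl, hg.lift_br (rootMap_mem par 𝒜 i j ha)
    (rootMap_mem par 𝒜 k i hb), h0, rootMap_br_symm par 𝒜 hik.symm hij hjk.symm hb ha]
  simp

/-- The other factorization, through `j`: now `F_{kj}(b)` commutes with `F_{ij}(a)`, and
`[F_{ij}(a), F_{jl}(c)] = F_{il}(ac)`. Combined with skew symmetry this exchanges the columns `j`
and `l`. -/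
theorem lift_distinct_columns {i j k l : Fin 4} (hij : i ≠ j) (hil : i ≠ l)
    (hjk : j ≠ k) (hjl : j ≠ l) (hkl : k ≠ l) {p q : ZMod 2} {a b : A} (ha : a ∈ 𝒜 p)
    (hb : b ∈ 𝒜 q) (c : A) :
    hg.lift (rootMap par 𝒜 i j a) (rootMap par 𝒜 k l (b * c)) =
      koszul (par i + par j + p) (par k + par j + q) •
        hg.lift (rootMap par 𝒜 k j b) (rootMap par 𝒜 i l (a * c)) := by
  rw [← rootMap_br par 𝒜 hjk.symm hjl hkl, hg.lift_br (rootMap_mem par 𝒜 i j ha)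
    (rootMap_mem par 𝒜 k j hb), rootMap_comm par 𝒜 hij hjk.symm hjk hij,
    rootMap_br par 𝒜 hij hjl hil]
  simp

end General

/-! ### Four distinct indices, one of them odd: 2-torsion and sign-free exchanges -/

section Small

variable {E : Type*} [AddCommGroup E] [Module K E] [LieSuperalgebra K E]
  {g : LieSuperHom K E (Steinberg par31 𝒜)} (hg : IsCentralExtension g)

theorem par31_sum {i j k l : Fin 4} (hij : i ≠ j) (hik : i ≠ k) (hil : i ≠ l)
    (hjk : j ≠ k) (hjl : j ≠ l) (hkl : k ≠ l) :
    par31 i + par31 k = 1 ∨ par31 j + par31 l = 1 := by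
  revert i j k l
  decide

/-- Since `i + k = 1`, the exponents add up to `(i + j + p) + (k + j + p) = i + k = 1`. -/
theorem koszul_rows (i j k p : ZMod 2) (h : i + k = 1) :
    koszul (i + j + p) (k + i + 0) * koszul (k + j + p) (i + k + 0) = -1 := by
  revert i j k p; decide

/-- The four exponents add up to the product of `(i + j + p) + (i + l + p)` and `(k + j + q) + (k +
l + q)`, that is, to `(j + l)² = 1`. -/
theorem koszul_columns (i j k l p q : ZMod 2) (h : j + l = 1) :
    (koszul (i + j + p) (k + j + q) * koszul (k + j + q) (i + l + p)) *
      (koszul (i + l + p) (k + l + q) * koszul (k + l + q) (i + j + p)) = -1 := by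
  revert i j k l p q; decide

include hg

/-- The single odd index is a row or a column of the block. Exchanging twice the two rows, or the
two columns, whose parities differ returns to the same bracket with total sign `-1`. -/
theorem lift_distinct_neg {i j k l : Fin 4} (hij : i ≠ j) (hik : i ≠ k) (hil : i ≠ l)
    (hjk : j ≠ k) (hjl : j ≠ l) (hkl : k ≠ l) {p q : ZMod 2} {a b : A} (ha : a ∈ 𝒜 p)
    (hb : b ∈ 𝒜 q) : -hg.lift (rootMap par31 𝒜 i j a) (rootMap par31 𝒜 k l b) =
      hg.lift (rootMap par31 𝒜 i j a) (rootMap par31 𝒜 k l b) := by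
  obtain h | h := par31_sum hij hik hil hjk hjl hkl
  · have h1 := lift_distinct_rows hg hij hik hil hjk hkl ha graded_one_mem b
    have h2 := lift_distinct_rows hg hjk.symm hik.symm hkl hij.symm hil ha graded_one_mem b
    rw [one_mul, one_mul] at h1 h2
    rw [h2, smul_neg, neg_neg, smul_smul, koszul_rows _ _ _ _ h, neg_one_smul] at h1
    exact h1.symm
  · have swap : ∀ {j l : Fin 4} (_ : i ≠ j) (_ : i ≠ l) (_ : j ≠ k) (_ : j ≠ l) (_ : k ≠ l),
        hg.lift (rootMap par31 𝒜 i j a) (rootMap par31 𝒜 k l b) =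
        -((koszul (par31 i + par31 j + p) (par31 k + par31 j + q) *
          koszul (par31 k + par31 j + q) (par31 i + par31 l + p)) •
            hg.lift (rootMap par31 𝒜 i l a) (rootMap par31 𝒜 k j b)) := by
      intro j l hij hil hjk hjl hkl
      have h1 := lift_distinct_columns hg hij hil hjk hjl hkl ha hb 1
      rw [mul_one, mul_one, hg.lift_skew (rootMap_mem par31 𝒜 k j hb) (rootMap_mem par31 𝒜 i l ha),
        smul_neg, smul_smul] at h1
      exact h1
    have h1 := swap hij hil hjk hjl hkl
    rw [swap hil hij hkl.symm hjl.symm hjk.symm, smul_neg, neg_neg, smul_smul,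
      koszul_columns _ _ _ _ _ _ h, neg_one_smul] at h1
    exact h1.symm

/-- The exchange through `i`, whose sign can be dropped because the bracket equals its negative. -/
theorem lift_row_swap {i j k l : Fin 4} (hij : i ≠ j) (hik : i ≠ k) (hil : i ≠ l)
    (hjk : j ≠ k) (hjl : j ≠ l) (hkl : k ≠ l) {p q r : ZMod 2} {a b c : A} (ha : a ∈ 𝒜 p)
    (hb : b ∈ 𝒜 q) (hc : c ∈ 𝒜 r) :
    hg.lift (rootMap par31 𝒜 i j a) (rootMap par31 𝒜 k l (b * c)) =
      hg.lift (rootMap par31 𝒜 k j (b * a)) (rootMap par31 𝒜 i l c) := by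
  have := lift_distinct_neg hg hjk.symm hik.symm hkl hij.symm hjl hil (SetLike.mul_mem_graded hb ha)
    hc
  rw [lift_distinct_rows hg hij hik hil hjk hkl ha hb, koszul_smul_of_neg this, this]

theorem lift_row_swap' {i j k l : Fin 4} (hij : i ≠ j) (hik : i ≠ k) (hil : i ≠ l)
    (hjk : j ≠ k) (hjl : j ≠ l) (hkl : k ≠ l) {p q r : ZMod 2} {a b c : A} (ha : a ∈ 𝒜 p)
    (hb : b ∈ 𝒜 q) (hc : c ∈ 𝒜 r) :
    hg.lift (rootMap par31 𝒜 i j a) (rootMap par31 𝒜 k l (b * c)) =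
      hg.lift (rootMap par31 𝒜 k j b) (rootMap par31 𝒜 i l (a * c)) := by
  have := lift_distinct_neg hg hjk.symm hik.symm hkl hij.symm hjl hil hb
    (SetLike.mul_mem_graded ha hc)
  rw [lift_distinct_columns hg hij hil hjk hjl hkl ha hb, koszul_smul_of_neg this]

theorem lift_distinct_symm {i j k l : Fin 4} (hij : i ≠ j) (hik : i ≠ k) (hil : i ≠ l)
    (hjk : j ≠ k) (hjl : j ≠ l) (hkl : k ≠ l) {p q : ZMod 2} {a b : A} (ha : a ∈ 𝒜 p)
    (hb : b ∈ 𝒜 q) :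
    hg.lift (rootMap par31 𝒜 i j a) (rootMap par31 𝒜 k l b) =
      hg.lift (rootMap par31 𝒜 k l b) (rootMap par31 𝒜 i j a) := by
  have := lift_distinct_neg hg hkl hik.symm hjk.symm hil.symm hjl.symm hij hb ha
  rw [hg.lift_skew (rootMap_mem par31 𝒜 i j ha) (rootMap_mem par31 𝒜 k l hb),
    koszul_smul_of_neg this, this]

end Small

/-! ### The map from `𝓦` onto the kernel of a perfect central extension -/

section Kernel

variable {E : Type*} [AddCommGroup E] [Module K E] [LieSuperalgebra K E]
  {g : LieSuperHom K E (Steinberg par31 𝒜)} (hg : IsCentralExtension g)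

variable (σ : Equiv.Perm (Fin 4))

/-- The linear map `a ↦ [F_{ij}(a)', F_{kl}(1)']` for the lifts of the root vectors to a central
extension. -/
def quadMap : A →ₗ[K] E :=
  (hg.lift.flip (rootMap par31 𝒜 (σ 2) (σ 3) 1)) ∘ₗ rootMap par31 𝒜 (σ 0) (σ 1)

theorem quadMap_apply (a : A) : quadMap hg σ a =
    hg.lift (rootMap par31 𝒜 (σ 0) (σ 1) a) (rootMap par31 𝒜 (σ 2) (σ 3) 1) := rfl

theorem perm_ne {i j : Fin 4} (h : i ≠ j := by decide) : σ i ≠ σ j := σ.injective.ne h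

theorem map_quadMap (a : A) : g (quadMap hg σ a) = 0 := by
  rw [quadMap_apply, hg.map_lift]
  exact rootMap_comm par31 𝒜 (perm_ne σ) (perm_ne σ) (perm_ne σ) (perm_ne σ) a 1

theorem lift_row_swap_self {p q : ZMod 2} {a b : A} (ha : a ∈ 𝒜 p) (hb : b ∈ 𝒜 q) :
    hg.lift (rootMap par31 𝒜 (σ 0) (σ 1) a) (rootMap par31 𝒜 (σ 2) (σ 3) b) =
      hg.lift (rootMap par31 𝒜 (σ 2) (σ 1) a) (rootMap par31 𝒜 (σ 0) (σ 3) b) := by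
  simpa using lift_row_swap hg (perm_ne σ) (perm_ne σ) (perm_ne σ) (perm_ne σ) (perm_ne σ)
    (perm_ne σ) ha graded_one_mem hb (i := σ 0) (j := σ 1) (k := σ 2) (l := σ 3)

theorem lift_eq_quadMap {p q : ZMod 2} {a b : A} (ha : a ∈ 𝒜 p) (hb : b ∈ 𝒜 q) :
    hg.lift (rootMap par31 𝒜 (σ 0) (σ 1) a) (rootMap par31 𝒜 (σ 2) (σ 3) b) =
      quadMap hg σ (b * a) := by
  have := lift_row_swap hg (perm_ne σ) (perm_ne σ) (perm_ne σ) (perm_ne σ) (perm_ne σ)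
    (perm_ne σ) ha hb graded_one_mem (i := σ 0) (j := σ 1) (k := σ 2) (l := σ 3)
  rw [mul_one] at this
  rw [this, quadMap_apply, lift_row_swap_self hg σ (SetLike.mul_mem_graded hb ha) graded_one_mem]

/-- The exchange through `j` followed by an exchange of rows restores the four indices but
interchanges `a` and `b`. This is the source of the commutativity of `A₂`. -/
theorem lift_mul_left_comm {p q r : ZMod 2} {a b c : A} (ha : a ∈ 𝒜 p) (hb : b ∈ 𝒜 q)
    (hc : c ∈ 𝒜 r) :
    hg.lift (rootMap par31 𝒜 (σ 0) (σ 1) a) (rootMap par31 𝒜 (σ 2) (σ 3) (b * c)) =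
      hg.lift (rootMap par31 𝒜 (σ 0) (σ 1) b) (rootMap par31 𝒜 (σ 2) (σ 3) (a * c)) := by
  rw [lift_row_swap_self hg σ hb (SetLike.mul_mem_graded ha hc)]
  exact lift_row_swap' hg (perm_ne σ) (perm_ne σ) (perm_ne σ) (perm_ne σ) (perm_ne σ)
    (perm_ne σ) ha hb hc

theorem quadMap_mul_comm {p q : ZMod 2} {a b : A} (ha : a ∈ 𝒜 p) (hb : b ∈ 𝒜 q) :
    quadMap hg σ (a * b) = quadMap hg σ (b * a) := by
  have := lift_mul_left_comm hg σ ha hb graded_one_mem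
  rw [mul_one, mul_one, lift_eq_quadMap hg σ ha hb, lift_eq_quadMap hg σ hb ha] at this
  exact this.symm

/-- Vanishing on commutators alone would not give vanishing on the two-sided ideal they generate;
the factor `c` is what allows it. -/
theorem quadMap_mul_mul_comm {p q : ZMod 2} {a b : A} (c : A) (ha : a ∈ 𝒜 p) (hb : b ∈ 𝒜 q) :
    quadMap hg σ (a * b * c) = quadMap hg σ (b * a * c) := by
  refine graded_induction 𝒜 (P := fun c => quadMap hg σ (a * b * c) = quadMap hg σ (b * a * c))
    ?_ ?_ c
  · intro c d hc hd
    rw [mul_add, mul_add, map_add, map_add, hc, hd]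
  intro r c hc
  have := lift_mul_left_comm hg σ ha hb hc
  rw [lift_eq_quadMap hg σ ha (SetLike.mul_mem_graded hb hc),
    lift_eq_quadMap hg σ hb (SetLike.mul_mem_graded ha hc),
    quadMap_mul_comm hg σ (SetLike.mul_mem_graded hb hc) ha,
    quadMap_mul_comm hg σ (SetLike.mul_mem_graded ha hc) hb] at this
  rw [mul_assoc, mul_assoc, this]

theorem quadMap_neg (a : A) : -quadMap hg σ a = quadMap hg σ a := by
  refine graded_induction 𝒜 (P := fun a => -quadMap hg σ a = quadMap hg σ a) ?_ ?_ a
  · intro a b ha hb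
    rw [map_add, neg_add, ha, hb]
  · intro p a ha
    exact lift_distinct_neg hg (perm_ne σ) (perm_ne σ) (perm_ne σ) (perm_ne σ) (perm_ne σ)
      (perm_ne σ) ha graded_one_mem

theorem quadMap_row_swap : quadMap hg (σ * Equiv.swap 0 2) = quadMap hg σ := by
  refine LinearMap.ext fun a => graded_induction 𝒜
    (P := fun a => quadMap hg (σ * Equiv.swap 0 2) a = quadMap hg σ a) ?_ ?_ a
  · intro a b ha hb
    rw [map_add, map_add, ha, hb]
  · intro p a ha
    exact (lift_row_swap_self hg σ ha graded_one_mem).symm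

theorem quadMap_column_swap : quadMap hg (σ * Equiv.swap 1 3) = quadMap hg σ := by
  refine LinearMap.ext fun a => graded_induction 𝒜
    (P := fun a => quadMap hg (σ * Equiv.swap 1 3) a = quadMap hg σ a) ?_ ?_ a
  · intro a b ha hb
    rw [map_add, map_add, ha, hb]
  · intro p a ha
    rw [quadMap_apply]
    change hg.lift (rootMap par31 𝒜 (σ 0) (σ 3) a) (rootMap par31 𝒜 (σ 2) (σ 1) 1) = _
    rw [lift_distinct_symm hg (perm_ne σ) (perm_ne σ) (perm_ne σ) (perm_ne σ) (perm_ne σ)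
      (perm_ne σ) ha graded_one_mem, ← lift_row_swap_self hg σ graded_one_mem ha,
      lift_eq_quadMap hg σ graded_one_mem ha, mul_one]

theorem quadMap_klein {ρ : Equiv.Perm (Fin 4)} (hρ : ρ ∈ kleinSubgroup) :
    quadMap hg (σ * ρ) = quadMap hg σ := by
  obtain rfl | rfl | rfl | rfl := hρ
  · rw [mul_one]
  · exact quadMap_row_swap hg σ
  · exact quadMap_column_swap hg σ
  · rw [← mul_assoc, quadMap_column_swap, quadMap_row_swap]

theorem superIdeal_le_ker_quadMap : superIdeal 𝒜 2 ≤ LinearMap.ker (quadMap hg σ) := by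
  -- The kernel of `quadMap` need not be an ideal. `N` is the largest two-sided ideal inside it, so
  -- it suffices to put the generators of `𝓘₂` into `N`.
  let N : Submodule K A :=
    { carrier := {x | ∀ y, quadMap hg σ (x * y) = 0 ∧ quadMap hg σ (y * x) = 0}
      add_mem' := fun hx hy z => by
        rw [add_mul, mul_add, map_add, map_add, (hx z).1, (hx z).2, (hy z).1, (hy z).2]
        simp
      zero_mem' := fun z => by simp
      smul_mem' := fun c x hx z => by
        rw [smul_mul_assoc, mul_smul_comm, map_smul, map_smul, (hx z).1, (hx z).2]
        simp }
  have hcomm : ∀ a b : A, quadMap hg σ (a * b) = quadMap hg σ (b * a) := by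
    intro a b
    refine graded_induction 𝒜 (P := fun a => quadMap hg σ (a * b) = quadMap hg σ (b * a)) ?_ ?_ a
    · intro c d hc hd
      rw [mul_add, add_mul, map_add, map_add, hc, hd]
    intro p a ha
    refine graded_induction 𝒜 (P := fun b => quadMap hg σ (a * b) = quadMap hg σ (b * a)) ?_ ?_ b
    · intro c d hc hd
      rw [mul_add, add_mul, map_add, map_add, hc, hd]
    intro q b hb
    exact quadMap_mul_comm hg σ ha hb
  have hN : superIdeal 𝒜 2 ≤ N := by
    refine idealGen_le ?_ ?_
    · intro x hx y
      rw [hcomm y x]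
      suffices quadMap hg σ (x * y) = 0 from ⟨this, this⟩
      cases hx with
      | smul p a ha =>
        rw [smul_mul_assoc, map_nsmul, two_nsmul]
        nth_rewrite 1 [← quadMap_neg hg σ]
        exact neg_add_cancel _
      | comm p q a b ha hb =>
        rw [sub_mul, smul_mul_assoc, map_sub, map_zsmul,
          koszul_smul_of_neg (quadMap_neg hg σ _), quadMap_mul_mul_comm hg σ y ha hb, sub_self]
    · intro x hx y
      constructor <;> intro z
      · rw [hcomm z, mul_assoc]
        exact ⟨(hx _).1, (hx _).1⟩
      · rw [hcomm _ z, ← mul_assoc]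
        exact ⟨(hx _).2, (hx _).2⟩
  intro x hx
  have := (hN hx 1).1
  rwa [mul_one] at this

/-- The linear map induced by `quadMap` on `Π(A₂)`. -/
def quadBar : ParityShift (SuperQuotient 𝒜 2) →ₗ[K] E :=
  (superIdeal 𝒜 2).liftQ (quadMap hg σ) (superIdeal_le_ker_quadMap hg σ)

theorem quadBar_classMap (a : A) : quadBar hg σ (classMap 𝒜 a) = quadMap hg σ a := rfl

/-- The linear map from `𝓦` to the kernel of a central extension of `st(3,1,A)`. -/
def kernelMap : WModule 𝒜 →ₗ[K] E :=
  ∑ c : Equiv.Perm (Fin 4) ⧸ kleinSubgroup, quadBar hg c.out ∘ₗ LinearMap.proj c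

theorem kernelMap_epsilon (a : A) : kernelMap hg (epsilon 𝒜 σ a) = quadMap hg σ a := by
  classical
  rw [kernelMap, LinearMap.sum_apply, Finset.sum_eq_single (QuotientGroup.mk σ)]
  · rw [LinearMap.comp_apply, LinearMap.proj_apply, epsilon_apply, if_pos rfl, quadBar_classMap]
    -- The chosen representative of the coset differs from `σ` by an element of the Klein subgroup,
    -- under which `quadMap` is invariant.
    have h : σ⁻¹ * (QuotientGroup.mk σ : Equiv.Perm (Fin 4) ⧸ kleinSubgroup).out
        ∈ kleinSubgroup := by
      rw [← QuotientGroup.eq, QuotientGroup.out_eq']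
    have := quadMap_klein hg σ h
    rw [mul_inv_cancel_left] at this
    rw [this]
  · intro c _ hc
    rw [LinearMap.comp_apply, LinearMap.proj_apply, epsilon_apply, if_neg hc, map_zero]
  · simp

omit [GradedAlgebra 𝒜] in
theorem exists_sum_epsilon (x : WModule 𝒜) :
    ∃ a : Equiv.Perm (Fin 4) ⧸ kleinSubgroup → A, ∑ c, epsilon 𝒜 c.out (a c) = x := by
  classical
  choose a ha using fun c => classMap_surjective 𝒜 (x c)
  refine ⟨a, funext fun d => ?_⟩
  rw [Finset.sum_apply, Finset.sum_eq_single d]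
  · rw [epsilon_apply, QuotientGroup.out_eq', if_pos rfl, ha]
  · intro c _ hc
    rw [epsilon_apply, QuotientGroup.out_eq', if_neg (Ne.symm hc)]
  · simp

theorem map_kernelMap (x : WModule 𝒜) : g (kernelMap hg x) = 0 := by
  obtain ⟨a, rfl⟩ := exists_sum_epsilon x
  rw [map_sum, map_sum]
  refine Finset.sum_eq_zero fun c _ => ?_
  rw [kernelMap_epsilon, map_quadMap]

/-- All Steinberg relations lift exactly, except the commutation of root vectors with four distinct
indices; the defect of that one is a value of `quadMap`, hence comes from `𝓦`. -/
theorem rootLift_isSteinbergFamily :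
    IsSteinbergFamily par31 𝒜 (rootLift hg) (LinearMap.range (kernelMap hg)) where
  mem _ _ _ ha := rootLift_mem hg ha
  mul hij hjk hik _ _ _ _ ha hb := by
    rw [br_rootLift hg hij hjk, rootLift_mul hg hik hij hjk ha hb, sub_self]
    exact zero_mem _
  comm := by
    intro i j k l hij hkl hjk hil p q a b ha hb
    rw [br_rootLift hg hij hkl]
    by_cases h : i = k ∨ j = l
    · rw [lift_root_eq_zero hg hij hkl hjk hil h ha hb]
      exact zero_mem _
    · obtain ⟨σ, rfl, rfl, rfl, rfl⟩ := exists_perm hij hkl (by tauto)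
      rw [lift_eq_quadMap hg σ ha hb, ← kernelMap_epsilon]
      exact LinearMap.mem_range_self _ _

/-- The homomorphism from the free nonassociative algebra given by the lifts of the root vectors
covers the projection to `st`. -/
theorem map_freeLift (t : FreeNonUnitalNonAssocAlgebra K (SteinbergGenerator (Fin 4) 𝒜)) :
    g (freeLift (genLift 𝒜 (rootLift hg)) t) = Presented.mk K (SteinbergGenerator.deg par31 𝒜)
      (steinbergRelations_homogeneous par31 𝒜) t := by
  have word : ∀ a : FreeMagma (SteinbergGenerator (Fin 4) 𝒜),
      g (freeLift (genLift 𝒜 (rootLift hg)) (MonoidAlgebra.single a (1 : K)))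
        = Presented.mk K (SteinbergGenerator.deg par31 𝒜)
          (steinbergRelations_homogeneous par31 𝒜) (MonoidAlgebra.single a 1) := by
    intro a
    induction a with
    | ih1 x =>
      obtain ⟨i, j, h, p, a⟩ := x
      refine (congrArg g (freeLift_freeF 𝒜 (rootLift hg) h p a)).trans ?_
      rw [map_rootLift hg h, rootMap_of_mem par31 𝒜 h a.2]
      rfl
    | ih2 a b ha hb =>
      rw [single_mul_word, freeLift_mul, g.br, ha, hb]
      rfl
  induction t using MonoidAlgebra.induction_linear with
  | zero => simp only [map_zero]
  | add x y hx hy => simp only [map_add, hx, hy]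
  | single a c =>
    have h : (MonoidAlgebra.single a c : FreeNonUnitalNonAssocAlgebra K
      (SteinbergGenerator (Fin 4) 𝒜)) = c • MonoidAlgebra.single a 1 := by simp
    rw [h, map_smul, map_smul, map_smul, word]

/-- The kernel of a perfect central extension of `st(3,1,A)` is a quotient of `𝓦`. -/
theorem exists_kernelMap_eq (hE : IsPerfect K E) {x : E} (hx : g x = 0) :
    ∃ y, kernelMap hg y = x := by
  -- The lifted root vectors generate `E`: a bracket in `E` depends only on its images in `st`,
  -- which are represented by words, so it is the value of a product of such representatives;
  -- brackets span `E`.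
  obtain ⟨t, rfl⟩ : ∃ t : FreeNonUnitalNonAssocAlgebra K (SteinbergGenerator (Fin 4) 𝒜),
      freeLift (genLift 𝒜 (rootLift hg)) t = x := by
    refine hE.induction (P := fun x => ∃ t : FreeNonUnitalNonAssocAlgebra K
        (SteinbergGenerator (Fin 4) 𝒜), freeLift (genLift 𝒜 (rootLift hg)) t = x)
      ⟨0, map_zero _⟩ ?_ ?_ ?_ x
    · rintro _ _ ⟨s, rfl⟩ ⟨t, rfl⟩
      exact ⟨s + t, map_add _ _ _⟩
    · rintro c _ ⟨t, rfl⟩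
      exact ⟨c • t, map_smul _ _ _⟩
    · intro x y
      obtain ⟨s, hs⟩ := Presented.mk_surjective K _ _ (g x)
      obtain ⟨t, ht⟩ := Presented.mk_surjective K _ _ (g y)
      refine ⟨s * t, ?_⟩
      rw [freeLift_mul]
      exact hg.br_congr ((map_freeLift hg s).trans hs) ((map_freeLift hg t).trans ht)
  rw [map_freeLift, Presented.mk_eq_zero] at hx
  -- An element of the kernel is now the value of an element of the presentation ideal. The
  -- relations take values in the central submodule coming from `𝓦` and the axioms take the value
  -- zero, so the whole ideal maps into that submodule.
  refine presentationIdeal_le_comap (C := LinearMap.range (kernelMap hg))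
    (rootLift_isSteinbergFamily hg).genLift_mem ?_
    (fun _ hr => (rootLift_isSteinbergFamily hg).relation hr) hx
  rintro _ ⟨y, rfl⟩ z
  exact ⟨hg.br_left (map_kernelMap hg y) z, hg.br_right (map_kernelMap hg y) z⟩

end Kernel

end CentralExtensionsOfSteinberg

/-! ### The universal central extension -/

section Generic

variable {K : Type*} [CommRing K]

/-- The inverse of a bijective homomorphism. -/
def LieSuperHom.symm {L M : Type*} [AddCommGroup L] [Module K L] [LieSuperalgebra K L]
    [AddCommGroup M] [Module K M] [LieSuperalgebra K M] (f : LieSuperHom K L M)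
    (hf : Function.Bijective f) : LieSuperHom K M L where
  toLinearMap := (LinearEquiv.ofBijective f.toLinearMap hf).symm.toLinearMap
  map_gr p x hx := by
    obtain ⟨y, hy, rfl⟩ := exists_homogeneous_lift f.toLinearMap f.map_gr hf.2 hx
    change (LinearEquiv.ofBijective f.toLinearMap hf).symm (f y) ∈ _
    rwa [show (LinearEquiv.ofBijective f.toLinearMap hf).symm (f y) = y from
      (LinearEquiv.ofBijective f.toLinearMap hf).symm_apply_apply y]
  map_br x y := by
    obtain ⟨a, rfl⟩ := hf.2 x
    obtain ⟨b, rfl⟩ := hf.2 y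
    have h : ∀ a, (LinearEquiv.ofBijective f.toLinearMap hf).symm (f a) = a :=
      (LinearEquiv.ofBijective f.toLinearMap hf).symm_apply_apply
    change (LinearEquiv.ofBijective f.toLinearMap hf).symm (SuperLie.br K (f a) (f b)) =
      SuperLie.br K ((LinearEquiv.ofBijective f.toLinearMap hf).symm (f a))
        ((LinearEquiv.ofBijective f.toLinearMap hf).symm (f b))
    rw [← f.br, h, h, h]

theorem LieSuperHom.apply_symm {L M : Type*} [AddCommGroup L] [Module K L] [LieSuperalgebra K L]
    [AddCommGroup M] [Module K M] [LieSuperalgebra K M] (f : LieSuperHom K L M)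
    (hf : Function.Bijective f) (x : M) : f (f.symm hf x) = x :=
  (LinearEquiv.ofBijective f.toLinearMap hf).apply_symm_apply x

theorem IsPerfect.of_surjective {L M : Type*} [AddCommGroup L] [Module K L] [LieSuperalgebra K L]
    [AddCommGroup M] [Module K M] [LieSuperalgebra K M] {f : LieSuperHom K L M}
    (hf : Function.Surjective f) (hL : IsPerfect K L) : IsPerfect K M := by
  refine eq_top_iff.2 fun x _ => ?_
  obtain ⟨x, rfl⟩ := hf x
  exact (f.toDerived hL x).2

/-- A central extension `π : N → L` of a perfect `L` that is isomorphic to the universal one gives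
universal central extensions of all `M` such that `f : L → M` is a central extension. -/
theorem isUniversalCentralExtension_comp.{w'} {L M N : Type*}
    [AddCommGroup L] [Module K L] [LieSuperalgebra K L]
    [AddCommGroup M] [Module K M] [LieSuperalgebra K M]
    [AddCommGroup N] [Module K N] [LieSuperalgebra K N] (hL : IsPerfect K L)
    {π : LieSuperHom K N L} (hπ : IsCentralExtension π) {Q : LieSuperHom K (UniversalExt K L) N}
    (hQ : Function.Bijective Q) (hπQ : ∀ u, π (Q u) = UniversalExt.proj K L u)
    {f : LieSuperHom K L M} (hf : IsCentralExtension f) :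
    IsUniversalCentralExtension.{w'} (f.comp π) := by
  have hN : IsPerfect K N := IsPerfect.of_surjective hQ.2 (UniversalExt.isPerfect hL)
  refine ⟨hf.comp hπ hN, fun E _ _ _ g hg => ⟨(UniversalExt.lift hg f).comp (Q.symm hQ), ?_, ?_⟩⟩
  · refine LieSuperHom.ext fun x => ?_
    change g (UniversalExt.lift hg f (Q.symm hQ x)) = f (π x)
    rw [UniversalExt.map_lift, ← hπQ, Q.apply_symm]
  · intro h hh
    refine hg.hom_unique hN fun x => ?_
    change g (h x) = g (UniversalExt.lift hg f (Q.symm hQ x))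
    rw [UniversalExt.map_lift, ← hπQ, Q.apply_symm]
    exact congrArg (fun k : LieSuperHom K N M => k x) hh

variable {L W : Type*} [AddCommGroup L] [Module K L] [LieSuperalgebra K L]
  [AddCommGroup W] [Module K W] [Supermodule K W] {ψ : L →ₗ[K] L →ₗ[K] W}
  (hψ : IsEvenSuperCocycle ψ)

theorem CocycleExt.proj_isCentralExtension : IsCentralExtension (CocycleExt.proj hψ) := by
  refine ⟨fun x => ⟨((x, 0) : L × W), rfl⟩, fun x hx y => ?_⟩
  have h : x.1 = 0 := hx
  change ((br K x.1 y.1, ψ x.1 y.1) : L × W) = 0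
  rw [h]
  simp [br]

/-- The homomorphism `x ∧ y ↦ ([x, y], ψ(x, y))`. -/
def toCocycleExt : LieSuperHom K (UniversalExt K L) (CocycleExt hψ) :=
  UniversalExt.lift (CocycleExt.proj_isCentralExtension hψ) LieSuperHom.id

theorem toCocycleExt_mk (t : L ⊗[K] L) : toCocycleExt hψ (UniversalExt.mk K L t) =
    ((TensorProduct.lift (LieSuperalgebra.bracket (K := K) (L := L)) t,
      TensorProduct.lift ψ t) : L × W) := by
  induction t using TensorProduct.induction_on with
  | zero => simp only [map_zero]; rfl
  | add x y hx hy =>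
    rw [map_add, map_add, hx, hy, map_add, map_add]
    rfl
  | tmul x y =>
    exact (CocycleExt.proj_isCentralExtension hψ).lift_apply
      (show CocycleExt hψ from ((x, 0) : L × W)) (show CocycleExt hψ from ((y, 0) : L × W))

theorem proj_toCocycleExt (u : UniversalExt K L) :
    CocycleExt.proj hψ (toCocycleExt hψ u) = UniversalExt.proj K L u :=
  UniversalExt.map_lift (CocycleExt.proj_isCentralExtension hψ) LieSuperHom.id u

include hψ in
theorem lift_mem_gr_of_tensorGr {p : ZMod 2} {t : L ⊗[K] L} (ht : t ∈ tensorGr K L p) :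
    TensorProduct.lift ψ t ∈ gr K p := by
  have h := (toCocycleExt hψ).mem_gr (x := UniversalExt.mk K L t) ⟨t, ht, rfl⟩
  rw [toCocycleExt_mk] at h
  exact h.2

/-- If `x ∧ y ↦ ([x, y], ψ(x, y))` is bijective, then `ψ` identifies the second homology with the
values of the cocycle. -/
theorem exists_H₂_equiv (hQ : Function.Bijective (toCocycleExt hψ)) :
    ∃ e : H₂ K L ≃ₗ[K] W, ∀ p : ZMod 2, (H₂gr K L p).map e.toLinearMap = gr K p := by
  let c : cycles₂ K L →ₗ[K] W := TensorProduct.lift ψ ∘ₗ (cycles₂ K L).subtype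
  -- A homogeneous preimage of `(0, y)` is represented by a homogeneous tensor. Its first coordinate
  -- being zero says that the tensor is a cycle.
  have hlift : ∀ {p : ZMod 2} {y : W}, y ∈ gr K p →
      ∃ t : cycles₂ K L, (t : L ⊗[K] L) ∈ tensorGr K L p ∧ c t = y := by
    intro p y hy
    have hy' : (show CocycleExt hψ from ((0, y) : L × W)) ∈ gr K p := ⟨zero_mem _, hy⟩
    obtain ⟨u, ⟨t, ht, rfl⟩, h⟩ := exists_homogeneous_lift (toCocycleExt hψ).toLinearMap
      (toCocycleExt hψ).map_gr hQ.2 hy'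
    have h' := (toCocycleExt_mk hψ t).symm.trans h
    exact ⟨⟨t, congrArg Prod.fst h'⟩, ht, congrArg Prod.snd h'⟩
  have hs : Function.Surjective c := by
    intro y
    obtain ⟨a, ha, b, hb, rfl⟩ := exists_parts (K := K) y
    obtain ⟨s, -, rfl⟩ := hlift ha
    obtain ⟨t, -, rfl⟩ := hlift hb
    exact ⟨s + t, map_add _ _ _⟩
  -- A cycle `t` is sent to `(0, ψ(t))`, so by injectivity it is a boundary exactly when `ψ(t) = 0`.
  have hk : (boundaries₂ K L).comap (cycles₂ K L).subtype = LinearMap.ker c := by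
    ext t
    rw [Submodule.mem_comap, Submodule.subtype_apply, ← UniversalExt.mk_eq_zero,
      ← map_eq_zero_iff (toCocycleExt hψ).toLinearMap hQ.1, toCocycleExt_mk, LinearMap.mem_ker]
    have ht : TensorProduct.lift (LieSuperalgebra.bracket (K := K) (L := L)) t.1 = 0 := t.2
    exact ⟨fun h => congrArg Prod.snd h, fun h => Prod.ext ht h⟩
  refine ⟨(Submodule.quotEquivOfEq _ _ hk).trans (c.quotKerEquivOfSurjective hs), fun p => ?_⟩
  ext y
  constructor
  · rintro ⟨_, ⟨t, ht, rfl⟩, rfl⟩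
    exact lift_mem_gr_of_tensorGr hψ ht
  · intro hy
    obtain ⟨t, ht, rfl⟩ := hlift hy
    exact ⟨_, ⟨t, ht, rfl⟩, rfl⟩

end Generic

/-! ### Comparison of the universal extension with `st(3,1,A)^♯` -/

section SteinbergExtension

variable {K : Type u} [CommRing K] {A : Type v} [Ring A] [Algebra K A]
  (𝒜 : ZMod 2 → Submodule K A) [GradedAlgebra 𝒜]

/-- The element attached to `ε_σ(a)` is the class of `F_{σ0σ1}(a) ⊗ F_{σ2σ3}(1)`. Its bracket in
`st` is zero and its `ψ`-value is `ε_σ(a)`. Hence `𝓦` embeds in the kernel. -/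
theorem toCocycleExt_kernelMap (hU : IsCentralExtension (UniversalExt.proj K (Steinberg par31 𝒜)))
    (x : WModule 𝒜) :
    toCocycleExt (steinbergCocycle_isEvenSuperCocycle 𝒜) (kernelMap hU x) =
      ((0, x) : Steinberg par31 𝒜 × WModule 𝒜) := by
  have key : ∀ (σ : Equiv.Perm (Fin 4)) (a : A),
      toCocycleExt (steinbergCocycle_isEvenSuperCocycle 𝒜) (kernelMap hU (epsilon 𝒜 σ a)) =
        ((0, epsilon 𝒜 σ a) : Steinberg par31 𝒜 × WModule 𝒜) := by
    intro σ a
    have h : quadMap hU σ a = UniversalExt.mk K _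
        (rootMap par31 𝒜 (σ 0) (σ 1) a ⊗ₜ rootMap par31 𝒜 (σ 2) (σ 3) 1) := by
      obtain ⟨s, hs⟩ := hU.1 (rootMap par31 𝒜 (σ 0) (σ 1) a)
      obtain ⟨t, ht⟩ := hU.1 (rootMap par31 𝒜 (σ 2) (σ 3) 1)
      rw [quadMap_apply, ← hs, ← ht, hU.lift_apply]
      rfl
    rw [kernelMap_epsilon, h, toCocycleExt_mk]
    refine Prod.ext ?_ ?_
    · exact rootMap_comm par31 𝒜 (perm_ne σ) (perm_ne σ) (perm_ne σ) (perm_ne σ) a 1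
    · exact (steinbergCocycle_distinct 𝒜 σ a 1).trans (by rw [mul_one])
  obtain ⟨a, rfl⟩ := exists_sum_epsilon x
  rw [map_sum, map_sum, Finset.sum_congr rfl fun c _ => key c.out (a c)]
  exact (map_sum (LinearMap.inr K (Steinberg par31 𝒜) (WModule 𝒜)) _ _).symm

/-- Injectivity: an element sent to zero lies over zero in `st`, so it comes from some `w ∈ 𝓦`, and
its image is `(0, w)`. Surjectivity: lift the first coordinate and correct the second by an element
of `𝓦`. -/
theorem toCocycleExt_bijective :
    Function.Bijective (toCocycleExt (steinbergCocycle_isEvenSuperCocycle 𝒜)) := by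
  have hL := Steinberg.isPerfect par31 𝒜
  have hU := UniversalExt.proj_isCentralExtension hL
  constructor
  · refine (injective_iff_map_eq_zero _).2 fun u hu => ?_
    obtain ⟨y, rfl⟩ := exists_kernelMap_eq hU (UniversalExt.isPerfect hL) (x := u) (by
      rw [← proj_toCocycleExt (steinbergCocycle_isEvenSuperCocycle 𝒜), hu, map_zero])
    have h : y = 0 := congrArg Prod.snd ((toCocycleExt_kernelMap 𝒜 hU y).symm.trans hu)
    rw [h, map_zero]
  · intro x
    obtain ⟨u, hu⟩ := hU.1 (CocycleExt.proj _ x)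
    refine ⟨u + kernelMap hU
      (x.2 - (toCocycleExt (steinbergCocycle_isEvenSuperCocycle 𝒜) u).2), ?_⟩
    rw [map_add, toCocycleExt_kernelMap]
    refine Prod.ext ?_ ?_
    · refine (add_zero _).trans ?_
      exact (proj_toCocycleExt (steinbergCocycle_isEvenSuperCocycle 𝒜) u).trans hu
    · exact add_sub_cancel _ _

end SteinbergExtension

end SuperLie

end

open SuperLie
theorem theoremT {K : Type u} [CommRing K] {A : Type v} [Ring A] [Algebra K A]
    (𝒜 : ZMod 2 → Submodule K A) [GradedAlgebra 𝒜]
    (hA : ∃ s : Set A, (1 : A) ∈ s ∧ LinearIndependent K ((↑) : s → A) ∧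
      Submodule.span K s = ⊤) :
    ∃ ψ : Steinberg par31 𝒜 →ₗ[K] Steinberg par31 𝒜 →ₗ[K] WModule 𝒜,
      (IsSteinbergCocycle 𝒜 ψ ∧ ∀ ψ', IsSteinbergCocycle 𝒜 ψ' → ψ' = ψ) ∧
      ∃ hψ : IsEvenSuperCocycle ψ,
        IsUniversalCentralExtension.{w} (CocycleExt.proj hψ) ∧
        (∃ φ : LieSuperHom K (Steinberg par31 𝒜) (SuperSL par31 𝒜),
          (∀ (i j : Fin 4) (h : i ≠ j) (a : A),
            ((φ (stF par31 𝒜 h a) : SuperSL par31 𝒜) : SuperGL par31 𝒜) = matrixUnit par31 𝒜 i j a) ∧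
          IsUniversalCentralExtension.{w} (φ.comp (CocycleExt.proj hψ))) ∧
        ∃ e : H₂ K (Steinberg par31 𝒜) ≃ₗ[K] WModule 𝒜,
          ∀ p : ZMod 2, (H₂gr K (Steinberg par31 𝒜) p).map e.toLinearMap = gr K p := by
  have hψ := steinbergCocycle_isEvenSuperCocycle 𝒜
  have hL := Steinberg.isPerfect par31 𝒜
  have hQ := toCocycleExt_bijective 𝒜
  refine ⟨steinbergCocycle 𝒜, ⟨steinbergCocycle_isSteinbergCocycle 𝒜, fun ψ' h =>
    h.unique 𝒜 (steinbergCocycle_isSteinbergCocycle 𝒜)⟩, hψ, ?_, ⟨stToSL par31 𝒜, ?_, ?_⟩,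
    exists_H₂_equiv hψ hQ⟩
  -- Part (1) is the case of the trivial central extension of `st`, by the identity; composing with
  -- the identity leaves the projection unchanged.
  · exact isUniversalCentralExtension_comp hL (CocycleExt.proj_isCentralExtension hψ) hQ
      (proj_toCocycleExt hψ) (f := LieSuperHom.id)
      ⟨Function.surjective_id, fun x hx y => by rw [show x = 0 from hx]; simp [br]⟩
  · intro i j h a
    rw [stToSL_coe, ← rootMap_eq, stToGL_rootMap par31 𝒜 h]
    rfl
  · exact isUniversalCentralExtension_comp hL (CocycleExt.proj_isCentralExtension hψ) hQ
      (proj_toCocycleExt hψ) (stToSL_isCentralExtension par31 𝒜)
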